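/- Let $d\in\mathbb N$, let $\mathbb T^d=\mathbb R^d/\mathbb Z^d$ with normalized Haar measure $dx$, let $\mathcal V$ be a locally compact Polish space, and let $\pi$ be a Borel probability measure on $\mathcal V$. Let $\sigma\colon\mathcal V\times\mathcal V\to[0,+\infty)$ be Borel and symmetric, with $\lambda(v):=\int\sigma(v,v')\,\pi(dv')<+\infty$ for all $v$, let $b\colon\mathcal V\to\mathbb R^d$ be Borel, and assume $\int e^{\gamma\lambda}\,d\pi<+\infty$ and $\int e^{\gamma|b|}\,d\pi<+\infty$ for every $\gamma\ge 0$. For $P\in\mathcal P(\mathbb T^d\times\mathcal V)$ let $\mathcal H(P)\in[0,+\infty]$ be its relative entropy with respect to $dx\,\pi(dv)$. If $\mathcal H(P)<+\infty$, let $$\mathcal E(P)=2\sup_{\phi\in C_b(\mathbb T^d\times\mathcal V)}\iint P(dx,dv)\,\pi(dv')\,\sigma(v,v')\big[1-e^{\phi(x,v')-\phi(x,v)}\big],$$ which is the variational form of $\int dx\iint\pi(dv)\pi(dv')\,\sigma(v,v')\big[\sqrt{f(x,v')}-\sqrt{f(x,v)}\big]^2$ for $dP=f\,dx\,\pi(dv)$.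 Let $a<c$. Denote by $\mathcal S_{\mathrm{be}}[a,c]$ the set of pairs $(P,\Theta)$ where $P=(P_t)_{t\in[a,c]}$ is a weakly continuous path in $\mathcal P(\mathbb T^d\times\mathcal V)$ with $\sup_{t\in[a,c]}\mathcal H(P_t)<+\infty$ and $\Theta$ is a finite signed Borel measure on $[a,c]\times\mathbb T^d\times\mathcal V\times\mathcal V$, antisymmetric under the exchange of the last two variables. For such a pair set $$\mathcal R^{a,c}(P,\Theta)=\sup_{\zeta,\alpha}\Big\{\Theta(\zeta)-\int_a^c\!dt\iiint P_t(dx,dv)\,\pi(dv')\,\sigma(v,v')\big[\cosh\zeta(t,x,v,v')-1\big]\big[\alpha(t,x,v,v')+\alpha(t,x,v',v)^{-1}\big]\Big\},$$ where $\zeta$ ranges over the compactly supported continuous real functions on $[a,c]\times\mathbb T^d\times\mathcal V\times\mathcal V$ antisymmetric in the last two variables, and $\alpha$ over the bounded continuous positive functions on that space that are bounded away from zero. The pair satisfies the balance equation on $[a,c]$ if $$\int_a^c P_t\big(\partial_t\phi+b\cdot\nabla_x\phi\big)\,dt=\frac12\int\Theta(dt,dx,dv,dv')\,\big[\phi(t,x,v)-\phi(t,x,v')\big]$$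 for all continuous, compactly supported $\phi\colon(a,c)\times\mathbb T^d\times\mathcal V\to\mathbb R$ that are continuously differentiable in the first two variables. If $\mathcal H(Q)<+\infty$, a solution to the linear Boltzmann equation on $[a,c]$ with initial condition $Q$ is a pair $(P,\Theta)\in\mathcal S_{\mathrm{be}}[a,c]$ with $P_a=Q$ that satisfies the balance equation on $[a,c]$ and $\mathcal H(P_c)+\int_a^c\mathcal E(P_u)\,du+\mathcal R^{a,c}(P,\Theta)\le\mathcal H(Q)$. Let $T>0$, and denote by $\Theta_{[s,t]}$ the restriction of $\Theta$ to times in $[s,t]$. 1. If $(P,\Theta)\in\mathcal S_{\mathrm{be}}[0,T]$ satisfies the balance equation on $[0,T]$, then for all $0\le s<t\le T$ $$\mathcal H(P_t)+\int_s^t\mathcal E(P_u)\,du+\mathcal R^{s,t}(P,\Theta_{[s,t]})\ \ge\ \mathcal H(P_s).$$ 2. Consequently, if $(P,\Theta)$ is a solution on $[0,T]$ with initial condition $Q$, then for every $0<t\le T$ its restriction $(P|_{[0,t]},\Theta_{[0,t]})$ is a solution on $[0,t]$ with initial condition $Q$; more generally, for all $0\le s<t\le T$ the restriction $(P|_{[s,t]},\Theta_{[s,t]})$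 is a solution on $[s,t]$ with initial condition $P_s$. -/

import Mathlib

open MeasureTheory Set Topology
open scoped ENNReal

noncomputable section

namespace LinearBoltzmann

/-- The torus `ℝ^d / ℤ^d`; its `volume` is the normalized Haar measure. -/
abbrev Torus (d : ℕ) : Type := UnitAddTorus (Fin d)

/-- The canonical projection `ℝ^d → ℝ^d / ℤ^d`. -/
def toTorus {d : ℕ} (y : EuclideanSpace ℝ (Fin d)) : Torus d :=
  fun i => ((y i : ℝ) : UnitAddCircle)

/-- The gradient at `x` of a function on the torus, computed on its lift to `ℝ^d`. -/
def torusGradient {d : ℕ} (g : Torus d → ℝ) (x : Torus d) : EuclideanSpace ℝ (Fin d) :=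
  gradient (fun y : EuclideanSpace ℝ (Fin d) => g (x + toTorus y)) 0

/-- The scattering rate `λ(v) = ∫ σ(v,v') π(dv')`. -/
def scatteringRate {V : Type*} [MeasurableSpace V] (π : Measure V) (σ : V → V → ℝ) (v : V) : ℝ :=
  ∫ v', σ v v' ∂π

/-- The standing assumptions on the scattering kernel `σ` and on the drift `b`. -/
structure Admissible {d : ℕ} {V : Type*} [MeasurableSpace V] (π : Measure V)
    (σ : V → V → ℝ) (b : V → EuclideanSpace ℝ (Fin d)) : Prop where
  measurable_kernel : Measurable (fun p : V × V => σ p.1 p.2)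
  kernel_nonneg : ∀ v v', 0 ≤ σ v v'
  kernel_symm : ∀ v v', σ v v' = σ v' v
  /-- The scattering rate is finite. -/
  integrable_kernel : ∀ v, Integrable (fun v' => σ v v') π
  exp_moment_rate : ∀ γ : ℝ, 0 ≤ γ → Integrable (fun v => Real.exp (γ * scatteringRate π σ v)) π
  measurable_drift : Measurable b
  exp_moment_drift : ∀ γ : ℝ, 0 ≤ γ → Integrable (fun v => Real.exp (γ * ‖b v‖)) π

section Functionals

variable {d : ℕ} {V : Type*} [TopologicalSpace V] [PolishSpace V] [MeasurableSpace V]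
  [BorelSpace V]

/-- Relative entropy of `P` with respect to `dx π(dv)`, with values in `[0,+∞]`. -/
def entropy (π : Measure V) (P : ProbabilityMeasure (Torus d × V)) : ℝ≥0∞ :=
  InformationTheory.klDiv (P : Measure (Torus d × V)) ((volume : Measure (Torus d)).prod π)

/-- Dirichlet form of the square root, i.e. `∫ dx ∬ π(dv) π(dv') σ(v,v') (√f(x,v') - √f(x,v))²`
if `dP = f dx π(dv)`, for `P` of finite entropy, through its variational formula
`2 sup_φ ∬ P(dx,dv) π(dv') σ(v,v') [1 - exp (φ(x,v') - φ(x,v))]`.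
The choice `φ = 0` gives the value `0`, so that `ENNReal.ofReal` does not change the supremum. -/
def dirichletForm (π : Measure V) (σ : V → V → ℝ) (P : ProbabilityMeasure (Torus d × V)) :
    ℝ≥0∞ :=
  2 * ⨆ φ : BoundedContinuousFunction (Torus d × V) ℝ,
    ENNReal.ofReal
      (∫ z : (Torus d × V) × V,
        σ z.1.2 z.2 * (1 - Real.exp (φ (z.1.1, z.2) - φ (z.1.1, z.1.2)))
        ∂((P : Measure (Torus d × V)).prod π))

/-- The test functions `ζ`: continuous, with compact support, and antisymmetric with respect to
the exchange of the last two variables. The continuous compactly supported functions on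
`[a,b] × 𝕋^d × V × V` are exactly the restrictions of those on `ℝ × 𝕋^d × V × V`. -/
structure IsCurrentTest (ζ : ℝ × Torus d × V × V → ℝ) : Prop where
  continuous : Continuous ζ
  hasCompactSupport : HasCompactSupport ζ
  antisymm : ∀ t x v v', ζ (t, x, v', v) = -ζ (t, x, v, v')

/-- The test functions `α`: continuous, bounded, with values in `(0,+∞)` and uniformly bounded away
from zero. Those on `[a,b] × 𝕋^d × V × V` are exactly the restrictions of those on
`ℝ × 𝕋^d × V × V`. -/
structure IsWeightTest (α : ℝ × Torus d × V × V → ℝ) : Prop where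
  continuous : Continuous α
  bounded : ∃ C : ℝ, ∀ z, α z ≤ C
  bounded_below : ∃ c : ℝ, 0 < c ∧ ∀ z, c ≤ α z

/-- The kinematic term on the time interval `[a,b]`, for a signed measure `Θ` on
`[a,b] × 𝕋^d × V × V`. The choice `ζ = 0` gives the value `0`, so that `ENNReal.ofReal` does not
change the supremum. -/
def kinematicTerm (π : Measure V) (σ : V → V → ℝ) (a b : ℝ)
    (P : ℝ → ProbabilityMeasure (Torus d × V)) (Θ : SignedMeasure (ℝ × Torus d × V × V)) :
    ℝ≥0∞ :=
  ⨆ (ζ : ℝ × Torus d × V × V → ℝ) (_ : IsCurrentTest ζ)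
    (α : ℝ × Torus d × V × V → ℝ) (_ : IsWeightTest α),
    ENNReal.ofReal
      ((∫ᵛ z, ζ z ∂•Θ) -
        ∫ t in a..b, ∫ z : (Torus d × V) × V,
          σ z.1.2 z.2 * (Real.cosh (ζ (t, z.1.1, z.1.2, z.2)) - 1) *
            (α (t, z.1.1, z.1.2, z.2) + (α (t, z.1.1, z.2, z.1.2))⁻¹)
          ∂((P t : Measure (Torus d × V)).prod π))

/-- Restriction of a measure on `ℝ × 𝕋^d × V × V` to the times in `[a,b]`. -/
def restrictTime (Θ : SignedMeasure (ℝ × Torus d × V × V)) (a b : ℝ) :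
    SignedMeasure (ℝ × Torus d × V × V) :=
  Θ.restrict (Icc a b ×ˢ univ)

/-- The pairs with bounded entropy on `[a,b]`: `P` is a weakly continuous path of probabilities
with bounded entropy on `[a,b]` (its values at other times play no role) and `Θ` is a finite signed
measure on `[a,b] × 𝕋^d × V × V`, antisymmetric in the last two variables. -/
structure IsBoundedEntropyPair (π : Measure V) (a b : ℝ)
    (P : ℝ → ProbabilityMeasure (Torus d × V)) (Θ : SignedMeasure (ℝ × Torus d × V × V)) :
    Prop where
  continuousOn : ContinuousOn P (Icc a b)
  bounded_entropy : (⨆ t ∈ Icc a b, entropy π (P t)) < ⊤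
  concentrated : restrictTime Θ a b = Θ
  antisymm : VectorMeasure.map Θ
    (fun z : ℝ × Torus d × V × V => (z.1, z.2.1, z.2.2.2, z.2.2.1)) = -Θ

/-- The test functions of the balance equation on `(a,b) × 𝕋^d × V`: continuous, with compact
support in `(a,b) × 𝕋^d × V` (and extended by zero to all times), continuously differentiable in
the first two variables. -/
structure IsBalanceTest (a b : ℝ) (φ : ℝ × Torus d × V → ℝ) : Prop where
  continuous : Continuous φ
  hasCompactSupport : HasCompactSupport φ
  support_subset : tsupport φ ⊆ Ioo a b ×ˢ univ
  contDiff : ∀ v, ContDiff ℝ 1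
    (fun y : ℝ × EuclideanSpace ℝ (Fin d) => φ (y.1, toTorus y.2, v))
  continuous_deriv : Continuous
    (fun z : ℝ × Torus d × V => deriv (fun t => φ (t, z.2.1, z.2.2)) z.1)
  continuous_gradient : Continuous
    (fun z : ℝ × Torus d × V => torusGradient (fun x => φ (z.1, x, z.2.2)) z.2.1)

/-- The weak form of `(∂_t + b(v)·∇_x) P + ∫ Θ(·,dv') = 0` on the time interval `(a,c)`. -/
def BalanceEquation (b : V → EuclideanSpace ℝ (Fin d)) (a c : ℝ)
    (P : ℝ → ProbabilityMeasure (Torus d × V)) (Θ : SignedMeasure (ℝ × Torus d × V × V)) :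
    Prop :=
  ∀ φ : ℝ × Torus d × V → ℝ, IsBalanceTest a c φ →
    ∫ t in a..c, ∫ z : Torus d × V,
        (deriv (fun u => φ (u, z.1, z.2)) t +
          inner ℝ (b z.2) (torusGradient (fun x => φ (t, x, z.2)) z.1))
        ∂(P t : Measure (Torus d × V)) =
      (1 / 2) * ∫ᵛ z, (φ (z.1, z.2.1, z.2.2.1) - φ (z.1, z.2.1, z.2.2.2)) ∂•Θ

/-- `(P, Θ)` is a solution to the linear Boltzmann equation on the time interval `[a,c]` with
initial condition `Q`. -/
structure IsSolution (π : Measure V) (σ : V → V → ℝ) (b : V → EuclideanSpace ℝ (Fin d)) (a c : ℝ)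
    (Q : ProbabilityMeasure (Torus d × V))
    (P : ℝ → ProbabilityMeasure (Torus d × V)) (Θ : SignedMeasure (ℝ × Torus d × V × V)) :
    Prop where
  entropy_initial : entropy π Q < ⊤
  pair : IsBoundedEntropyPair π a c P Θ
  initial : P a = Q
  balance : BalanceEquation b a c P Θ
  entropy_dissipation :
    entropy π (P c) + (∫⁻ u in Icc a c, dirichletForm π σ (P u)) + kinematicTerm π σ a c P Θ
      ≤ entropy π Q

end Functionals

end LinearBoltzmann

end

/-!
# Entropy inequality and restriction of solutions for the linear Boltzmann equation

The heart of the matter is that the entropy inequality is a chain rule. Formally, if `P` has density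
`ρ` and `Θ` is the current in the balance equation, then the antisymmetry of `Θ` gives
`H(P_a) - H(P_c) = Θ(ζ)` with `ζ(v,v') = (log ρ(v) - log ρ(v')) / 2`. The choice
`α = √(ρ(v') / ρ(v))` of the weight in the kinematic term `R` yields
`Θ(ζ) ≤ R + ∫ 2 σ √(ρ(v) ρ(v')) (cosh ζ - 1)`, and for this `ζ` the last integrand is precisely
`σ (√ρ(v) - √ρ(v'))²`, the integrand of the Dirichlet form.

The rigorous version runs as follows. The kinematic term may be taken to be finite. Its variational
formula extends to bounded measurable test functions (`ofReal_le_kinematicTerm_of_measurable`),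
hence `Θ` has a density `g` with respect to `dt dx π(dv) π(dv')`
(`absolutelyContinuous_of_kinematicTerm_ne_top`), and the weight can be optimized
(`ofReal_vectorIntegral_le`). The Dirichlet form dominates its expression in terms of the density
(`lintegral_sqrt_sub_sqrt_le_dirichletForm`). The chain rule is proved along the free flow
`y ↦ y + t b(v)`, which preserves `dx π(dv)`. Testing the balance equation with plane waves that
travel with the flow, and using that the integrals of bounded measurable functions are continuous
in time along a path with bounded entropy, one finds that in the moving frame the density is,
for almost every starting point, a primitive in time of `-∫ g π(dv')`
(`flowDensity_eq_sub_integral`). The one-dimensional chain rule can therefore be applied on almost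
every trajectory to the truncation of the entropy whose derivative is the logarithm truncated to
`[1/(n+1), n+1]` (`integral_truncEntropy_sub`). Truncation only decreases `|ζ|`, so the cost stays
below the Dirichlet form, and `n → ∞` gives the inequality (`entropy_le_add_kinematicTerm`).

For the restriction of solutions, the kinematic term is superadditive in time
(`kinematicTerm_add_le`), since measurable test functions can be glued. On `[0,T]` the dissipation
inequality bounds from above the sum of the contributions of `[0,s]`, `[s,t]` and `[t,T]`; the
entropy inequality bounds the contributions of `[0,s]` and `[t,T]` from below by the entropy
differences; these are finite, and subtracting them leaves the dissipation inequality on `[s,t]`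
(`IsSolution.restrict`).
-/

open MeasureTheory Set Topology Filter
open scoped ENNReal

noncomputable section

namespace LinearBoltzmann

/-! ### Approximation by continuous functions and integration against signed measures -/

/-- Continuous compactly supported functions approximate an integrable function simultaneously in
`L¹` and almost everywhere. -/
lemma exists_seq_continuous_tendsto_ae_and_integral {X : Type*} [TopologicalSpace X]
    [PolishSpace X] [LocallyCompactSpace X] [MeasurableSpace X] [BorelSpace X]
    (μ : Measure X) [IsFiniteMeasure μ] {g : X → ℝ} (hg : Integrable g μ) :
    ∃ G : ℕ → X → ℝ, (∀ n, Continuous (G n)) ∧ (∀ n, HasCompactSupport (G n)) ∧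
      (∀ n, Integrable (G n) μ) ∧
      Tendsto (fun n => ∫ x, |G n x - g x| ∂μ) atTop (𝓝 0) ∧
      ∀ᵐ x ∂μ, Tendsto (fun n => G n x) atTop (𝓝 (g x)) := by
  let := TopologicalSpace.upgradeIsCompletelyMetrizable X
  have h1 : ∀ n : ℕ, ∃ G : X → ℝ, HasCompactSupport G ∧
      eLpNorm (g - G) 1 μ ≤ ENNReal.ofReal (1 / ((n : ℝ) + 1)) ∧ Continuous G ∧ MemLp G 1 μ :=
    fun n => (memLp_one_iff_integrable.2 hg).exists_hasCompactSupport_eLpNorm_sub_le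
      ENNReal.one_ne_top (by simp only [ne_eq, ENNReal.ofReal_eq_zero, not_le]; positivity)
  choose G hG1 hG2 hG3 hG4 using h1
  have hlim : Tendsto (fun n => eLpNorm (G n - g) 1 μ) atTop (𝓝 0) := by
    have h0 : Tendsto (fun n : ℕ => ENNReal.ofReal (1 / ((n : ℝ) + 1))) atTop (𝓝 0) := by
      simpa using (ENNReal.tendsto_ofReal tendsto_one_div_add_atTop_nhds_zero_nat)
    refine tendsto_of_tendsto_of_tendsto_of_le_of_le tendsto_const_nhds h0 (fun _ => zero_le)
      (fun n => ?_)
    rw [eLpNorm_sub_comm]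
    exact hG2 n
  obtain ⟨ns, hns, hae⟩ := (tendstoInMeasure_of_tendsto_eLpNorm one_ne_zero
    (fun n => (hG3 n).aestronglyMeasurable) hg.aestronglyMeasurable hlim).exists_seq_tendsto_ae
  have hint : ∀ n, Integrable (G n) μ := fun n => memLp_one_iff_integrable.1 (hG4 n)
  refine ⟨fun n => G (ns n), fun n => hG3 _, fun n => hG1 _, fun n => hint _, ?_, hae⟩
  have h2 := (ENNReal.tendsto_toReal ENNReal.zero_ne_top).comp (hlim.comp hns.tendsto_atTop)
  refine h2.congr (fun n => ?_)
  simp only [Function.comp, eLpNorm_one_eq_lintegral_enorm, Pi.sub_apply]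
  exact (integral_norm_eq_lintegral_enorm ((hint _).sub hg).aestronglyMeasurable).symm

/-- Continuous compactly supported functions approximate a bounded function almost everywhere,
with the same bound. -/
lemma exists_seq_continuous_bounded_tendsto_ae {X : Type*} [TopologicalSpace X]
    [PolishSpace X] [LocallyCompactSpace X] [MeasurableSpace X] [BorelSpace X]
    (μ : Measure X) [IsFiniteMeasure μ] {g : X → ℝ} (hg : Measurable g) {C : ℝ}
    (hC : ∀ x, |g x| ≤ C) :
    ∃ G : ℕ → X → ℝ, (∀ n, Continuous (G n)) ∧ (∀ n, HasCompactSupport (G n)) ∧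
      (∀ n x, |G n x| ≤ C) ∧ ∀ᵐ x ∂μ, Tendsto (fun n => G n x) atTop (𝓝 (g x)) := by
  rcases isEmpty_or_nonempty X with hX | ⟨⟨x0⟩⟩
  · exact ⟨fun _ => g, fun n => by fun_prop, fun n => HasCompactSupport.of_compactSpace _,
      fun n => hC, Eventually.of_forall fun x => tendsto_const_nhds⟩
  have hC0 : 0 ≤ C := (abs_nonneg _).trans (hC x0)
  obtain ⟨G, h1, h2, -, -, h5⟩ := exists_seq_continuous_tendsto_ae_and_integral μ
    (Integrable.of_bound hg.aestronglyMeasurable C (Eventually.of_forall hC))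
  refine ⟨fun n x => max (-C) (min C (G n x)), fun n => by fun_prop, fun n => ?_, fun n x => ?_, ?_⟩
  · exact (h2 n).comp_left (g := fun r => max (-C) (min C r)) (by simp [hC0])
  · rw [abs_le]
    exact ⟨le_max_left _ _, max_le (by linarith) (min_le_left _ _)⟩
  · filter_upwards [h5] with x hx
    have h := (tendsto_const_nhds (x := -C)).max ((tendsto_const_nhds (x := C)).min hx)
    rwa [min_eq_right (abs_le.1 (hC x)).2, max_eq_right (abs_le.1 (hC x)).1] at h

instance isFiniteMeasure_variation {X : Type*} [MeasurableSpace X] (Θ : SignedMeasure X) :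
    IsFiniteMeasure Θ.variation := by
  rw [← SignedMeasure.totalVariation_eq_variation]
  infer_instance

lemma integrable_variation_of_bound {X : Type*} [MeasurableSpace X] (Θ : SignedMeasure X)
    {F : X → ℝ} (hF : Measurable F) {C : ℝ} (hC : ∀ x, |F x| ≤ C) : Θ.Integrable F :=
  Integrable.of_bound hF.aestronglyMeasurable C (Eventually.of_forall hC)

lemma vectorIntegral_toSignedMeasure {X : Type*} [MeasurableSpace X] (μ : Measure X)
    [IsFiniteMeasure μ] (F : X → ℝ) : ∫ᵛ x, F x ∂•μ.toSignedMeasure = ∫ x, F x ∂μ := by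
  rw [← VectorMeasure.integral_toSignedMeasure]
  congr 1
  ext
  simp

lemma vectorIntegral_withDensity {X : Type*} [MeasurableSpace X] {μ : Measure X} {g : X → ℝ}
    (hgm : Measurable g) (hg : Integrable g μ) {F : X → ℝ} (hF : Measurable F) {C : ℝ}
    (hC : ∀ x, |F x| ≤ C) :
    ∫ᵛ x, F x ∂•(μ.withDensityᵥ g) = ∫ x, F x * g x ∂μ := by
  have := isFiniteMeasure_withDensity_ofReal hg.2
  have := isFiniteMeasure_withDensity_ofReal hg.neg.2
  have key : ∀ f : X → ℝ, Measurable f → ∫ x, F x ∂(μ.withDensity fun x => ENNReal.ofReal (f x)) =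
      ∫ x, F x * max (f x) 0 ∂μ := by
    intro f hf
    rw [integral_withDensity_eq_integral_toReal_smul (by fun_prop) (by simp)]
    refine integral_congr_ae (Eventually.of_forall fun x => ?_)
    simp [ENNReal.toReal_ofReal', mul_comm]
  have hi : ∀ f : X → ℝ, Integrable f μ → Integrable (fun x => F x * max (f x) 0) μ := by
    intro f hf
    exact hf.pos_part.bdd_mul hF.aestronglyMeasurable (Eventually.of_forall hC)
  rw [withDensityᵥ_eq_withDensity_pos_part_sub_withDensity_neg_part hg,
    VectorMeasure.integral_sub_vectorMeasure (integrable_variation_of_bound _ hF hC)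
      (integrable_variation_of_bound _ hF hC),
    vectorIntegral_toSignedMeasure, vectorIntegral_toSignedMeasure, key _ hgm]
  rw [show (fun x => ENNReal.ofReal (-g x)) = fun x => ENNReal.ofReal ((-g) x) from rfl,
    key _ hgm.neg, ← integral_sub (hi _ hg) (hi _ hg.neg)]
  refine integral_congr_ae (Eventually.of_forall fun x => ?_)
  simp only [Pi.neg_apply, ← mul_sub, max_zero_sub_eq_self]

/-! ### Densities of paths with bounded entropy -/

instance isProbabilityMeasure_volume_torus (d : ℕ) :
    IsProbabilityMeasure (volume : Measure (Torus d)) := by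
  have : IsProbabilityMeasure (volume : Measure UnitAddCircle) := ⟨UnitAddCircle.measure_univ⟩
  rw [volume_pi]
  infer_instance

/-- The reference measure `dx π(dv)` on the phase space. -/
abbrev phase (d : ℕ) {V : Type*} [MeasurableSpace V] (π : Measure V) : Measure (Torus d × V) :=
  (volume : Measure (Torus d)).prod π

/-- The reference measure `dx π(dv) π(dv')` on the space of collisions. -/
abbrev collision (d : ℕ) {V : Type*} [MeasurableSpace V] (π : Measure V) :
    Measure (Torus d × V × V) :=
  (volume : Measure (Torus d)).prod (π.prod π)

/-- The reference measure `dt dx π(dv) π(dv')` for collisions at times in `[a,c]`. -/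
abbrev timeCollision (d : ℕ) {V : Type*} [MeasurableSpace V] (π : Measure V) (a c : ℝ) :
    Measure (ℝ × Torus d × V × V) :=
  ((volume : Measure ℝ).restrict (Icc a c)).prod (collision d π)

/-- `ρ` is a nonnegative, jointly measurable density of the path `P` with respect to `dx π(dv)` at
all times in `[a,c]`. -/
structure IsDensityPath {d : ℕ} {V : Type*} [MeasurableSpace V] (π : Measure V) (a c : ℝ)
    (P : ℝ → Measure (Torus d × V)) (ρ : ℝ × Torus d × V → ℝ) : Prop where
  measurable : Measurable ρ
  nonneg : ∀ z, 0 ≤ ρ z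
  eq : ∀ t ∈ Icc a c, P t = (phase d π).withDensity (fun z => ENNReal.ofReal (ρ (t, z)))

lemma IsDensityPath.measurable_slice {d : ℕ} {V : Type*} [MeasurableSpace V] {π : Measure V}
    {a c : ℝ} {P : ℝ → Measure (Torus d × V)} {ρ : ℝ × Torus d × V → ℝ}
    (hρ : IsDensityPath π a c P ρ) (t : ℝ) : Measurable (fun z => ρ (t, z)) :=
  hρ.measurable.comp (by fun_prop)

lemma measurable_measure_of_continuous {X : Type*} [TopologicalSpace X] [PolishSpace X]
    [MeasurableSpace X] [BorelSpace X] {Q : ℝ → ProbabilityMeasure X} (hQ : Continuous Q) :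
    Measurable (fun t => (Q t : Measure X)) := by
  refine Measurable.measure_of_isPiSystem_of_isProbabilityMeasure (S := {s | IsOpen s})
    (BorelSpace.measurable_eq.trans rfl) isPiSystem_isOpen (fun s hs => ?_)
  refine LowerSemicontinuous.measurable (lowerSemicontinuous_iff_le_liminf.2 fun t => ?_)
  exact ProbabilityMeasure.le_liminf_measure_open_of_tendsto (hQ.tendsto t) hs

lemma absolutelyContinuous_of_entropy_lt_top {d : ℕ} {V : Type*} [MeasurableSpace V] {π : Measure V}
    {Q : ProbabilityMeasure (Torus d × V)}
    (h : entropy π Q < ⊤) : (Q : Measure (Torus d × V)) ≪ phase d π :=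
  (InformationTheory.klDiv_ne_top_iff.1 h.ne).1

/-- The relative entropy as an integral of the density. -/
lemma entropy_eq_lintegral_klFun {d : ℕ} {V : Type*} [MeasurableSpace V] {π : Measure V}
    [IsProbabilityMeasure π] {Q : ProbabilityMeasure (Torus d × V)} {f : Torus d × V → ℝ}
    (hf : Measurable f) (hf0 : ∀ z, 0 ≤ f z)
    (hQ : (Q : Measure (Torus d × V)) = (phase d π).withDensity (fun z => ENNReal.ofReal (f z))) :
    entropy π Q = ∫⁻ z, ENNReal.ofReal (InformationTheory.klFun (f z)) ∂(phase d π) := by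
  have hac : (Q : Measure (Torus d × V)) ≪ phase d π := by
    rw [hQ]; exact withDensity_absolutelyContinuous _ _
  rw [entropy, InformationTheory.klDiv_eq_lintegral_klFun_of_ac hac]
  refine lintegral_congr_ae ?_
  have h := Measure.rnDeriv_withDensity (phase d π) hf.ennreal_ofReal
  rw [← hQ] at h
  filter_upwards [h] with z hz
  rw [hz, ENNReal.toReal_ofReal (hf0 z)]

/-- Young's inequality for the entropy function and its Legendre conjugate `exp - 1`. -/
lemma mul_le_klFun_add_exp {f : ℝ} (hf : 0 ≤ f) (g : ℝ) :
    f * g ≤ InformationTheory.klFun f + (Real.exp g - 1) := by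
  rw [InformationTheory.klFun_apply]
  rcases hf.eq_or_lt with rfl | hf
  · simpa using (Real.exp_pos g).le
  · have h := Real.add_one_le_exp (g - Real.log f)
    rw [Real.exp_sub, Real.exp_log hf, le_div_iff₀ hf] at h
    linarith

/-- The entropy inequality. -/
lemma lintegral_le_entropy_add {d : ℕ} {V : Type*} [MeasurableSpace V] {π : Measure V}
    [IsProbabilityMeasure π] {Q : ProbabilityMeasure (Torus d × V)} {g : Torus d × V → ℝ}
    (hg : Measurable g) (hg0 : ∀ z, 0 ≤ g z) :
    ∫⁻ z, ENNReal.ofReal (g z) ∂(Q : Measure (Torus d × V)) ≤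
      entropy π Q + ∫⁻ z, ENNReal.ofReal (Real.exp (g z) - 1) ∂(phase d π) := by
  by_cases hQ : entropy π Q < ⊤
  swap
  · simp only [not_lt, top_le_iff] at hQ
    simp [hQ]
  have hac := absolutelyContinuous_of_entropy_lt_top hQ
  rw [entropy, InformationTheory.klDiv_eq_lintegral_klFun_of_ac hac, ← lintegral_add_left
    (by have := InformationTheory.measurable_klFun; fun_prop),
    ← lintegral_rnDeriv_mul hac (by fun_prop)]
  refine lintegral_mono_ae ?_
  filter_upwards [Measure.rnDeriv_ne_top (Q : Measure (Torus d × V)) (phase d π)] with z hz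
  rw [← ENNReal.ofReal_add (InformationTheory.klFun_nonneg ENNReal.toReal_nonneg)
    (by simpa using hg0 z)]
  calc _ = ENNReal.ofReal (((Q : Measure (Torus d × V)).rnDeriv (phase d π) z).toReal * g z) := by
        rw [ENNReal.ofReal_mul ENNReal.toReal_nonneg, ENNReal.ofReal_toReal hz]
    _ ≤ _ := ENNReal.ofReal_le_ofReal (mul_le_klFun_add_exp ENNReal.toReal_nonneg _)

/-- A bounded sequence that vanishes in the limit almost everywhere for the reference measure
vanishes in the limit in `L¹`, uniformly over the measures with bounded entropy. -/
lemma tendsto_iSup_lintegral_of_entropy_le {d : ℕ} {V : Type*} [MeasurableSpace V] {π : Measure V}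
    [IsProbabilityMeasure π] {H : ℝ≥0∞} (hH : H < ⊤)
    {ι : Type*} {l : Filter ι}
    [l.IsCountablyGenerated] {g : ι → Torus d × V → ℝ} (hg : ∀ i, Measurable (g i))
    (hg0 : ∀ i z, 0 ≤ g i z) {C : ℝ} (hC : ∀ i z, g i z ≤ C)
    (hlim : ∀ᵐ z ∂(phase d π), Tendsto (fun i => g i z) l (𝓝 0)) :
    Tendsto (fun i => ⨆ (Q : ProbabilityMeasure (Torus d × V)) (_ : entropy π Q ≤ H),
      ∫⁻ z, ENNReal.ofReal (g i z) ∂(Q : Measure (Torus d × V))) l (𝓝 0) := by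
  rw [ENNReal.tendsto_nhds_zero]
  intro ε hε
  -- choose `γ` with `H / γ < ε / 2`, then let `∫ (exp (γ g) - 1)` vanish
  obtain ⟨γ, hγ0, hγ⟩ : ∃ γ : ℝ, 0 < γ ∧ H < ENNReal.ofReal γ * (ε / 2) := by
    rcases eq_or_ne ε ⊤ with rfl | hε'
    · exact ⟨1, one_pos, by simpa [ENNReal.top_div_of_ne_top] using hH⟩
    · have hε2 : 0 < (ε / 2).toReal :=
        ENNReal.toReal_pos (ENNReal.half_pos hε.ne').ne' (ENNReal.div_lt_top hε' (by simp)).ne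
      refine ⟨(H.toReal + 1) / (ε / 2).toReal, by positivity, ?_⟩
      rw [← ENNReal.ofReal_toReal (ENNReal.div_lt_top hε' (by simp : (2 : ℝ≥0∞) ≠ 0)).ne,
        ← ENNReal.ofReal_mul (by positivity), ENNReal.toReal_ofReal hε2.le,
        div_mul_cancel₀ _ hε2.ne']
      rw [← ENNReal.ofReal_toReal hH.ne, ENNReal.toReal_ofReal ENNReal.toReal_nonneg]
      exact (ENNReal.ofReal_lt_ofReal_iff (by positivity)).2 (by linarith)
  have hexp : Tendsto (fun i => ∫⁻ z, ENNReal.ofReal (Real.exp (γ * g i z) - 1) ∂(phase d π))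
      l (𝓝 0) := by
    rw [show (0 : ℝ≥0∞) = ∫⁻ z, (0 : ℝ≥0∞) ∂(phase d π) by simp]
    refine tendsto_lintegral_filter_of_dominated_convergence
      (fun _ => ENNReal.ofReal (Real.exp (γ * C) - 1))
      (Eventually.of_forall fun i => by have := hg i; fun_prop)
      (Eventually.of_forall fun i => Eventually.of_forall fun z => ?_) (by simp) ?_
    · have := hC i z
      gcongr
    · filter_upwards [hlim] with z hz
      have h1 : Tendsto (fun i => Real.exp (γ * g i z) - 1) l (𝓝 (Real.exp (γ * 0) - 1)) :=
        ((Real.continuous_exp.tendsto _).comp (hz.const_mul γ)).sub_const 1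
      simpa using ENNReal.tendsto_ofReal h1
  have hpos : 0 < ENNReal.ofReal γ * (ε / 2) :=
    ENNReal.mul_pos (by simpa using hγ0) (ENNReal.half_pos hε.ne').ne'
  filter_upwards [ENNReal.tendsto_nhds_zero.1 hexp _ hpos] with i hi
  refine iSup₂_le fun Q hQ => ?_
  have h1 := lintegral_le_entropy_add (π := π) (Q := Q) (g := fun z => γ * g i z)
    (by have := hg i; fun_prop) (fun z => mul_nonneg hγ0.le (hg0 i z))
  have h2 : ∫⁻ z, ENNReal.ofReal (γ * g i z) ∂(Q : Measure (Torus d × V)) =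
      ENNReal.ofReal γ * ∫⁻ z, ENNReal.ofReal (g i z) ∂(Q : Measure (Torus d × V)) := by
    rw [← lintegral_const_mul' _ _ ENNReal.ofReal_ne_top]
    simp_rw [ENNReal.ofReal_mul hγ0.le]
  rw [h2] at h1
  have h3 : ENNReal.ofReal γ * ∫⁻ z, ENNReal.ofReal (g i z) ∂(Q : Measure (Torus d × V)) ≤
      ENNReal.ofReal γ * ε := by
    refine h1.trans ((add_le_add (hQ.trans hγ.le) hi).trans ?_)
    rw [← mul_add, ENNReal.add_halves]
  exact (ENNReal.mul_le_mul_iff_right (by simpa using hγ0) ENNReal.ofReal_ne_top).1 h3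

section

variable {d : ℕ} {V : Type*} [TopologicalSpace V] [PolishSpace V] [MeasurableSpace V]
  [BorelSpace V] {π : Measure V} [IsProbabilityMeasure π]

/-- A weakly continuous path of absolutely continuous measures has a jointly measurable density. -/
lemma exists_isDensityPath {a c : ℝ} (hac : a ≤ c) {P : ℝ → ProbabilityMeasure (Torus d × V)}
    (hP : ContinuousOn P (Icc a c))
    (hac' : ∀ t ∈ Icc a c, (P t : Measure (Torus d × V)) ≪ phase d π) :
    ∃ ρ : ℝ × Torus d × V → ℝ,
      IsDensityPath π a c (fun t => (P t : Measure (Torus d × V))) ρ := by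
  have hcont : Continuous (fun t => P (projIcc a c hac t)) :=
    (continuousOn_iff_continuous_domRestrict.1 hP).comp continuous_projIcc
  let κ : ProbabilityTheory.Kernel ℝ (Torus d × V) :=
    ⟨_, measurable_measure_of_continuous hcont⟩
  have hκ : ∀ t, κ t = (P (projIcc a c hac t) : Measure (Torus d × V)) := fun t => rfl
  have : ProbabilityTheory.IsMarkovKernel κ := ⟨fun t => by rw [hκ]; infer_instance⟩
  let η : ProbabilityTheory.Kernel ℝ (Torus d × V) := ProbabilityTheory.Kernel.const ℝ (phase d π)
  refine ⟨fun z => (κ.rnDeriv η z.1 z.2).toReal, ?_, fun _ => ENNReal.toReal_nonneg, ?_⟩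
  · exact (ProbabilityTheory.Kernel.measurable_rnDeriv κ η).ennreal_toReal
  · intro t ht
    have hp : κ t = P t := by rw [hκ, projIcc_of_mem hac ht]
    have h1 : κ t ≪ η t := by rw [hp]; exact hac' t ht
    have h2 := ProbabilityTheory.Kernel.withDensity_rnDeriv_eq h1
    rw [ProbabilityTheory.Kernel.withDensity_apply _
      (ProbabilityTheory.Kernel.measurable_rnDeriv κ η), hp] at h2
    rw [← h2]
    refine withDensity_congr_ae ?_
    filter_upwards [ProbabilityTheory.Kernel.rnDeriv_ne_top κ η (a := t)] with z hz
    exact (ENNReal.ofReal_toReal hz).symm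

end

/-! ### The reference measures and the exchange of velocities -/

/-- The exchange of the two velocities at the space of timed collisions. -/
def swapVelocities {d : ℕ} {V : Type*} (z : ℝ × Torus d × V × V) : ℝ × Torus d × V × V :=
  (z.1, z.2.1, z.2.2.2, z.2.2.1)

@[simp]
lemma swapVelocities_swapVelocities {d : ℕ} {V : Type*} (z : ℝ × Torus d × V × V) :
    swapVelocities (swapVelocities z) = z := rfl

@[fun_prop]
lemma measurable_swapVelocities {d : ℕ} {V : Type*} [MeasurableSpace V] :
    Measurable (swapVelocities (d := d) (V := V)) := by
  unfold swapVelocities; fun_prop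

/-- The exchange of velocities as a homeomorphism. -/
def swapVelocitiesHomeomorph {d : ℕ} {V : Type*} [TopologicalSpace V] :
    (ℝ × Torus d × V × V) ≃ₜ (ℝ × Torus d × V × V) where
  toFun := swapVelocities
  invFun := swapVelocities
  left_inv := swapVelocities_swapVelocities
  right_inv := swapVelocities_swapVelocities
  continuous_toFun := by unfold swapVelocities; fun_prop
  continuous_invFun := by unfold swapVelocities; fun_prop

lemma Admissible.scatteringRate_nonneg {d : ℕ} {V : Type*} [MeasurableSpace V] {π : Measure V}
    {σ : V → V → ℝ} {b : V → EuclideanSpace ℝ (Fin d)} (hA : Admissible π σ b) (v : V) :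
    0 ≤ scatteringRate π σ v := integral_nonneg fun _ => hA.kernel_nonneg _ _

section

variable {d : ℕ} {V : Type*} [MeasurableSpace V] {π : Measure V} [IsProbabilityMeasure π]

lemma measurePreserving_swap_collision :
    MeasurePreserving (fun w : Torus d × V × V => (w.1, w.2.2, w.2.1))
      (collision d π) (collision d π) :=
  (MeasurePreserving.id _).prod Measure.measurePreserving_swap

lemma measurePreserving_swapVelocities (a c : ℝ) :
    MeasurePreserving (swapVelocities (d := d) (V := V))
      (timeCollision d π a c) (timeCollision d π a c) :=
  (MeasurePreserving.id _).prod measurePreserving_swap_collision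

/-- The measurable equivalence exchanging the velocities. -/
def swapVelocitiesEquiv : (ℝ × Torus d × V × V) ≃ᵐ (ℝ × Torus d × V × V) where
  toFun := swapVelocities
  invFun := swapVelocities
  left_inv := swapVelocities_swapVelocities
  right_inv := swapVelocities_swapVelocities
  measurable_toFun := measurable_swapVelocities
  measurable_invFun := measurable_swapVelocities

lemma measurePreserving_collision :
    MeasurePreserving (MeasurableEquiv.prodAssoc : (Torus d × V) × V ≃ᵐ Torus d × V × V)
      ((phase d π).prod π) (collision d π) :=
  measurePreserving_prodAssoc _ _ _

lemma measurePreserving_collision_phase :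
    MeasurePreserving (fun w : Torus d × V × V => (w.1, w.2.1)) (collision d π) (phase d π) :=
  (MeasurePreserving.id _).prod measurePreserving_fst

lemma measurePreserving_collision_phase' :
    MeasurePreserving (fun w : Torus d × V × V => (w.1, w.2.2)) (collision d π) (phase d π) :=
  (MeasurePreserving.id _).prod measurePreserving_snd

/-- Integration against `(f dx dπ) ⊗ π` as an integral over the space of collisions. -/
lemma integral_prod_withDensity {f : Torus d × V → ℝ} (hf : Measurable f) (hf0 : ∀ z, 0 ≤ f z)
    (F : (Torus d × V) × V → ℝ) :
    ∫ z, F z ∂(((phase d π).withDensity (fun z => ENNReal.ofReal (f z))).prod π) =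
      ∫ w, f (w.1, w.2.1) * F ((w.1, w.2.1), w.2.2) ∂(collision d π) := by
  rw [prod_withDensity_left (by fun_prop), integral_withDensity_eq_integral_toReal_smul
    (by fun_prop) (by simp), ← measurePreserving_collision.integral_comp
      (MeasurableEquiv.measurableEmbedding _)]
  refine integral_congr_ae (Eventually.of_forall fun z => ?_)
  simp [MeasurableEquiv.prodAssoc, ENNReal.toReal_ofReal (hf0 _)]

variable {σ : V → V → ℝ} {b : V → EuclideanSpace ℝ (Fin d)}

@[fun_prop]
lemma Admissible.measurable_scatteringRate (hA : Admissible π σ b) :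
    Measurable (scatteringRate π σ) :=
  (hA.measurable_kernel.stronglyMeasurable.integral_prod_right (ν := π)).measurable

/-- The collision rate out of `(x,v)` is `λ(v)`. -/
lemma lintegral_mul_kernel (hA : Admissible π σ b) {f : Torus d × V → ℝ} (hf : Measurable f)
    (hf0 : ∀ z, 0 ≤ f z) :
    ∫⁻ w, ENNReal.ofReal (f (w.1, w.2.1) * σ w.2.1 w.2.2) ∂(collision d π) =
      ∫⁻ z, ENNReal.ofReal (scatteringRate π σ z.2)
        ∂((phase d π).withDensity (fun z => ENNReal.ofReal (f z))) := by
  have hm := hA.measurable_kernel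
  have hl := hA.measurable_scatteringRate
  have hm' : Measurable fun z : (Torus d × V) × V => σ z.1.2 z.2 :=
    hm.comp (measurable_fst.snd.prodMk measurable_snd)
  rw [lintegral_withDensity_eq_lintegral_mul _ (by fun_prop) (by fun_prop),
    ← measurePreserving_collision.lintegral_comp_emb (MeasurableEquiv.measurableEmbedding _)]
  rw [lintegral_prod]
  · refine lintegral_congr fun z => ?_
    simp only [MeasurableEquiv.prodAssoc, MeasurableEquiv.coe_mk, Equiv.prodAssoc_apply,
      Pi.mul_apply]
    simp_rw [ENNReal.ofReal_mul (hf0 _)]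
    rw [lintegral_const_mul' _ _ ENNReal.ofReal_ne_top, scatteringRate,
      ofReal_integral_eq_lintegral_ofReal (hA.integrable_kernel _)
        (Eventually.of_forall fun _ => hA.kernel_nonneg _ _)]
  · simp only [MeasurableEquiv.prodAssoc, MeasurableEquiv.coe_mk, Equiv.prodAssoc_apply]
    fun_prop

lemma integrable_kernel_collision (hA : Admissible π σ b) :
    Integrable (fun w : Torus d × V × V => σ w.2.1 w.2.2) (collision d π) := by
  have hm' : Measurable fun w : Torus d × V × V => σ w.2.1 w.2.2 :=
    hA.measurable_kernel.comp measurable_snd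
  refine ⟨hm'.aestronglyMeasurable, ?_⟩
  rw [hasFiniteIntegral_iff_ofReal (Eventually.of_forall fun _ => hA.kernel_nonneg _ _)]
  have h := lintegral_mul_kernel hA (f := fun _ => 1) measurable_const (fun _ => zero_le_one)
  simp only [one_mul, ENNReal.ofReal_one, withDensity_const, one_smul] at h
  rw [h]
  have hint : Integrable (scatteringRate π σ) π := by
    refine (hA.exp_moment_rate 1 zero_le_one).mono'
      hA.measurable_scatteringRate.aestronglyMeasurable (Eventually.of_forall fun v => ?_)
    rw [Real.norm_of_nonneg (hA.scatteringRate_nonneg v), one_mul]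
    linarith [Real.add_one_le_exp (scatteringRate π σ v)]
  have h2 : Integrable (fun z : Torus d × V => scatteringRate π σ z.2) (phase d π) :=
    hint.comp_snd _
  exact (hasFiniteIntegral_iff_ofReal
    (Eventually.of_forall fun z => hA.scatteringRate_nonneg _)).1 h2.2

end

lemma measurable_density_mul_kernel {d : ℕ} {V : Type*} [MeasurableSpace V] {π : Measure V}
    {σ : V → V → ℝ} {b : V → EuclideanSpace ℝ (Fin d)} 
    {a c : ℝ} {P : ℝ → ProbabilityMeasure (Torus d × V)} {ρ : ℝ × Torus d × V → ℝ}
    (hA : Admissible π σ b)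
    (hρ : IsDensityPath π a c (fun t => (P t : Measure (Torus d × V))) ρ) :
    Measurable (fun q : ℝ × Torus d × V × V => ρ (q.1, q.2.1, q.2.2.1) * σ q.2.2.1 q.2.2.2) := by
  have h1 := hρ.measurable
  have h2 : Measurable fun q : ℝ × Torus d × V × V => σ q.2.2.1 q.2.2.2 :=
    hA.measurable_kernel.comp measurable_snd.snd
  exact (h1.comp (by fun_prop)).mul h2

/-- Functions of the velocity with an exponential moment are integrable, uniformly over the
measures with bounded entropy. -/
lemma exists_lintegral_le_of_entropy_le {d : ℕ} {V : Type*} [MeasurableSpace V] {π : Measure V}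
    [IsProbabilityMeasure π]
    {g : V → ℝ} (hg : Measurable g) (hg0 : ∀ v, 0 ≤ g v)
    (hexp : Integrable (fun v => Real.exp (g v)) π) {H : ℝ≥0∞} (hH : H < ⊤) :
    ∃ M < (⊤ : ℝ≥0∞), ∀ Q : ProbabilityMeasure (Torus d × V), entropy π Q ≤ H →
      ∫⁻ z, ENNReal.ofReal (g z.2) ∂(Q : Measure (Torus d × V)) ≤ M := by
  refine ⟨_, ?_, fun Q hQ => (lintegral_le_entropy_add (g := fun z => g z.2) (by fun_prop)
    (fun z => hg0 _)).trans (add_le_add_left hQ _)⟩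
  refine ENNReal.add_lt_top.2 ⟨hH, ?_⟩
  have h : Integrable (fun z : Torus d × V => Real.exp (g z.2)) (phase d π) :=
    Integrable.comp_snd (f := fun v => Real.exp (g v)) hexp _
  have h2 := h.sub (integrable_const (1 : ℝ))
  exact (hasFiniteIntegral_iff_ofReal (Eventually.of_forall fun z => by
    simpa using hg0 _)).1 h2.2

lemma integrable_of_lintegral_lt_top {X : Type*} [MeasurableSpace X] {μ : Measure X} {g : X → ℝ}
    (hg : Measurable g) (hg0 : ∀ x, 0 ≤ g x) (h : ∫⁻ x, ENNReal.ofReal (g x) ∂μ < ⊤) :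
    Integrable g μ :=
  ⟨hg.aestronglyMeasurable, (hasFiniteIntegral_iff_ofReal (Eventually.of_forall hg0)).2 h⟩

section

variable {d : ℕ} {V : Type*} [MeasurableSpace V] {π : Measure V} [IsProbabilityMeasure π]
  {σ : V → V → ℝ} {b : V → EuclideanSpace ℝ (Fin d)} {a c : ℝ}
  {P : ℝ → ProbabilityMeasure (Torus d × V)} {ρ : ℝ × Torus d × V → ℝ}

/-- The total collision rate over the time interval is finite. -/
lemma integrable_density_mul_kernel (hA : Admissible π σ b)
    (hH : (⨆ t ∈ Icc a c, entropy π (P t)) < ⊤)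
    (hρ : IsDensityPath π a c (fun t => (P t : Measure (Torus d × V))) ρ) :
    Integrable (fun q : ℝ × Torus d × V × V => ρ (q.1, q.2.1, q.2.2.1) * σ q.2.2.1 q.2.2.2)
      (timeCollision d π a c) := by
  have hm := measurable_density_mul_kernel hA hρ
  refine integrable_of_lintegral_lt_top hm
    (fun q => mul_nonneg (hρ.nonneg _) (hA.kernel_nonneg _ _)) ?_
  obtain ⟨M, hM, hM'⟩ := exists_lintegral_le_of_entropy_le (d := d) hA.measurable_scatteringRate
    hA.scatteringRate_nonneg (by simpa using hA.exp_moment_rate 1 zero_le_one) hH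
  rw [lintegral_prod _ hm.ennreal_ofReal.aemeasurable]
  calc _ ≤ ∫⁻ t in Icc a c, M := by
        refine setLIntegral_mono' measurableSet_Icc fun t ht => ?_
        have h := lintegral_mul_kernel hA (f := fun z => ρ (t, z))
          (hρ.measurable_slice t) (fun z => hρ.nonneg _)
        rw [h, ← hρ.eq t ht]
        exact hM' _ (le_iSup₂ (f := fun t _ => entropy π (P t)) t ht)
    _ < ⊤ := by
        rw [lintegral_const]
        exact ENNReal.mul_lt_top hM (by simp)

/-- The action of a bounded function, integrated over time, as one integral over the space of
timed collisions. -/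
lemma integral_collisions (hA : Admissible π σ b) (hac : a ≤ c)
    (hH : (⨆ t ∈ Icc a c, entropy π (P t)) < ⊤)
    (hρ : IsDensityPath π a c (fun t => (P t : Measure (Torus d × V))) ρ)
    {F : ℝ × Torus d × V × V → ℝ} (hF : Measurable F) {C : ℝ} (hC : ∀ q, |F q| ≤ C) :
    ∫ t in a..c, ∫ z : (Torus d × V) × V, σ z.1.2 z.2 * F (t, z.1.1, z.1.2, z.2)
        ∂((P t : Measure (Torus d × V)).prod π) =
      ∫ q, ρ (q.1, q.2.1, q.2.2.1) * σ q.2.2.1 q.2.2.2 * F q ∂(timeCollision d π a c) := by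
  rw [integral_prod _ ((integrable_density_mul_kernel hA hH hρ).mul_bdd
      hF.aestronglyMeasurable (Eventually.of_forall hC)),
    intervalIntegral.integral_of_le hac, ← integral_Icc_eq_integral_Ioc]
  refine setIntegral_congr_fun measurableSet_Icc fun t ht => ?_
  simp only
  rw [hρ.eq t ht, integral_prod_withDensity (hρ.measurable_slice t)
    (fun z => hρ.nonneg _)]
  simp only [mul_assoc]

end

/-! ### The kinematic term: measurable test functions and absolute continuity -/

lemma vectorIntegral_swapVelocities {d : ℕ} {V : Type*} [MeasurableSpace V]
    {Θ : SignedMeasure (ℝ × Torus d × V × V)}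
    (hΘ : VectorMeasure.map Θ (swapVelocities (d := d) (V := V)) = -Θ)
    (F : ℝ × Torus d × V × V → ℝ) :
    ∫ᵛ q, F (swapVelocities q) ∂•Θ = -∫ᵛ q, F q ∂•Θ := by
  rw [← VectorMeasure.integral_neg_vectorMeasure, ← hΘ]
  exact ((swapVelocitiesEquiv (d := d) (V := V)).measurableEmbedding.integral_map_vectorMeasure).symm

section

variable {d : ℕ} {V : Type*} [TopologicalSpace V] [PolishSpace V]
  [MeasurableSpace V] [BorelSpace V] {π : Measure V} [IsProbabilityMeasure π]
  {σ : V → V → ℝ} {b : V → EuclideanSpace ℝ (Fin d)} {a c : ℝ}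
  {P : ℝ → ProbabilityMeasure (Torus d × V)} {ρ : ℝ × Torus d × V → ℝ}
  {Θ : SignedMeasure (ℝ × Torus d × V × V)}

lemma abs_cosh_sub_one_mul_le {ζ A C D : ℝ} (hζ : |ζ| ≤ C) (hA : |A| ≤ D) :
    |(Real.cosh ζ - 1) * A| ≤ Real.cosh C * D := by
  have h1 : Real.cosh ζ ≤ Real.cosh C :=
    Real.cosh_le_cosh.2 (hζ.trans (le_abs_self C))
  have h2 := Real.one_le_cosh ζ
  rw [abs_mul, abs_of_nonneg (by linarith : 0 ≤ Real.cosh ζ - 1)]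
  exact mul_le_mul (by linarith) hA (abs_nonneg _) (by linarith)

/-- The defining bound of the kinematic term extends from continuous to bounded measurable test
functions. -/
lemma ofReal_le_kinematicTerm_of_measurable [LocallyCompactSpace V]
    (hA : Admissible π σ b) (hac : a ≤ c)
    (hH : (⨆ t ∈ Icc a c, entropy π (P t)) < ⊤)
    (hρ : IsDensityPath π a c (fun t => (P t : Measure (Torus d × V))) ρ)
    {ζ : ℝ × Torus d × V × V → ℝ} (hζ : Measurable ζ) {C : ℝ} (hC : ∀ q, |ζ q| ≤ C)
    (hζa : ∀ q, ζ (swapVelocities q) = -ζ q)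
    {α : ℝ × Torus d × V × V → ℝ} (hα : Measurable α) {m M : ℝ} (hm : 0 < m)
    (hmα : ∀ q, m ≤ α q) (hMα : ∀ q, α q ≤ M) :
    ENNReal.ofReal ((∫ᵛ q, ζ q ∂•Θ) -
      ∫ q, ρ (q.1, q.2.1, q.2.2.1) * σ q.2.2.1 q.2.2.2 *
        ((Real.cosh (ζ q) - 1) * (α q + (α (swapVelocities q))⁻¹)) ∂(timeCollision d π a c)) ≤
      kinematicTerm π σ a c P Θ := by
  let ν : Measure (ℝ × Torus d × V × V) := Θ.variation + timeCollision d π a c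
  let μ := ν + ν.map swapVelocities
  obtain ⟨Z, hZ1, hZ2, hZ3, hZ4⟩ := exists_seq_continuous_bounded_tendsto_ae μ hζ hC
  have hαM : ∀ q, |α q| ≤ M := fun q => by
    rw [abs_of_nonneg (hm.le.trans (hmα q))]; exact hMα q
  obtain ⟨A, hA1, -, hA3, hA4⟩ := exists_seq_continuous_bounded_tendsto_ae μ hα hαM
  -- almost everywhere convergence holds at `q` and at its exchange
  have hboth : ∀ {p : ℝ × Torus d × V × V → Prop}, (∀ᵐ q ∂μ, p q) →
      ∀ᵐ q ∂ν, p q ∧ p (swapVelocities q) := by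
    intro p hp
    rw [ae_add_measure_iff] at hp
    exact hp.1.and (ae_of_ae_map measurable_swapVelocities.aemeasurable hp.2)
  let Z' : ℕ → ℝ × Torus d × V × V → ℝ := fun n q => (Z n q - Z n (swapVelocities q)) / 2
  let A' : ℕ → ℝ × Torus d × V × V → ℝ := fun n q => max m (A n q)
  have hsw : Continuous (swapVelocities (d := d) (V := V)) := swapVelocitiesHomeomorph.continuous
  have hZ'1 : ∀ n, Continuous (Z' n) := fun n => by
    have := hZ1 n
    fun_prop
  have hA'1 : ∀ n, Continuous (A' n) := fun n => by
    have := hA1 n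
    fun_prop
  have hZ'test : ∀ n, IsCurrentTest (Z' n) := fun n =>
    { continuous := hZ'1 n
      hasCompactSupport := by
        have h1 : HasCompactSupport (fun q => Z n (swapVelocities q)) :=
          (hZ2 n).comp_homeomorph swapVelocitiesHomeomorph
        exact ((hZ2 n).sub h1).comp_left (g := fun r : ℝ => r / 2) (by simp)
      antisymm := fun t x v v' => by
        simp only [Z', swapVelocities]
        ring }
  have hA'm : ∀ n q, m ≤ A' n q := fun n q => le_max_left _ _
  have hA'test : ∀ n, IsWeightTest (A' n) := fun n =>
    { continuous := hA'1 n
      bounded := ⟨max m M, fun q => max_le_max le_rfl ((le_abs_self _).trans (hA3 n q))⟩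
      bounded_below := ⟨m, hm, hA'm n⟩ }
  have hZ'C : ∀ n q, |Z' n q| ≤ C := fun n q => by
    simp only [Z']
    have h1 := abs_le.1 (hZ3 n q)
    have h2 := abs_le.1 (hZ3 n (swapVelocities q))
    rw [abs_le]
    constructor <;> linarith
  have hfacb : ∀ x y : ℝ, m ≤ x → x ≤ max m M → m ≤ y → |x + y⁻¹| ≤ max m M + m⁻¹ := by
    intro x y hx hx' hy
    rw [abs_of_nonneg (by have := hm.trans_le hx; have := hm.trans_le hy; positivity)]
    exact add_le_add hx' (inv_anti₀ hm hy)
  let F : ℕ → ℝ × Torus d × V × V → ℝ := fun n q =>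
    (Real.cosh (Z' n q) - 1) * (A' n q + (A' n (swapVelocities q))⁻¹)
  have hFm : ∀ n, Measurable (F n) := fun n => by
    have h1 := (hZ'1 n).measurable
    have h2 := (hA'1 n).measurable
    fun_prop
  have hFb : ∀ n q, |F n q| ≤ Real.cosh C * (max m M + m⁻¹) := fun n q =>
    abs_cosh_sub_one_mul_le (hZ'C n q) (hfacb _ _ (hA'm n q)
      (max_le_max le_rfl ((le_abs_self _).trans (hA3 n q))) (hA'm n _))
  -- convergence of the two integrals
  have hlimZ : ∀ᵐ q ∂ν, Tendsto (fun n => Z' n q) atTop (𝓝 (ζ q)) := by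
    filter_upwards [hboth hZ4] with q hq
    have h := (hq.1.sub hq.2).div_const 2
    rwa [hζa q, show (ζ q - -ζ q) / 2 = ζ q by ring] at h
  have hlimF : ∀ᵐ q ∂ν, Tendsto (fun n => F n q) atTop
      (𝓝 ((Real.cosh (ζ q) - 1) * (α q + (α (swapVelocities q))⁻¹))) := by
    filter_upwards [hlimZ, hboth hA4] with q hq hq'
    have hA' : ∀ q, Tendsto (fun n => A n q) atTop (𝓝 (α q)) →
        Tendsto (fun n => A' n q) atTop (𝓝 (α q)) := by
      intro q h
      have h2 := (tendsto_const_nhds (x := m)).max h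
      rwa [max_eq_right (hmα q)] at h2
    exact (((Real.continuous_cosh.tendsto _).comp hq).sub_const 1).mul
      ((hA' _ hq'.1).add ((hA' _ hq'.2).inv₀ (hm.trans_le (hmα _)).ne'))
  rw [ae_add_measure_iff] at hlimZ hlimF
  have hlim1 : Tendsto (fun n => ∫ᵛ q, Z' n q ∂•Θ) atTop (𝓝 (∫ᵛ q, ζ q ∂•Θ)) :=
    VectorMeasure.tendsto_integral_of_dominated_convergence (fun _ => C)
      (fun n => (hZ'1 n).aestronglyMeasurable) (integrable_const _)
      (fun n => Eventually.of_forall (hZ'C n)) hlimZ.1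
  have hint := integrable_density_mul_kernel hA hH hρ
  have hlim2 := tendsto_integral_of_dominated_convergence
    (F := fun n q => ρ (q.1, q.2.1, q.2.2.1) * σ q.2.2.1 q.2.2.2 * F n q)
    (μ := timeCollision d π a c) _ (fun n => hint.aestronglyMeasurable.mul
      (hFm n).aestronglyMeasurable) (hint.norm.mul_const (Real.cosh C * (max m M + m⁻¹)))
    (fun n => Eventually.of_forall fun q => by
      rw [norm_mul]
      exact mul_le_mul_of_nonneg_left (hFb n q) (norm_nonneg _))
    (hlimF.2.mono fun q hq => hq.const_mul _)
  refine le_of_tendsto (ENNReal.tendsto_ofReal (hlim1.sub hlim2)) (Eventually.of_forall fun n => ?_)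
  rw [← integral_collisions hA hac hH hρ (hFm n) (hFb n)]
  refine le_trans (le_of_eq ?_) (le_iSup₂_of_le (Z' n) (hZ'test n)
    (le_iSup₂_of_le (A' n) (hA'test n) le_rfl))
  simp only [F, swapVelocities, mul_assoc]

/-- If the kinematic term is finite, the current is absolutely continuous with respect to
`dt dx π(dv) π(dv')`: a null set can be tested with arbitrarily large `ζ` at no cost. -/
lemma absolutelyContinuous_of_kinematicTerm_ne_top [LocallyCompactSpace V]
    (hA : Admissible π σ b) (hac : a ≤ c)
    (hH : (⨆ t ∈ Icc a c, entropy π (P t)) < ⊤)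
    (hρ : IsDensityPath π a c (fun t => (P t : Measure (Torus d × V))) ρ)
    (hΘ : VectorMeasure.map Θ (swapVelocities (d := d) (V := V)) = -Θ)
    (hR : kinematicTerm π σ a c P Θ ≠ ⊤) :
    Θ ≪ᵥ (timeCollision d π a c).toENNRealVectorMeasure := by
  refine VectorMeasure.AbsolutelyContinuous.mk fun B hB hB0 => ?_
  rw [Measure.toENNRealVectorMeasure_apply_measurable hB] at hB0
  have hB0' : ∀ᵐ q ∂(timeCollision d π a c), q ∉ B := measure_eq_zero_iff_ae_notMem.1 hB0
  have hB0'' : ∀ᵐ q ∂(timeCollision d π a c), swapVelocities q ∉ B :=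
    (measurePreserving_swapVelocities a c).quasiMeasurePreserving.ae hB0'
  have hind : Measurable (B.indicator (fun _ => (1 : ℝ))) := measurable_const.indicator hB
  have hindb : ∀ q, |B.indicator (fun _ => (1 : ℝ)) q| ≤ 1 := fun q => by
    by_cases hq : q ∈ B <;> simp [hq]
  have hΘB : ∫ᵛ q, B.indicator (fun _ => (1 : ℝ)) q ∂•Θ = Θ B := by
    rw [VectorMeasure.integral_indicator hB, VectorMeasure.integral_const]
    simp [VectorMeasure.restrict_apply _ hB]
  have key : ∀ γ : ℝ, γ * (2 * Θ B) ≤ (kinematicTerm π σ a c P Θ).toReal := by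
    intro γ
    let ζ : ℝ × Torus d × V × V → ℝ := fun q =>
      γ * (B.indicator (fun _ => (1 : ℝ)) q - B.indicator (fun _ => (1 : ℝ)) (swapVelocities q))
    have hζm : Measurable ζ := by fun_prop
    have hζb : ∀ q, |ζ q| ≤ |γ| * 2 := fun q => by
      rw [abs_mul]
      refine mul_le_mul_of_nonneg_left ?_ (abs_nonneg _)
      refine (abs_sub _ _).trans ?_
      linarith [hindb q, hindb (swapVelocities q)]
    have h := ofReal_le_kinematicTerm_of_measurable (Θ := Θ) hA hac hH hρ hζm hζb
      (fun q => by simp only [ζ, swapVelocities_swapVelocities]; ring)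
      (measurable_const (a := (1 : ℝ))) one_pos (fun _ => le_rfl) (fun _ => le_rfl)
    have h0 : ∫ q, ρ (q.1, q.2.1, q.2.2.1) * σ q.2.2.1 q.2.2.2 *
        ((Real.cosh (ζ q) - 1) * (1 + (1 : ℝ)⁻¹)) ∂(timeCollision d π a c) = 0 := by
      refine integral_eq_zero_of_ae ?_
      filter_upwards [hB0', hB0''] with q h1 h2
      simp [ζ, h1, h2]
    have h1 : ∫ᵛ q, ζ q ∂•Θ = γ * (2 * Θ B) := by
      simp only [ζ]
      have e1 : ∫ᵛ q, γ * (B.indicator (fun _ => (1 : ℝ)) q -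
          B.indicator (fun _ => (1 : ℝ)) (swapVelocities q)) ∂•Θ =
          γ • ∫ᵛ q, (B.indicator (fun _ => (1 : ℝ)) q -
          B.indicator (fun _ => (1 : ℝ)) (swapVelocities q)) ∂•Θ :=
        VectorMeasure.integral_fun_smul ..
      rw [e1, VectorMeasure.integral_fun_sub (integrable_variation_of_bound Θ hind hindb)
        (integrable_variation_of_bound Θ (hind.comp measurable_swapVelocities)
          (fun q => hindb (swapVelocities q))) (g := fun q =>
            B.indicator (fun _ => (1 : ℝ)) (swapVelocities q)), vectorIntegral_swapVelocities hΘ, hΘB,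
        smul_eq_mul]
      ring
    rw [h0, h1, sub_zero] at h
    exact (ENNReal.ofReal_le_iff_le_toReal hR).1 h
  by_contra hne
  have h := key (((kinematicTerm π σ a c P Θ).toReal + 1) / (2 * Θ B))
  rw [div_mul_cancel₀ _ (mul_ne_zero two_ne_zero hne)] at h
  linarith

end

/-! ### Truncations and the optimal weight -/

/-- Truncation of a real number to `[1/(n+1), n+1]`. -/
def trunc (n : ℕ) (r : ℝ) : ℝ := max (1 / ((n : ℝ) + 1)) (min r ((n : ℝ) + 1))

lemma one_div_le_trunc (n : ℕ) (r : ℝ) : 1 / ((n : ℝ) + 1) ≤ trunc n r := le_max_left _ _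

lemma trunc_pos (n : ℕ) (r : ℝ) : 0 < trunc n r :=
  lt_of_lt_of_le (by positivity) (one_div_le_trunc n r)

lemma one_div_le_self_add_one (n : ℕ) : 1 / ((n : ℝ) + 1) ≤ (n : ℝ) + 1 := by
  have h : (0 : ℝ) ≤ n := n.cast_nonneg
  rw [div_le_iff₀ (by positivity)]
  nlinarith

lemma trunc_le (n : ℕ) (r : ℝ) : trunc n r ≤ (n : ℝ) + 1 :=
  max_le (one_div_le_self_add_one n) (min_le_right _ _)

@[fun_prop]
lemma continuous_trunc (n : ℕ) : Continuous (trunc n) := by unfold trunc; fun_prop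

@[fun_prop]
lemma measurable_trunc (n : ℕ) : Measurable (trunc n) := (continuous_trunc n).measurable

lemma trunc_mono (n : ℕ) : Monotone (trunc n) := fun _ _ h =>
  max_le_max le_rfl (min_le_min h le_rfl)

lemma tendsto_trunc {r : ℝ} (hr : 0 ≤ r) : Tendsto (fun n => trunc n r) atTop (𝓝 r) := by
  have h1 : Tendsto (fun n : ℕ => min r ((n : ℝ) + 1)) atTop (𝓝 r) := by
    refine tendsto_const_nhds.congr' ?_
    obtain ⟨N, hN⟩ := exists_nat_ge r
    filter_upwards [eventually_ge_atTop N] with n hn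
    have : (N : ℝ) ≤ n := by exact_mod_cast hn
    exact (min_eq_left (by linarith)).symm
  have h2 := (tendsto_one_div_add_atTop_nhds_zero_nat (𝕜 := ℝ)).max h1
  rwa [max_eq_right hr] at h2

/-- The square root of the ratio of the truncations, which approximates `√(g / f)`. -/
def sqrtRatio (n : ℕ) (f g : ℝ) : ℝ := √(trunc n g / trunc n f)

lemma sqrtRatio_inv (n : ℕ) (f g : ℝ) : (sqrtRatio n g f)⁻¹ = sqrtRatio n f g := by
  rw [sqrtRatio, sqrtRatio, ← Real.sqrt_inv, inv_div]

lemma sqrtRatio_nonneg (n : ℕ) (f g : ℝ) : 0 ≤ sqrtRatio n f g := Real.sqrt_nonneg _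

lemma sqrtRatio_le (n : ℕ) (f g : ℝ) : sqrtRatio n f g ≤ (n : ℝ) + 1 := by
  rw [sqrtRatio, Real.sqrt_le_left (by positivity), div_le_iff₀ (trunc_pos n f)]
  have h1 := one_div_le_trunc n f
  rw [div_le_iff₀ (by positivity)] at h1
  nlinarith [trunc_le n g, trunc_pos n f]

lemma one_div_le_sqrtRatio (n : ℕ) (f g : ℝ) : 1 / ((n : ℝ) + 1) ≤ sqrtRatio n f g := by
  rw [← sqrtRatio_inv, ← one_div]
  refine one_div_le_one_div_of_le ?_ (sqrtRatio_le n g f)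
  exact Real.sqrt_pos.2 (div_pos (trunc_pos _ _) (trunc_pos _ _))

lemma sqrtRatio_eq_exp (n : ℕ) (f g : ℝ) :
    sqrtRatio n f g = Real.exp (Real.log (trunc n g) / 2 - Real.log (trunc n f) / 2) := by
  rw [sqrtRatio, ← sub_div, ← Real.log_div (trunc_pos _ _).ne' (trunc_pos _ _).ne',
    ← Real.log_sqrt (div_pos (trunc_pos _ _) (trunc_pos _ _)).le,
    Real.exp_log (Real.sqrt_pos.2 (div_pos (trunc_pos _ _) (trunc_pos _ _)))]

@[fun_prop]
lemma measurable_sqrtRatio (n : ℕ) {X : Type*} [MeasurableSpace X] {f g : X → ℝ}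
    (hf : Measurable f) (hg : Measurable g) : Measurable (fun x => sqrtRatio n (f x) (g x)) := by
  unfold sqrtRatio; fun_prop

/-- The truncated version of `√(f * g)` has a bound that is uniform in the truncation, so that the
truncation can be removed by dominated convergence. -/
lemma mul_sqrtRatio_le (n : ℕ) {f g : ℝ} (hf : 0 ≤ f) (hg : 0 ≤ g) :
    f * sqrtRatio n f g ≤ f + g + 1 := by
  have hn : (0 : ℝ) ≤ n := n.cast_nonneg
  rcases le_or_gt f ((n : ℝ) + 1) with h | h
  · have h1 : f ≤ trunc n f := by
      rw [trunc, min_eq_left h]; exact le_max_right _ _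
    have h2 : trunc n g ≤ g + 1 := by
      refine max_le ?_ ((min_le_left _ _).trans (by linarith))
      rw [div_le_iff₀ (by positivity)]
      nlinarith
    have h3 : f * (trunc n g / trunc n f) ≤ g + 1 := by
      rw [mul_div_assoc', div_le_iff₀ (trunc_pos n f)]
      nlinarith [trunc_pos n f, trunc_pos n g]
    have h4 : f * sqrtRatio n f g = √(f * (f * (trunc n g / trunc n f))) := by
      rw [sqrtRatio, ← mul_assoc, Real.sqrt_mul (by positivity), Real.sqrt_mul_self hf]
    rw [h4, Real.sqrt_le_left (by positivity)]
    nlinarith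
  · have h1 : trunc n f = (n : ℝ) + 1 := by
      rw [trunc, min_eq_right h.le, max_eq_right (one_div_le_self_add_one n)]
    have h2 : sqrtRatio n f g ≤ 1 := by
      rw [sqrtRatio, h1, Real.sqrt_le_left zero_le_one, one_pow]
      exact div_le_one_of_le₀ (trunc_le n g) (by positivity)
    nlinarith

lemma tendsto_mul_sqrtRatio {f g : ℝ} (hf : 0 ≤ f) (hg : 0 ≤ g) :
    Tendsto (fun n => f * sqrtRatio n f g) atTop (𝓝 √(f * g)) := by
  rcases hf.eq_or_lt with rfl | hf'
  · simp
  · have h := ((((tendsto_trunc hg).div (tendsto_trunc hf) hf'.ne').sqrt)).const_mul f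
    have e : f * √(g / f) = √(f * g) := by
      rw [← Real.sqrt_mul_self hf, ← Real.sqrt_mul (by positivity), Real.sqrt_mul_self hf]
      congr 1
      field_simp
    rwa [e] at h

section

variable {d : ℕ} {V : Type*} [TopologicalSpace V] [PolishSpace V]
  [MeasurableSpace V] [BorelSpace V] {π : Measure V} [IsProbabilityMeasure π]
  {σ : V → V → ℝ} {b : V → EuclideanSpace ℝ (Fin d)} {a c : ℝ}
  {P : ℝ → ProbabilityMeasure (Torus d × V)} {ρ : ℝ × Torus d × V → ℝ}
  {Θ : SignedMeasure (ℝ × Torus d × V × V)}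

/-- The bound on the current by the kinematic term once the weight `α` is optimized, the optimum
being `α = √(ρ(v') / ρ(v))`. -/
lemma ofReal_vectorIntegral_le [LocallyCompactSpace V]
    (hA : Admissible π σ b) (hac : a ≤ c)
    (hH : (⨆ t ∈ Icc a c, entropy π (P t)) < ⊤)
    (hρ : IsDensityPath π a c (fun t => (P t : Measure (Torus d × V))) ρ)
    {ζ : ℝ × Torus d × V × V → ℝ} (hζ : Measurable ζ) {C : ℝ} (hC : ∀ q, |ζ q| ≤ C)
    (hζa : ∀ q, ζ (swapVelocities q) = -ζ q) :
    ENNReal.ofReal (∫ᵛ q, ζ q ∂•Θ) ≤ kinematicTerm π σ a c P Θ +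
      ∫⁻ q, ENNReal.ofReal (σ q.2.2.1 q.2.2.2 *
        (2 * √(ρ (q.1, q.2.1, q.2.2.1) * ρ (q.1, q.2.1, q.2.2.2)) * (Real.cosh (ζ q) - 1)))
        ∂(timeCollision d π a c) := by
  by_cases hR : kinematicTerm π σ a c P Θ = ⊤
  · simp [hR]
  let f : ℝ × Torus d × V × V → ℝ := fun q => ρ (q.1, q.2.1, q.2.2.1)
  let f' : ℝ × Torus d × V × V → ℝ := fun q => ρ (q.1, q.2.1, q.2.2.2)
  let S : ℝ × Torus d × V × V → ℝ := fun q => σ q.2.2.1 q.2.2.2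
  have hf : Measurable f := hρ.measurable.comp (by fun_prop)
  have hf' : Measurable f' := hρ.measurable.comp (by fun_prop)
  have hS : Measurable S := hA.measurable_kernel.comp measurable_snd.snd
  have hf0 : ∀ q, 0 ≤ f q := fun q => hρ.nonneg _
  have hf0' : ∀ q, 0 ≤ f' q := fun q => hρ.nonneg _
  have hS0 : ∀ q, 0 ≤ S q := fun q => hA.kernel_nonneg _ _
  have hcosh0 : ∀ q, 0 ≤ Real.cosh (ζ q) - 1 := fun q => by linarith [Real.one_le_cosh (ζ q)]
  have hcoshC : ∀ q, Real.cosh (ζ q) - 1 ≤ Real.cosh C := fun q => by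
    have := Real.cosh_le_cosh.2 ((hC q).trans (le_abs_self C))
    linarith
  let I : ℝ := ∫ q, S q * (2 * √(f q * f' q) * (Real.cosh (ζ q) - 1)) ∂(timeCollision d π a c)
  have hbound : ∫ᵛ q, ζ q ∂•Θ ≤ (kinematicTerm π σ a c P Θ).toReal + I := by
    have hn : ∀ n : ℕ, ∫ᵛ q, ζ q ∂•Θ ≤ (kinematicTerm π σ a c P Θ).toReal +
        ∫ q, S q * (2 * (f q * sqrtRatio n (f q) (f' q)) * (Real.cosh (ζ q) - 1))
          ∂(timeCollision d π a c) := by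
      intro n
      have h := ofReal_le_kinematicTerm_of_measurable (Θ := Θ) hA hac hH hρ hζ hC hζa
        (α := fun q => sqrtRatio n (f q) (f' q)) (by fun_prop)
        (by positivity : 0 < 1 / ((n : ℝ) + 1)) (fun q => one_div_le_sqrtRatio n _ _)
        (fun q => sqrtRatio_le n _ _)
      have e : ∀ q, sqrtRatio n (f (swapVelocities q)) (f' (swapVelocities q)) =
        sqrtRatio n (f' q) (f q) := fun q => rfl
      simp_rw [e, sqrtRatio_inv] at h
      have h2 := (ENNReal.ofReal_le_iff_le_toReal hR).1 h
      rw [sub_le_iff_le_add] at h2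
      refine h2.trans (le_of_eq ?_)
      congr 1
      refine integral_congr_ae (Eventually.of_forall fun q => ?_)
      simp only [f, S]
      ring
    have hint : Integrable (fun q => f q * S q) (timeCollision d π a c) :=
      integrable_density_mul_kernel hA hH hρ
    have hint' : Integrable (fun q => f' q * S q) (timeCollision d π a c) := by
      refine ((measurePreserving_swapVelocities a c).integrable_comp_of_integrable hint).congr
        (Eventually.of_forall fun q => ?_)
      simp only [f, f', S, Function.comp, swapVelocities, hA.kernel_symm q.2.2.2 q.2.2.1]
    have hintS : Integrable S (timeCollision d π a c) :=
      Integrable.comp_snd (f := fun w : Torus d × V × V => σ w.2.1 w.2.2)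
        (integrable_kernel_collision hA) _
    have hlim : Tendsto (fun n : ℕ => ∫ q, S q * (2 * (f q * sqrtRatio n (f q) (f' q)) *
        (Real.cosh (ζ q) - 1)) ∂(timeCollision d π a c)) atTop (𝓝 I) := by
      refine tendsto_integral_of_dominated_convergence
        (fun q => 2 * Real.cosh C * (f q * S q + f' q * S q + S q))
        (fun n => by fun_prop) (((hint.add hint').add hintS).const_mul _)
        (fun n => Eventually.of_forall fun q => ?_) (Eventually.of_forall fun q => ?_)
      · have h0 : 0 ≤ f q * sqrtRatio n (f q) (f' q) :=
          mul_nonneg (hf0 q) (sqrtRatio_nonneg _ _ _)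
        rw [Real.norm_of_nonneg (mul_nonneg (hS0 q) (mul_nonneg (by linarith) (hcosh0 q)))]
        have h1 := mul_sqrtRatio_le n (hf0 q) (hf0' q)
        calc _ ≤ S q * (2 * (f q + f' q + 1) * Real.cosh C) :=
              mul_le_mul_of_nonneg_left (mul_le_mul (by linarith) (hcoshC q) (hcosh0 q)
                (by linarith [hf0 q, hf0' q])) (hS0 q)
          _ = _ := by ring
      · exact (((tendsto_mul_sqrtRatio (hf0 q) (hf0' q)).const_mul 2).mul_const _).const_mul _
    exact ge_of_tendsto (hlim.const_add _) (Eventually.of_forall hn)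
  have hI : ENNReal.ofReal I ≤ ∫⁻ q, ENNReal.ofReal
      (S q * (2 * √(f q * f' q) * (Real.cosh (ζ q) - 1))) ∂(timeCollision d π a c) := by
    by_cases hi : Integrable (fun q => S q * (2 * √(f q * f' q) * (Real.cosh (ζ q) - 1)))
      (timeCollision d π a c)
    · refine (ofReal_integral_eq_lintegral_ofReal hi (Eventually.of_forall fun q => ?_)).le
      have := hS0 q
      have := hcosh0 q
      simp only [Pi.zero_apply]
      positivity
    · simp [I, integral_undef hi]
  calc ENNReal.ofReal (∫ᵛ q, ζ q ∂•Θ)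
      ≤ ENNReal.ofReal ((kinematicTerm π σ a c P Θ).toReal + I) := ENNReal.ofReal_le_ofReal hbound
    _ ≤ ENNReal.ofReal (kinematicTerm π σ a c P Θ).toReal + ENNReal.ofReal I :=
        ENNReal.ofReal_add_le
    _ ≤ _ := by
        rw [ENNReal.ofReal_toReal hR]
        exact add_le_add_right hI _

/-! ### The Dirichlet form -/

/-- The Dirichlet form dominates its expression in terms of the density, as is seen by testing with
truncations of half the logarithm of the density. -/
lemma lintegral_sqrt_sub_sqrt_le_dirichletForm [LocallyCompactSpace V] (hA : Admissible π σ b)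
    {Q : ProbabilityMeasure (Torus d × V)} (hQ : entropy π Q < ⊤) {f : Torus d × V → ℝ}
    (hf : Measurable f) (hf0 : ∀ z, 0 ≤ f z)
    (hQf : (Q : Measure (Torus d × V)) =
      (phase d π).withDensity (fun z => ENNReal.ofReal (f z))) :
    ∫⁻ w, ENNReal.ofReal (σ w.2.1 w.2.2 * (√(f (w.1, w.2.1)) - √(f (w.1, w.2.2))) ^ 2)
      ∂(collision d π) ≤ dirichletForm π σ Q := by
  let S : Torus d × V × V → ℝ := fun w => σ w.2.1 w.2.2
  let g : Torus d × V × V → ℝ := fun w => f (w.1, w.2.1)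
  let g' : Torus d × V × V → ℝ := fun w => f (w.1, w.2.2)
  have hS : Measurable S := hA.measurable_kernel.comp measurable_snd
  have hg : Measurable g := hf.comp (by fun_prop)
  have hg' : Measurable g' := hf.comp (by fun_prop)
  have hS0 : ∀ w, 0 ≤ S w := fun w => hA.kernel_nonneg _ _
  have hint : Integrable (fun w => g w * S w) (collision d π) := by
    refine integrable_of_lintegral_lt_top (by fun_prop)
      (fun w => mul_nonneg (hf0 _) (hS0 w)) ?_
    simp only [g, S]
    rw [lintegral_mul_kernel hA hf hf0, ← hQf]
    obtain ⟨M, hM, hM'⟩ := exists_lintegral_le_of_entropy_le (d := d)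
      hA.measurable_scatteringRate hA.scatteringRate_nonneg
      (by simpa using hA.exp_moment_rate 1 zero_le_one) hQ
    exact (hM' Q le_rfl).trans_lt hM
  have hint' : Integrable (fun w => g' w * S w) (collision d π) := by
    refine (measurePreserving_swap_collision.integrable_comp_of_integrable hint).congr
      (Eventually.of_forall fun w => ?_)
    simp only [g, g', S, Function.comp, hA.kernel_symm w.2.2 w.2.1]
  have hintS : Integrable S (collision d π) := integrable_kernel_collision hA
  -- bounded measurable test functions
  have hmeas : ∀ φ : Torus d × V → ℝ, Measurable φ → ∀ C : ℝ, (∀ z, |φ z| ≤ C) →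
      2 * ENNReal.ofReal (∫ w, g w * S w *
        (1 - Real.exp (φ (w.1, w.2.2) - φ (w.1, w.2.1))) ∂(collision d π)) ≤
        dirichletForm π σ Q := by
    intro φ hφ C hC
    obtain ⟨Φ, hΦ1, -, hΦ3, hΦ4⟩ := exists_seq_continuous_bounded_tendsto_ae (phase d π) hφ hC
    have h1 := measurePreserving_collision_phase.quasiMeasurePreserving.ae hΦ4
    have h2 := measurePreserving_collision_phase'.quasiMeasurePreserving.ae hΦ4
    have hb : ∀ n (w : Torus d × V × V),
        |1 - Real.exp (Φ n (w.1, w.2.2) - Φ n (w.1, w.2.1))| ≤ 1 + Real.exp (C + C) := by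
      intro n w
      refine (abs_sub _ _).trans ?_
      rw [abs_one, Real.abs_exp]
      have e1 := (abs_le.1 (hΦ3 n (w.1, w.2.2))).2
      have e2 := (abs_le.1 (hΦ3 n (w.1, w.2.1))).1
      have := Real.exp_le_exp.2 (by linarith :
        Φ n (w.1, w.2.2) - Φ n (w.1, w.2.1) ≤ C + C)
      linarith
    have hm : ∀ n, Measurable fun w : Torus d × V × V =>
        1 - Real.exp (Φ n (w.1, w.2.2) - Φ n (w.1, w.2.1)) := fun n => by
      have := (hΦ1 n).measurable
      fun_prop
    have hlim := tendsto_integral_of_dominated_convergence (μ := collision d π)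
      (F := fun n w => g w * S w * (1 - Real.exp (Φ n (w.1, w.2.2) - Φ n (w.1, w.2.1))))
      (f := fun w => g w * S w * (1 - Real.exp (φ (w.1, w.2.2) - φ (w.1, w.2.1)))) _
      (fun n => hint.aestronglyMeasurable.mul (hm n).aestronglyMeasurable)
      (hint.norm.mul_const (1 + Real.exp (C + C)))
      (fun n => Eventually.of_forall fun w => by
        rw [norm_mul]
        exact mul_le_mul_of_nonneg_left (hb n w) (norm_nonneg _))
      (by
        filter_upwards [h1, h2] with w h1 h2
        exact (((Real.continuous_exp.tendsto _).comp (h2.sub h1)).const_sub 1).const_mul _)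
    refine le_of_tendsto (ENNReal.Tendsto.const_mul (ENNReal.tendsto_ofReal hlim)
      (Or.inr (by simp))) (Eventually.of_forall fun n => ?_)
    rw [dirichletForm]
    gcongr
    refine le_trans (le_of_eq ?_) (le_iSup _
      (BoundedContinuousFunction.ofNormedAddCommGroup (Φ n) (hΦ1 n) C (hΦ3 n)))
    rw [hQf, integral_prod_withDensity hf hf0]
    congr 1
    refine integral_congr_ae (Eventually.of_forall fun w => ?_)
    simp only [g, S, BoundedContinuousFunction.coe_ofNormedAddCommGroup, mul_assoc]
  have hlogb : ∀ n : ℕ, ∃ C : ℝ, ∀ z, |Real.log (trunc n (f z)) / 2| ≤ C := by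
    intro n
    have hn : (0 : ℝ) < (n : ℝ) + 1 := by positivity
    refine ⟨Real.log ((n : ℝ) + 1), fun z => ?_⟩
    have h1 := Real.log_le_log (by positivity) (one_div_le_trunc n (f z))
    have h2 := Real.log_le_log (trunc_pos n (f z)) (trunc_le n (f z))
    have h3 : 0 ≤ Real.log ((n : ℝ) + 1) := Real.log_nonneg (by simp)
    rw [one_div, Real.log_inv] at h1
    rw [abs_le]
    constructor <;> linarith
  have hn : ∀ n : ℕ, 2 * ENNReal.ofReal (∫ w, g w * S w * (1 - sqrtRatio n (g w) (g' w))
      ∂(collision d π)) ≤ dirichletForm π σ Q := by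
    intro n
    obtain ⟨C, hC⟩ := hlogb n
    have h := hmeas (fun z => Real.log (trunc n (f z)) / 2) (by fun_prop) C hC
    simpa only [sqrtRatio_eq_exp] using h
  have hlim : Tendsto (fun n : ℕ => ∫ w, g w * S w * (1 - sqrtRatio n (g w) (g' w))
      ∂(collision d π)) atTop (𝓝 (∫ w, S w * (g w - √(g w * g' w)) ∂(collision d π))) := by
    refine tendsto_integral_of_dominated_convergence
      (fun w => 2 * (g w * S w + g' w * S w + S w))
      (fun n => by fun_prop) (((hint.add hint').add hintS).const_mul _)
      (fun n => Eventually.of_forall fun w => ?_) (Eventually.of_forall fun w => ?_)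
    · have h0 : 0 ≤ g w * sqrtRatio n (g w) (g' w) :=
        mul_nonneg (hf0 _) (sqrtRatio_nonneg _ _ _)
      have h1 := mul_sqrtRatio_le n (hf0 (w.1, w.2.1)) (hf0 (w.1, w.2.2))
      have h2 : |g w - g w * sqrtRatio n (g w) (g' w)| ≤ 2 * (g w + g' w + 1) := by
        have hg0 : 0 ≤ g w := hf0 _
        have hg0' : 0 ≤ g' w := hf0 _
        change g w * sqrtRatio n (g w) (g' w) ≤ g w + g' w + 1 at h1
        rw [abs_le]
        constructor <;> linarith
      rw [show g w * S w * (1 - sqrtRatio n (g w) (g' w)) =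
        S w * (g w - g w * sqrtRatio n (g w) (g' w)) by ring, norm_mul,
        Real.norm_of_nonneg (hS0 w)]
      calc _ ≤ S w * (2 * (g w + g' w + 1)) := mul_le_mul_of_nonneg_left h2 (hS0 w)
        _ = _ := by ring
    · refine (((tendsto_mul_sqrtRatio (hf0 (w.1, w.2.1)) (hf0 (w.1, w.2.2))).const_sub
        (f (w.1, w.2.1))).const_mul (S w)).congr fun n => ?_
      simp only [g, g']
      ring
  have hfin := le_of_tendsto (ENNReal.Tendsto.const_mul (a := 2) (ENNReal.tendsto_ofReal hlim)
      (Or.inr (by simp))) (Eventually.of_forall hn)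
  refine le_trans (le_of_eq ?_) hfin
  -- symmetrization
  have hsq : ∀ w, S w * (√(g w) - √(g' w)) ^ 2 =
      S w * (g w - √(g w * g' w)) + S w * (g' w - √(g w * g' w)) := by
    intro w
    have h1 := Real.sq_sqrt (hf0 (w.1, w.2.1))
    have h2 := Real.sq_sqrt (hf0 (w.1, w.2.2))
    simp only [g, g']
    rw [Real.sqrt_mul (hf0 _), sub_sq, h1, h2]
    ring
  have hi1 : Integrable (fun w => S w * (g w - √(g w * g' w))) (collision d π) := by
    refine ((hint.add hint').const_mul 2).mono' (by fun_prop) (Eventually.of_forall fun w => ?_)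
    have hg0 : 0 ≤ g w := hf0 _
    have hg0' : 0 ≤ g' w := hf0 _
    have h1 : √(g w * g' w) ≤ g w + g' w := by
      rw [Real.sqrt_le_left (by positivity)]
      nlinarith
    have h2 := Real.sqrt_nonneg (g w * g' w)
    have h3 : |g w - √(g w * g' w)| ≤ 2 * (g w + g' w) := by
      rw [abs_le]
      constructor <;> linarith
    rw [norm_mul, Real.norm_of_nonneg (hS0 w)]
    calc _ ≤ S w * (2 * (g w + g' w)) := mul_le_mul_of_nonneg_left h3 (hS0 w)
      _ = _ := by simp only [Pi.add_apply]; ring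
  have hsw : ∀ w : Torus d × V × V, S (w.1, w.2.2, w.2.1) *
      (g (w.1, w.2.2, w.2.1) - √(g (w.1, w.2.2, w.2.1) * g' (w.1, w.2.2, w.2.1))) =
      S w * (g' w - √(g w * g' w)) := by
    intro w
    simp only [g, g', S, hA.kernel_symm w.2.2 w.2.1, mul_comm (f (w.1, w.2.2))]
  have hi2 : Integrable (fun w => S w * (g' w - √(g w * g' w))) (collision d π) :=
    (measurePreserving_swap_collision.integrable_comp_of_integrable hi1).congr
      (Eventually.of_forall hsw)
  have hsymm : ∫ w, S w * (g' w - √(g w * g' w)) ∂(collision d π) =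
      ∫ w, S w * (g w - √(g w * g' w)) ∂(collision d π) := by
    rw [← measurePreserving_swap_collision.integral_comp
      ((MeasurableEquiv.refl (Torus d)).prodCongr
        (MeasurableEquiv.prodComm (α := V) (β := V))).measurableEmbedding
      (fun w => S w * (g w - √(g w * g' w)))]
    exact integral_congr_ae (Eventually.of_forall fun w => (hsw w).symm)
  have hi3 : Integrable (fun w => S w * (√(g w) - √(g' w)) ^ 2) (collision d π) := by
    simp_rw [hsq]
    exact hi1.add hi2
  change ∫⁻ w, ENNReal.ofReal (S w * (√(g w) - √(g' w)) ^ 2) ∂(collision d π) = _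
  rw [← ofReal_integral_eq_lintegral_ofReal hi3
    (Eventually.of_forall fun w => mul_nonneg (hS0 w) (sq_nonneg _))]
  simp_rw [hsq]
  rw [integral_add hi1 hi2, hsymm, ← two_mul, ENNReal.ofReal_mul zero_le_two]
  simp

end

/-! ### Travelling waves as test functions of the balance equation -/

/-- The frequency of the Fourier mode `k`, as a vector of `ℝ^d`. -/
def frequency {d : ℕ} (k : Fin d → ℤ) : EuclideanSpace ℝ (Fin d) :=
  WithLp.toLp 2 (fun i => (k i : ℝ))

/-- The real plane wave `Re (z e^{2πi (s + k·x)})` with phase shift `s`. -/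
def wave {d : ℕ} (k : Fin d → ℤ) (z : ℂ) (s : ℝ) (x : Torus d) : ℝ :=
  (z * Complex.exp (2 * Real.pi * Complex.I * s) * UnitAddTorus.mFourier k x).re

lemma mFourier_add_toTorus {d : ℕ} (k : Fin d → ℤ) (x : Torus d) (y : EuclideanSpace ℝ (Fin d)) :
    UnitAddTorus.mFourier k (x + toTorus y) =
      Complex.exp (2 * Real.pi * Complex.I * (inner ℝ (frequency k) y : ℝ)) *
        UnitAddTorus.mFourier k x := by
  have h1 : ∀ i, fourier (k i) ((x + toTorus y) i) =
      Complex.exp (2 * Real.pi * Complex.I * (k i * y i : ℝ)) * fourier (k i) (x i) := by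
    intro i
    simp only [Pi.add_apply, toTorus]
    rw [fourier_apply, smul_add, AddCircle.toCircle_add, Circle.coe_mul, mul_comm, ← fourier_apply,
      ← fourier_apply, fourier_coe_apply]
    congr 2
    push_cast
    simp only [div_one]
    ring
  simp only [UnitAddTorus.mFourier, ContinuousMap.coe_mk]
  simp_rw [h1]
  rw [Finset.prod_mul_distrib, ← Complex.exp_sum]
  congr 2
  rw [← Finset.mul_sum]
  congr 1
  simp only [PiLp.inner_apply, frequency, RCLike.inner_apply, conj_trivial]
  push_cast
  exact Finset.sum_congr rfl fun i _ => mul_comm _ _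

lemma wave_add_toTorus {d : ℕ} (k : Fin d → ℤ) (z : ℂ) (s : ℝ) (x : Torus d)
    (y : EuclideanSpace ℝ (Fin d)) :
    wave k z s (x + toTorus y) = wave k z (s + inner ℝ (frequency k) y) x := by
  rw [wave, wave, mFourier_add_toTorus, ← mul_assoc, mul_assoc z, ← Complex.exp_add]
  congr 5
  push_cast
  ring

lemma hasDerivAt_wave {d : ℕ} (k : Fin d → ℤ) (z : ℂ) (s : ℝ) (x : Torus d) :
    HasDerivAt (fun s => wave k z s x) (wave k (2 * Real.pi * Complex.I * z) s x) s := by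
  have h1 : HasDerivAt (fun s : ℝ => 2 * Real.pi * Complex.I * (s : ℂ))
      (2 * Real.pi * Complex.I * 1) s := (Complex.ofRealCLM.hasDerivAt (x := s)).const_mul _
  have h2 := ((h1.cexp.const_mul z).mul_const (UnitAddTorus.mFourier k x))
  have h3 := Complex.reCLM.hasFDerivAt.comp_hasDerivAt s h2
  refine h3.congr_deriv ?_
  simp only [wave, Complex.reCLM_apply]
  congr 1
  ring

@[fun_prop]
lemma continuous_wave {d : ℕ} (k : Fin d → ℤ) (z : ℂ) {X : Type*} [TopologicalSpace X]
    {s : X → ℝ} {x : X → Torus d} (hs : Continuous s) (hx : Continuous x) :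
    Continuous (fun p => wave k z (s p) (x p)) := by
  unfold wave; fun_prop

lemma continuous_wave_prod {d : ℕ} (k : Fin d → ℤ) (z : ℂ) :
    Continuous (fun p : ℝ × Torus d => wave k z p.1 p.2) := by fun_prop

@[fun_prop]
lemma measurable_wave {d : ℕ} (k : Fin d → ℤ) (z : ℂ) {X : Type*} [MeasurableSpace X]
    {s : X → ℝ} {x : X → Torus d} (hs : Measurable s) (hx : Measurable x) :
    Measurable (fun p => wave k z (s p) (x p)) := by
  have h1 : Measurable (fun p => (s p, x p)) := hs.prodMk hx
  have h2 := (continuous_wave_prod k z).measurable.comp h1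
  exact h2

lemma abs_wave_le {d : ℕ} (k : Fin d → ℤ) (z : ℂ) (s : ℝ) (x : Torus d) :
    |wave k z s x| ≤ ‖z‖ := by
  refine (Complex.abs_re_le_norm _).trans ?_
  rw [norm_mul, norm_mul, show (2 * Real.pi * Complex.I * s : ℂ) = ((2 * Real.pi * s : ℝ) : ℂ) *
    Complex.I by push_cast; ring, Complex.norm_exp_ofReal_mul_I, mul_one]
  have h : ‖UnitAddTorus.mFourier k x‖ ≤ 1 :=
    (ContinuousMap.norm_coe_le_norm _ _).trans_eq UnitAddTorus.mFourier_norm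
  exact mul_le_of_le_one_right (norm_nonneg _) h

lemma torusGradient_mul_wave {d : ℕ} (k : Fin d → ℤ) (r : ℝ) (z : ℂ) (s : ℝ) (x : Torus d) :
    torusGradient (fun x => r * wave k z s x) x =
      (r * wave k (2 * Real.pi * Complex.I * z) s x) • frequency k := by
  refine HasGradientAt.gradient ?_
  rw [hasGradientAt_iff_hasFDerivAt]
  simp_rw [wave_add_toTorus]
  have h1 : HasFDerivAt (fun y : EuclideanSpace ℝ (Fin d) => s + inner ℝ (frequency k) y)
      (innerSL ℝ (frequency k)) 0 := ((innerSL ℝ (frequency k)).hasFDerivAt).const_add s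
  have h2 := HasDerivAt.comp_hasFDerivAt (f := fun y => s + inner ℝ (frequency k) y)
    (h₂ := fun s => wave k z s x) 0 (hasDerivAt_wave k z _ x) h1
  refine (h2.const_mul r).congr_fderiv ?_
  ext y
  simp [mul_assoc]

/-- A wave travelling with the velocity-dependent speed `B`, localized in time and velocity, is a
test function of the balance equation. -/
lemma isBalanceTest_wave {d : ℕ} {V : Type*} [TopologicalSpace V] [T2Space V] {a c : ℝ} {η : ℝ → ℝ}
    (hη : ContDiff ℝ 1 η) (hηc : HasCompactSupport η) (hηs : tsupport η ⊆ Ioo a c)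
    {χ B : V → ℝ} (hχ : Continuous χ) (hχc : HasCompactSupport χ) (hB : Continuous B)
    (k : Fin d → ℤ) (z : ℂ) :
    IsBalanceTest a c
      (fun p : ℝ × Torus d × V => η p.1 * χ p.2.2 * wave k z (-(B p.2.2) * p.1) p.2.1) := by
  have hηcont := hη.continuous
  have hη' : Continuous (deriv η) := hη.continuous_deriv le_rfl
  have hsupp : Function.support
      (fun p : ℝ × Torus d × V => η p.1 * χ p.2.2 * wave k z (-(B p.2.2) * p.1) p.2.1) ⊆
      tsupport η ×ˢ univ ×ˢ tsupport χ := by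
    intro p hp
    rw [Function.mem_support] at hp
    have h1 : η p.1 ≠ 0 := fun h => hp (by simp [h])
    have h2 : χ p.2.2 ≠ 0 := fun h => hp (by simp [h])
    exact ⟨subset_tsupport _ h1, mem_univ _, subset_tsupport _ h2⟩
  have hK : IsCompact (tsupport η ×ˢ (univ : Set (Torus d)) ×ˢ tsupport χ) :=
    hηc.isCompact.prod (isCompact_univ.prod hχc.isCompact)
  refine ⟨by fun_prop, ?_, ?_, ?_, ?_, ?_⟩
  · exact HasCompactSupport.of_support_subset_isCompact hK hsupp
  · exact (closure_minimal hsupp hK.isClosed).trans (prod_mono hηs (subset_univ _))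
  · intro v
    have hw : ContDiff ℝ 1 (fun s : ℝ => wave k z s 0) := by
      unfold wave
      generalize UnitAddTorus.mFourier k (0 : Torus d) = m
      have h1 : ContDiff ℝ 1 fun s : ℝ => (s : ℂ) := Complex.ofRealCLM.contDiff
      have h2 : ContDiff ℝ 1 fun s : ℝ => z * Complex.exp (2 * Real.pi * Complex.I * s) * m :=
        (contDiff_const.mul (contDiff_const.mul h1).cexp).mul contDiff_const
      exact Complex.reCLM.contDiff.comp h2
    have e : (fun y : ℝ × EuclideanSpace ℝ (Fin d) =>
        η y.1 * χ v * wave k z (-(B v) * y.1) (toTorus y.2)) = fun y =>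
        η y.1 * χ v * wave k z (-(B v) * y.1 + inner ℝ (frequency k) y.2) 0 := by
      ext y
      rw [← wave_add_toTorus, zero_add]
    simp only
    rw [e]
    have h3 : ContDiff ℝ 1 (fun y : ℝ × EuclideanSpace ℝ (Fin d) =>
        -(B v) * y.1 + inner ℝ (frequency k) y.2) :=
      (contDiff_const.mul contDiff_fst).add ((innerSL ℝ (frequency k)).contDiff.comp contDiff_snd)
    exact ((hη.comp contDiff_fst).mul contDiff_const).mul (hw.comp h3)
  · have e : (fun p : ℝ × Torus d × V => deriv (fun t =>
        η t * χ p.2.2 * wave k z (-(B p.2.2) * t) p.2.1) p.1) = fun p =>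
        deriv η p.1 * χ p.2.2 * wave k z (-(B p.2.2) * p.1) p.2.1 + η p.1 * χ p.2.2 *
          (wave k (2 * Real.pi * Complex.I * z) (-(B p.2.2) * p.1) p.2.1 * -(B p.2.2)) := by
      ext p
      have h1 := ((hη.differentiable one_ne_zero p.1).hasDerivAt).mul_const (χ p.2.2)
      have h2 : HasDerivAt (fun t => -(B p.2.2) * t) (-(B p.2.2)) p.1 := by
        simpa using (hasDerivAt_id p.1).const_mul (-(B p.2.2))
      exact (h1.mul ((hasDerivAt_wave k z _ p.2.1).comp p.1 h2)).deriv
    simp only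
    rw [e]
    fun_prop
  · simp only [torusGradient_mul_wave]
    fun_prop

/-- The transport operator applied to a travelling wave. -/
lemma transport_wave {d : ℕ} {V : Type*} {η : ℝ → ℝ} (hη : ContDiff ℝ 1 η) (χ B : V → ℝ)
    (b : V → EuclideanSpace ℝ (Fin d)) (k : Fin d → ℤ) (z : ℂ) (t : ℝ) (x : Torus d) (v : V) :
    deriv (fun u => η u * χ v * wave k z (-(B v) * u) x) t +
      inner ℝ (b v) (torusGradient (fun x => η t * χ v * wave k z (-(B v) * t) x) x) =
      deriv η t * χ v * wave k z (-(B v) * t) x + η t * χ v *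
        wave k (2 * Real.pi * Complex.I * z) (-(B v) * t) x *
          (inner ℝ (frequency k) (b v) - B v) := by
  have h1 := ((hη.differentiable one_ne_zero t).hasDerivAt).mul_const (χ v)
  have h2 : HasDerivAt (fun t => -(B v) * t) (-(B v)) t := by
    simpa using (hasDerivAt_id t).const_mul (-(B v))
  have h3 := (h1.mul ((hasDerivAt_wave k z _ x).comp t h2)).deriv
  rw [torusGradient_mul_wave, inner_smul_right, real_inner_comm]
  refine (congrArg (· + _) h3).trans ?_
  simp only [Function.comp]
  ring

/-! ### The balance equation along the free flow -/

/-- The reference measure `dt dx π(dv)` on the phase space at times in `[a,c]`. -/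
abbrev timePhase (d : ℕ) {V : Type*} [MeasurableSpace V] (π : Measure V) (a c : ℝ) :
    Measure (ℝ × Torus d × V) :=
  ((volume : Measure ℝ).restrict (Icc a c)).prod (phase d π)

lemma IsDensityPath.integral_eq {d : ℕ} {V : Type*} [MeasurableSpace V] {π : Measure V}
    {a c : ℝ} {P : ℝ → ProbabilityMeasure (Torus d × V)} {ρ : ℝ × Torus d × V → ℝ}
    (hρ : IsDensityPath π a c (fun t => (P t : Measure (Torus d × V))) ρ)
    {t : ℝ} (ht : t ∈ Icc a c) (F : Torus d × V → ℝ) :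
    ∫ z, F z ∂(P t : Measure (Torus d × V)) = ∫ z, ρ (t, z) * F z ∂(phase d π) := by
  have := hρ.measurable_slice t
  rw [hρ.eq t ht, integral_withDensity_eq_integral_toReal_smul this.ennreal_ofReal (by simp)]
  simp only [ENNReal.toReal_ofReal (hρ.nonneg _), smul_eq_mul]

lemma ae_timePhase_of_ae {d : ℕ} {V : Type*} [MeasurableSpace V] {π : Measure V}
    [SFinite π] {a c : ℝ} {p : V → Prop} (h : ∀ᵐ v ∂π, p v) :
    ∀ᵐ q ∂(timePhase d π a c), p q.2.2 := by
  have h1 : ∀ᵐ z ∂(phase d π), p z.2 := Measure.quasiMeasurePreserving_snd.ae h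
  exact Measure.quasiMeasurePreserving_snd.ae h1

lemma ae_timeCollision_of_ae {d : ℕ} {V : Type*} [MeasurableSpace V] {π : Measure V}
    [SFinite π] {a c : ℝ} {p : V → Prop} (h : ∀ᵐ v ∂π, p v) :
    ∀ᵐ q ∂(timeCollision d π a c), p q.2.2.1 := by
  have h1 : ∀ᵐ w ∂(π.prod π), p w.1 := Measure.quasiMeasurePreserving_fst.ae h
  have h2 : ∀ᵐ w ∂(collision d π), p w.2.1 := Measure.quasiMeasurePreserving_snd.ae h1
  exact Measure.quasiMeasurePreserving_snd.ae h2

lemma integral_path {d : ℕ} {V : Type*} [MeasurableSpace V] {π : Measure V}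
    [IsProbabilityMeasure π] {a c : ℝ} {P : ℝ → ProbabilityMeasure (Torus d × V)}
    {ρ : ℝ × Torus d × V → ℝ} (hac : a ≤ c)
    (hρ : IsDensityPath π a c (fun t => (P t : Measure (Torus d × V))) ρ)
    {F : ℝ × Torus d × V → ℝ} (hF : Integrable (fun p => ρ p * F p) (timePhase d π a c)) :
    ∫ t in a..c, ∫ z, F (t, z) ∂(P t : Measure (Torus d × V)) =
      ∫ p, ρ p * F p ∂(timePhase d π a c) := by
  rw [integral_prod _ hF, intervalIntegral.integral_of_le hac, ← integral_Icc_eq_integral_Ioc]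
  exact setIntegral_congr_fun measurableSet_Icc fun t ht => hρ.integral_eq ht _

/-- Functions of the velocity with an exponential moment are integrable along the path. -/
lemma integrable_density_mul {d : ℕ} {V : Type*} [MeasurableSpace V] {π : Measure V}
    [IsProbabilityMeasure π] {a c : ℝ} {P : ℝ → ProbabilityMeasure (Torus d × V)}
    {ρ : ℝ × Torus d × V → ℝ} (hH : (⨆ t ∈ Icc a c, entropy π (P t)) < ⊤)
    (hρ : IsDensityPath π a c (fun t => (P t : Measure (Torus d × V))) ρ)
    {g : V → ℝ} (hg : Measurable g) (hg0 : ∀ v, 0 ≤ g v)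
    (hexp : Integrable (fun v => Real.exp (g v)) π) :
    Integrable (fun p => ρ p * g p.2.2) (timePhase d π a c) := by
  have hm : Measurable (fun p => ρ p * g p.2.2) := hρ.measurable.mul (by fun_prop)
  refine integrable_of_lintegral_lt_top hm (fun p => mul_nonneg (hρ.nonneg _) (hg0 _)) ?_
  obtain ⟨M, hM, hM'⟩ := exists_lintegral_le_of_entropy_le (d := d) hg hg0 hexp hH
  rw [lintegral_prod _ hm.ennreal_ofReal.aemeasurable]
  calc _ ≤ ∫⁻ t in Icc a c, M := by
        refine setLIntegral_mono' measurableSet_Icc fun t ht => ?_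
        refine le_trans (le_of_eq ?_) (hM' (P t) (le_iSup₂ (f := fun t _ => entropy π (P t)) t ht))
        have := hρ.measurable_slice t
        rw [hρ.eq t ht, lintegral_withDensity_eq_lintegral_mul _ this.ennreal_ofReal
          (by fun_prop)]
        simp only [ENNReal.ofReal_mul (hρ.nonneg _), Pi.mul_apply]
    _ < ⊤ := by
        rw [lintegral_const]
        exact ENNReal.mul_lt_top hM (by simp)

lemma integrable_density {d : ℕ} {V : Type*} [MeasurableSpace V] {π : Measure V}
    [IsProbabilityMeasure π] {a c : ℝ} {P : ℝ → ProbabilityMeasure (Torus d × V)}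
    {ρ : ℝ × Torus d × V → ℝ} (hH : (⨆ t ∈ Icc a c, entropy π (P t)) < ⊤)
    (hρ : IsDensityPath π a c (fun t => (P t : Measure (Torus d × V))) ρ) :
    Integrable ρ (timePhase d π a c) := by
  simpa using integrable_density_mul hH hρ (measurable_const (a := (1 : ℝ)))
    (fun _ => zero_le_one) (integrable_const _)

section

variable {d : ℕ} {V : Type*} [TopologicalSpace V] [PolishSpace V]
  [MeasurableSpace V] [BorelSpace V] {π : Measure V} [IsProbabilityMeasure π]
  {σ : V → V → ℝ} {b : V → EuclideanSpace ℝ (Fin d)} {a c : ℝ}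
  {P : ℝ → ProbabilityMeasure (Torus d × V)} {ρ : ℝ × Torus d × V → ℝ}
  {Θ : SignedMeasure (ℝ × Torus d × V × V)}

/-- The balance equation tested with waves travelling with the exact speed `-b(v)`, for which the
transport term disappears. The speed and the localization in velocity are approximated by
continuous functions. -/
lemma balance_wave [LocallyCompactSpace V] (hA : Admissible π σ b) (hac : a ≤ c)
    (hH : (⨆ t ∈ Icc a c, entropy π (P t)) < ⊤)
    (hρ : IsDensityPath π a c (fun t => (P t : Measure (Torus d × V))) ρ)
    (hbal : BalanceEquation b a c P Θ)
    (hΘ : VectorMeasure.map Θ (swapVelocities (d := d) (V := V)) = -Θ)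
    {g : ℝ × Torus d × V × V → ℝ} (hgm : Measurable g) (hg : Integrable g (timeCollision d π a c))
    (hΘg : Θ = (timeCollision d π a c).withDensityᵥ g)
    {η : ℝ → ℝ} (hη : ContDiff ℝ 1 η) (hηc : HasCompactSupport η) (hηs : tsupport η ⊆ Ioo a c)
    {χ : V → ℝ} (hχ : Measurable χ) (hχ1 : ∀ v, |χ v| ≤ 1) (k : Fin d → ℤ) (z : ℂ) :
    ∫ p, ρ p * (deriv η p.1 *
        (χ p.2.2 * wave k z (-(inner ℝ (frequency k) (b p.2.2)) * p.1) p.2.1))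
        ∂(timePhase d π a c) =
      ∫ q, η q.1 * (χ q.2.2.1 * wave k z (-(inner ℝ (frequency k) (b q.2.2.1)) * q.1) q.2.1) * g q
        ∂(timeCollision d π a c) := by
  have hb := hA.measurable_drift
  let β : V → ℝ := fun v => inner ℝ (frequency k) (b v)
  have hβ : Measurable β := by fun_prop
  have hβb : ∀ v, |β v| ≤ ‖frequency k‖ * ‖b v‖ := fun v => abs_real_inner_le_norm _ _
  let z' : ℂ := 2 * Real.pi * Complex.I * z
  -- the approximating speeds and localizations
  have hρint := integrable_density hH hρ
  have hρb : Integrable (fun p => ρ p * ‖b p.2.2‖) (timePhase d π a c) :=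
    integrable_density_mul hH hρ hb.norm (fun _ => norm_nonneg _)
      (by simpa using hA.exp_moment_drift 1 zero_le_one)
  have hρm := hρ.measurable
  have hρβ : Integrable (fun p => ρ p * β p.2.2) (timePhase d π a c) := by
    refine (hρb.const_mul ‖frequency k‖).mono' (hρm.mul (by fun_prop)).aestronglyMeasurable
      (Eventually.of_forall fun p => ?_)
    rw [norm_mul, Real.norm_of_nonneg (hρ.nonneg p)]
    calc _ ≤ ρ p * (‖frequency k‖ * ‖b p.2.2‖) :=
          mul_le_mul_of_nonneg_left (hβb _) (hρ.nonneg p)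
      _ = _ := by ring
  have hβπ : Integrable β π := by
    refine ((hA.exp_moment_drift 1 zero_le_one).const_mul ‖frequency k‖).mono'
      hβ.aestronglyMeasurable (Eventually.of_forall fun v => (hβb v).trans ?_)
    rw [one_mul]
    exact mul_le_mul_of_nonneg_left (by linarith [Real.add_one_le_exp ‖b v‖]) (norm_nonneg _)
  let μP : Measure (ℝ × Torus d × V) :=
    (timePhase d π a c).withDensity (fun p => ENNReal.ofReal (ρ p))
  have : IsFiniteMeasure μP := isFiniteMeasure_withDensity_ofReal hρint.2
  have hpr : Measurable (fun p : ℝ × Torus d × V => p.2.2) := by fun_prop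
  have hμPint : ∀ f : V → ℝ, Measurable f → (Integrable f (μP.map fun p => p.2.2) ↔
      Integrable (fun p => ρ p * f p.2.2) (timePhase d π a c)) := by
    intro f hf
    rw [integrable_map_measure hf.aestronglyMeasurable hpr.aemeasurable,
      integrable_withDensity_iff_integrable_smul₀' (by fun_prop) (by simp)]
    simp [ENNReal.toReal_ofReal (hρ.nonneg _)]
  have hμPeq : ∀ f : V → ℝ, Measurable f → ∫ v, f v ∂(μP.map fun p => p.2.2) =
      ∫ p, ρ p * f p.2.2 ∂(timePhase d π a c) := by
    intro f hf
    rw [integral_map hpr.aemeasurable hf.aestronglyMeasurable,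
      integral_withDensity_eq_integral_toReal_smul (by fun_prop) (by simp)]
    simp [ENNReal.toReal_ofReal (hρ.nonneg _)]
  obtain ⟨B, hB1, hB2, hB3, hB4, hB5⟩ := exists_seq_continuous_tendsto_ae_and_integral
    (π + μP.map fun p => p.2.2) (g := β)
    (integrable_add_measure.2 ⟨hβπ, (hμPint β hβ).2 hρβ⟩)
  obtain ⟨X, hX1, hX2, hX3, hX4⟩ := exists_seq_continuous_bounded_tendsto_ae π hχ hχ1
  rw [ae_add_measure_iff] at hB5
  have hBm : ∀ n, Measurable (B n) := fun n => (hB1 n).measurable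
  have hXm : ∀ n, Measurable (X n) := fun n => (hX1 n).measurable
  have hρB : ∀ n, Integrable (fun p => ρ p * |B n p.2.2 - β p.2.2|) (timePhase d π a c) := by
    intro n
    have h := (hμPint (fun v => |B n v - β v|) (by have := hBm n; fun_prop)).1
    exact h (((integrable_add_measure.1 (hB3 n)).2.sub ((hμPint β hβ).2 hρβ)).abs)
  have hρBlim : Tendsto (fun n => ∫ p, ρ p * |B n p.2.2 - β p.2.2| ∂(timePhase d π a c))
      atTop (𝓝 0) := by
    refine squeeze_zero (fun n => integral_nonneg fun p =>
      mul_nonneg (hρ.nonneg p) (abs_nonneg _)) (fun n => ?_) hB4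
    have hi1 : Integrable (fun v => |B n v - β v|) π :=
      ((integrable_add_measure.1 (hB3 n)).1.sub hβπ).abs
    have hi2 : Integrable (fun v => |B n v - β v|) (μP.map fun p => p.2.2) :=
      ((integrable_add_measure.1 (hB3 n)).2.sub ((hμPint β hβ).2 hρβ)).abs
    rw [integral_add_measure hi1 hi2, hμPeq (fun v => |B n v - β v|)
      (by have := hBm n; fun_prop)]
    have : 0 ≤ ∫ v, |B n v - β v| ∂π := integral_nonneg fun _ => abs_nonneg _
    linarith
  -- bounds on the localization in time
  obtain ⟨C, hC⟩ := hηc.exists_bound_of_continuous hη.continuous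
  obtain ⟨D, hD⟩ := hηc.deriv.exists_bound_of_continuous (hη.continuous_deriv le_rfl)
  have hηm : Measurable η := hη.continuous.measurable
  have hη'm : Measurable (deriv η) := (hη.continuous_deriv le_rfl).measurable
  have hC0 : 0 ≤ C := (norm_nonneg _).trans (hC 0)
  have hXw : ∀ n v w s x, |X n v * wave k w s x| ≤ ‖w‖ := fun n v w s x => by
    rw [abs_mul]
    exact (mul_le_mul (hX3 n v) (abs_wave_le _ _ _ _) (abs_nonneg _) zero_le_one).trans
      (one_mul _).le
  -- the two terms of the transport operator, and the current
  let F1 : ℕ → ℝ × Torus d × V → ℝ := fun n p =>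
    ρ p * (deriv η p.1 * (X n p.2.2 * wave k z (-(B n p.2.2) * p.1) p.2.1))
  let F2 : ℕ → ℝ × Torus d × V → ℝ := fun n p =>
    ρ p * (η p.1 * (X n p.2.2 * wave k z' (-(B n p.2.2) * p.1) p.2.1) * (β p.2.2 - B n p.2.2))
  let F3 : ℕ → ℝ × Torus d × V × V → ℝ := fun n q =>
    η q.1 * (X n q.2.2.1 * wave k z (-(B n q.2.2.1) * q.1) q.2.1)
  have hF1b : ∀ n p, ‖F1 n p‖ ≤ ρ p * (D * ‖z‖) := fun n p => by
    rw [norm_mul, norm_mul, Real.norm_of_nonneg (hρ.nonneg p)]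
    exact mul_le_mul_of_nonneg_left (mul_le_mul (hD _) (hXw _ _ _ _ _) (norm_nonneg _)
      ((norm_nonneg _).trans (hD 0))) (hρ.nonneg p)
  have hF1m : ∀ n, Measurable (F1 n) := fun n => by
    have := hBm n
    have := hXm n
    fun_prop
  have hF2m : ∀ n, Measurable (F2 n) := fun n => by
    have := hBm n
    have := hXm n
    fun_prop
  have hF3m : ∀ n, Measurable (F3 n) := fun n => by
    have := hBm n
    have := hXm n
    fun_prop
  have hF2b : ∀ n p, ‖F2 n p‖ ≤ C * ‖z'‖ * (ρ p * |B n p.2.2 - β p.2.2|) := fun n p => by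
    rw [norm_mul, norm_mul, norm_mul, Real.norm_of_nonneg (hρ.nonneg p)]
    calc _ ≤ ρ p * (C * ‖z'‖ * |B n p.2.2 - β p.2.2|) := by
          rw [Real.norm_eq_abs (β p.2.2 - B n p.2.2), abs_sub_comm]
          exact mul_le_mul_of_nonneg_left (mul_le_mul_of_nonneg_right (mul_le_mul (hC _)
            (hXw _ _ _ _ _) (norm_nonneg _) hC0) (abs_nonneg _)) (hρ.nonneg p)
      _ = _ := by ring
  have hF3b : ∀ n q, |F3 n q| ≤ C * ‖z‖ := fun n q => by
    rw [abs_mul]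
    exact mul_le_mul (hC _) (hXw _ _ _ _ _) (abs_nonneg _) hC0
  have hF1i : ∀ n, Integrable (F1 n) (timePhase d π a c) := fun n =>
    (hρint.mul_const _).mono' (hF1m n).aestronglyMeasurable (Eventually.of_forall (hF1b n))
  have hF2i : ∀ n, Integrable (F2 n) (timePhase d π a c) := fun n =>
    ((hρB n).const_mul _).mono' (hF2m n).aestronglyMeasurable (Eventually.of_forall (hF2b n))
  have hn : ∀ n, ∫ p, F1 n p ∂(timePhase d π a c) + ∫ p, F2 n p ∂(timePhase d π a c) =
      ∫ q, F3 n q * g q ∂(timeCollision d π a c) := by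
    intro n
    have h := hbal _ (isBalanceTest_wave hη hηc hηs (hX1 n) (hX2 n) (hB1 n) k z)
    simp only [transport_wave hη] at h
    rw [integral_path hac hρ (F := fun p => deriv η p.1 * X n p.2.2 *
      wave k z (-(B n p.2.2) * p.1) p.2.1 + η p.1 * X n p.2.2 *
      wave k (2 * Real.pi * Complex.I * z) (-(B n p.2.2) * p.1) p.2.1 *
      (inner ℝ (frequency k) (b p.2.2) - B n p.2.2))] at h
    · rw [← integral_add (hF1i n) (hF2i n)]
      have e : ∀ p, F1 n p + F2 n p = ρ p * (deriv η p.1 * X n p.2.2 *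
          wave k z (-(B n p.2.2) * p.1) p.2.1 + η p.1 * X n p.2.2 *
          wave k (2 * Real.pi * Complex.I * z) (-(B n p.2.2) * p.1) p.2.1 *
          (inner ℝ (frequency k) (b p.2.2) - B n p.2.2)) := fun p => by
        simp only [F1, F2, β, z']
        ring
      simp_rw [e]
      rw [h]
      have e2 : ∀ q : ℝ × Torus d × V × V, η q.1 * X n q.2.2.1 *
          wave k z (-(B n q.2.2.1) * q.1) q.2.1 - η q.1 * X n q.2.2.2 *
          wave k z (-(B n q.2.2.2) * q.1) q.2.1 = F3 n q - F3 n (swapVelocities q) := fun q => by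
        simp only [F3, swapVelocities, mul_assoc]
      simp_rw [e2]
      rw [VectorMeasure.integral_fun_sub (integrable_variation_of_bound Θ (hF3m n) (hF3b n))
        (integrable_variation_of_bound Θ ((hF3m n).comp measurable_swapVelocities)
          (fun q => hF3b n (swapVelocities q))) (g := fun q => F3 n (swapVelocities q)),
        vectorIntegral_swapVelocities hΘ, hΘg, vectorIntegral_withDensity hgm hg (hF3m n) (hF3b n)]
      ring
    · refine ((hF1i n).add (hF2i n)).congr (Eventually.of_forall fun p => ?_)
      simp only [F1, F2, β, z', Pi.add_apply]
      ring
  -- passage to the limit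
  have hwlim : ∀ (s : ℝ) (x : Torus d) (v : V), Tendsto (fun n => X n v) atTop (𝓝 (χ v)) →
      Tendsto (fun n => B n v) atTop (𝓝 (β v)) →
      Tendsto (fun n => X n v * wave k z (-(B n v) * s) x) atTop
        (𝓝 (χ v * wave k z (-(β v) * s) x)) := by
    intro s x v h1 h2
    have hw : Continuous (fun r => wave k z (-r * s) x) := by fun_prop
    exact h1.mul ((hw.tendsto _).comp h2)
  have hlim1 : Tendsto (fun n => ∫ p, F1 n p ∂(timePhase d π a c)) atTop
      (𝓝 (∫ p, ρ p * (deriv η p.1 * (χ p.2.2 * wave k z (-(β p.2.2) * p.1) p.2.1))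
        ∂(timePhase d π a c))) := by
    refine tendsto_integral_of_dominated_convergence _
      (fun n => (hF1m n).aestronglyMeasurable) (hρint.mul_const (D * ‖z‖))
      (fun n => Eventually.of_forall (hF1b n)) ?_
    filter_upwards [ae_timePhase_of_ae (d := d) (a := a) (c := c) hX4,
      ae_timePhase_of_ae (d := d) (a := a) (c := c) hB5.1] with p h1 h2
    exact ((hwlim _ _ _ h1 h2).const_mul _).const_mul _
  have hlim2 : Tendsto (fun n => ∫ p, F2 n p ∂(timePhase d π a c)) atTop (𝓝 0) := by
    have h0 : Tendsto (fun n => C * ‖z'‖ * ∫ p, ρ p * |B n p.2.2 - β p.2.2|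
        ∂(timePhase d π a c)) atTop (𝓝 0) := by simpa using hρBlim.const_mul (C * ‖z'‖)
    refine squeeze_zero_norm (fun n => ?_) h0
    rw [← integral_const_mul]
    exact norm_integral_le_of_norm_le ((hρB n).const_mul _) (Eventually.of_forall (hF2b n))
  have hlim3 : Tendsto (fun n => ∫ q, F3 n q * g q ∂(timeCollision d π a c)) atTop
      (𝓝 (∫ q, η q.1 * (χ q.2.2.1 * wave k z (-(β q.2.2.1) * q.1) q.2.1) * g q
        ∂(timeCollision d π a c))) := by
    refine tendsto_integral_of_dominated_convergence (fun q => C * ‖z‖ * ‖g q‖)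
      (fun n => ((hF3m n).mul hgm).aestronglyMeasurable) (hg.norm.const_mul _)
      (fun n => Eventually.of_forall fun q => ?_) ?_
    · rw [norm_mul]
      exact mul_le_mul_of_nonneg_right (hF3b n q) (norm_nonneg _)
    · filter_upwards [ae_timeCollision_of_ae (d := d) (a := a) (c := c) hX4,
        ae_timeCollision_of_ae (d := d) (a := a) (c := c) hB5.1] with q h1 h2
      exact ((hwlim _ _ _ h1 h2).const_mul _).mul_const _
  have h := hlim1.add hlim2
  rw [add_zero] at h
  exact tendsto_nhds_unique h (hlim3.congr fun n => (hn n).symm)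

end

/-! ### Functions of one real variable: weak derivatives and the chain rule -/

/-- A continuous function on `[a,c]` whose weak derivative is the integrable function `-K` is a
primitive of `-K`. -/
lemma eq_sub_integral_of_weak_deriv {a c : ℝ} (hac : a < c) {U K : ℝ → ℝ}
    (hU : ContinuousOn U (Icc a c)) (hK : IntegrableOn K (Icc a c))
    (h : ∀ η : ℝ → ℝ, ContDiff ℝ 1 η → HasCompactSupport η → tsupport η ⊆ Ioo a c →
      ∫ t in Icc a c, deriv η t * U t = ∫ t in Icc a c, η t * K t) :
    ∀ t ∈ Icc a c, U t = U a - ∫ s in a..t, K s := by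
  have huIcc : uIcc a c = Icc a c := uIcc_of_le hac.le
  have hKi : IntervalIntegrable K volume a c :=
    (intervalIntegrable_iff_integrableOn_Icc_of_le hac.le).2 hK
  let J : ℝ → ℝ := fun t => ∫ s in a..t, K s
  have hJac : AbsolutelyContinuousOnInterval J a c :=
    hKi.absolutelyContinuousOnInterval_intervalIntegral (by simp)
  let W : ℝ → ℝ := fun t => U t + J t
  have hWc : ContinuousOn W (Icc a c) := hU.add (huIcc ▸ hJac.continuousOn)
  have hset : ∀ f : ℝ → ℝ, ∫ t in Icc a c, f t = ∫ t in a..c, f t := fun f => by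
    rw [intervalIntegral.integral_of_le hac.le, integral_Icc_eq_integral_Ioc]
  -- `W` has vanishing weak derivative
  have hW : ∀ η : ℝ → ℝ, ContDiff ℝ 1 η → HasCompactSupport η → tsupport η ⊆ Ioo a c →
      ∫ t in a..c, deriv η t * W t = 0 := by
    intro η h1 h2 h3
    have hηac : AbsolutelyContinuousOnInterval η a c := h1.contDiffOn.absolutelyContinuousOnInterval
    have ha : η a = 0 := image_eq_zero_of_notMem_tsupport fun ha => (h3 ha).1.false
    have hc : η c = 0 := image_eq_zero_of_notMem_tsupport fun hc => (h3 hc).2.false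
    have hη' : Continuous (deriv η) := h1.continuous_deriv le_rfl
    have hp := hηac.integral_mul_deriv_eq_deriv_mul hJac
    rw [ha, hc, zero_mul, zero_mul, sub_zero, zero_sub] at hp
    have hJd : ∫ t in a..c, η t * deriv J t = ∫ t in a..c, η t * K t := by
      refine intervalIntegral.integral_congr_ae ?_
      filter_upwards [hKi.ae_hasDerivAt_integral] with x hx hx'
      rw [(hx (uIoc_subset_uIcc hx') a (by simp)).deriv]
    have hUi : IntervalIntegrable (fun t => deriv η t * U t) volume a c :=
      (hη'.continuousOn.mul (huIcc ▸ hU)).intervalIntegrable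
    have hJi : IntervalIntegrable (fun t => deriv η t * J t) volume a c :=
      (hη'.continuousOn.mul hJac.continuousOn).intervalIntegrable
    have e : ∀ t, deriv η t * W t = deriv η t * U t + deriv η t * J t := fun t => mul_add _ _ _
    simp_rw [e]
    rw [intervalIntegral.integral_add hUi hJi, ← hset, h η h1 h2 h3, hset, ← hJd, hp]
    ring
  -- a smooth function supported inside the interval with integral one
  obtain ⟨θ, hθ1, hθ2, hθ3, hθ4⟩ : ∃ θ : ℝ → ℝ, ContDiff ℝ ((⊤ : ℕ∞) : WithTop ℕ∞) θ ∧ HasCompactSupport θ ∧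
      tsupport θ ⊆ Ioo a c ∧ ∫ t in a..c, θ t = 1 := by
    have hr : 0 < (c - a) / 4 := by linarith
    let φ : ContDiffBump ((a + c) / 2) := ⟨(c - a) / 8, (c - a) / 4, by linarith, by linarith⟩
    have hs : tsupport (φ.normed volume) ⊆ Ioo a c := by
      rw [φ.tsupport_normed_eq]
      intro x hx
      have hx' := abs_le.1 ((Real.dist_eq _ _).symm.trans_le (Metric.mem_closedBall.1 hx))
      have e : φ.rOut = (c - a) / 4 := rfl
      rw [e] at hx'
      constructor <;> linarith
    refine ⟨φ.normed volume, φ.contDiff_normed, φ.hasCompactSupport_normed, hs, ?_⟩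
    rw [← φ.integral_normed (μ := volume), intervalIntegral.integral_of_le hac.le,
      setIntegral_eq_integral_of_forall_compl_eq_zero]
    exact fun x hx => image_eq_zero_of_notMem_tsupport fun hx' => hx (Ioo_subset_Ioc_self (hs hx'))
  let C : ℝ := ∫ t in a..c, θ t * W t
  have hWi : ∀ g : ℝ → ℝ, Continuous g → IntervalIntegrable (fun t => g t * W t) volume a c :=
    fun g hg => (hg.continuousOn.mul (huIcc ▸ hWc)).intervalIntegrable
  -- `W` is orthogonal to every test function up to the constant `C`
  have horth : ∀ g : ℝ → ℝ, ContDiff ℝ ((⊤ : ℕ∞) : WithTop ℕ∞) g → HasCompactSupport g → tsupport g ⊆ Ioo a c →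
      ∫ t in a..c, g t * W t = (∫ t in a..c, g t) * C := by
    intro g hg1 hg2 hg3
    let m : ℝ := ∫ t in a..c, g t
    let ψ : ℝ → ℝ := fun t => g t - m * θ t
    have hψ1 : ContDiff ℝ ((⊤ : ℕ∞) : WithTop ℕ∞) ψ := hg1.sub (contDiff_const.mul hθ1)
    have hψc : Continuous ψ := hψ1.continuous
    let S : Set ℝ := tsupport g ∪ tsupport θ
    have hS : IsCompact S := hg2.isCompact.union hθ2.isCompact
    have hSne : S.Nonempty := by
      by_contra hne
      rw [not_nonempty_iff_eq_empty, union_empty_iff, tsupport_eq_empty_iff,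
        tsupport_eq_empty_iff] at hne
      rw [hne.2] at hθ4
      simp at hθ4
    have hSs : S ⊆ Ioo a c := union_subset hg3 hθ3
    have hψS : ∀ t, t ∉ S → ψ t = 0 := fun t ht => by
      rw [mem_union, not_or] at ht
      simp [ψ, image_eq_zero_of_notMem_tsupport ht.1, image_eq_zero_of_notMem_tsupport ht.2]
    have hψ0 : ∫ t in a..c, ψ t = 0 := by
      simp only [ψ]
      rw [intervalIntegral.integral_sub (hg1.continuous.intervalIntegrable _ _)
        ((hθ1.continuous.intervalIntegrable _ _).const_mul _),
        intervalIntegral.integral_const_mul, hθ4]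
      simp [m]
    let η : ℝ → ℝ := fun t => ∫ s in a..t, ψ s
    have hηd : ∀ t, HasDerivAt η (ψ t) t := fun t =>
      intervalIntegral.integral_hasDerivAt_right (hψc.intervalIntegrable _ _)
        (hψc.stronglyMeasurableAtFilter _ _) hψc.continuousAt
    have hη' : deriv η = ψ := funext fun t => (hηd t).deriv
    have hη1 : ContDiff ℝ 1 η := by
      rw [contDiff_one_iff_deriv, hη']
      exact ⟨fun t => (hηd t).differentiableAt, hψc⟩
    have hsub : Function.support η ⊆ Icc (sInf S) (sSup S) := by
      intro t ht
      by_contra hcon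
      rw [mem_Icc, not_and_or, not_le, not_le] at hcon
      refine ht ?_
      rcases hcon with hlt | hgt
      · simp only [η]
        refine intervalIntegral.integral_zero_ae (Eventually.of_forall fun s hs => hψS s ?_)
        intro hsS
        have h1 := (csInf_le hS.bddBelow hsS)
        have h2 := (hSs hsS).1
        rcases le_total a t with hat | hat
        · rw [uIoc_of_le hat] at hs
          linarith [hs.2]
        · rw [uIoc_of_ge hat] at hs
          linarith [hs.2]
      · have e : η t = η c + ∫ s in c..t, ψ s :=
          (intervalIntegral.integral_add_adjacent_intervals (hψc.intervalIntegrable _ _)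
            (hψc.intervalIntegrable _ _)).symm
        rw [e, show η c = 0 from hψ0, zero_add]
        refine intervalIntegral.integral_zero_ae (Eventually.of_forall fun s hs => hψS s ?_)
        intro hsS
        have h1 := (le_csSup hS.bddAbove hsS)
        have h2 := (hSs hsS).2
        rcases le_total c t with hat | hat
        · rw [uIoc_of_le hat] at hs
          linarith [hs.1]
        · rw [uIoc_of_ge hat] at hs
          linarith [hs.1]
    have hts : tsupport η ⊆ Icc (sInf S) (sSup S) := closure_minimal hsub isClosed_Icc
    have hends : Icc (sInf S) (sSup S) ⊆ Ioo a c := fun t ht =>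
      ⟨(hSs (hS.sInf_mem hSne)).1.trans_le ht.1, ht.2.trans_lt (hSs (hS.sSup_mem hSne)).2⟩
    have h0 := hW η hη1 (HasCompactSupport.of_support_subset_isCompact isCompact_Icc hsub)
      (hts.trans hends)
    rw [hη'] at h0
    have e : ∀ t, ψ t * W t = g t * W t - m * (θ t * W t) := fun t => by simp only [ψ]; ring
    simp_rw [e] at h0
    rw [intervalIntegral.integral_sub (hWi g hg1.continuous)
      ((hWi θ hθ1.continuous).const_mul _), intervalIntegral.integral_const_mul] at h0
    linarith
  have hae : ∀ᵐ t, t ∈ Ioo a c → W t - C = 0 := by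
    refine isOpen_Ioo.ae_eq_zero_of_integral_contDiff_smul_eq_zero
      (((hWc.sub continuousOn_const).mono Ioo_subset_Icc_self).locallyIntegrableOn
        measurableSet_Ioo) fun g hg1 hg2 hg3 => ?_
    have e : ∫ t, g t • (W t - C) = ∫ t in a..c, g t * (W t - C) := by
      rw [intervalIntegral.integral_of_le hac.le,
        setIntegral_eq_integral_of_forall_compl_eq_zero]
      · rfl
      · exact fun x hx => by
          rw [image_eq_zero_of_notMem_tsupport fun hx' => hx (Ioo_subset_Ioc_self (hg3 hx')),
            zero_mul]
    rw [e]
    simp_rw [mul_sub]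
    rw [intervalIntegral.integral_sub (hWi g hg1.continuous)
      ((hg1.continuous.intervalIntegrable _ _).mul_const _), intervalIntegral.integral_mul_const,
      horth g hg1 hg2 hg3, sub_self]
  -- by continuity `W` is constant on the closed interval
  have heq : EqOn W (fun _ => C) (Icc a c) := by
    have h1 : W =ᵐ[volume.restrict (Ioo a c)] fun _ => C := by
      rw [EventuallyEq, ae_restrict_iff' measurableSet_Ioo]
      filter_upwards [hae] with t ht ht'
      exact sub_eq_zero.1 (ht ht')
    have h2 : EqOn W (fun _ => C) (Ioo a c) :=
      Measure.eqOn_open_of_ae_eq h1 isOpen_Ioo (hWc.mono Ioo_subset_Icc_self) continuousOn_const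
    have h3 := h2.of_subset_closure hWc continuousOn_const Ioo_subset_Icc_self
      (by rw [closure_Ioo hac.ne])
    exact h3
  intro t ht
  have h1 := heq ht
  have h2 := heq (left_mem_Icc.2 hac.le)
  simp only [W, J, intervalIntegral.integral_same, add_zero] at h1 h2
  linarith

/-- The chain rule for a primitive of an integrable function and a Lipschitz `C¹` function. -/
lemma chain_rule_primitive {a c : ℝ} {β β' : ℝ → ℝ} (hβ : ∀ r, HasDerivAt β (β' r) r) {L : NNReal}
    (hL : LipschitzWith L β) {G : ℝ → ℝ} (hG : IntervalIntegrable G volume a c) (r : ℝ) :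
    β r - β (r - ∫ s in a..c, G s) = ∫ t in a..c, β' (r - ∫ s in a..t, G s) * G t := by
  let h : ℝ → ℝ := fun t => r - ∫ s in a..t, G s
  have hac : AbsolutelyContinuousOnInterval h a c := by
    have h1 : AbsolutelyContinuousOnInterval (fun _ : ℝ => r) a c :=
      (contDiff_const (n := 1)).contDiffOn.absolutelyContinuousOnInterval
    exact h1.sub (hG.absolutelyContinuousOnInterval_intervalIntegral (by simp))
  have hβac : AbsolutelyContinuousOnInterval (fun t => β (h t)) a c := by
    rw [absolutelyContinuousOnInterval_iff] at hac ⊢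
    intro ε hε
    obtain ⟨δ, hδ, H⟩ := hac (ε / (L + 1)) (by positivity)
    refine ⟨δ, hδ, fun E hE hE' => ?_⟩
    have h1 := H E hE hE'
    rw [lt_div_iff₀ (by positivity)] at h1
    calc _ ≤ ∑ i ∈ Finset.range E.1, (L : ℝ) * dist (h (E.2 i).1) (h (E.2 i).2) :=
          Finset.sum_le_sum fun i _ => hL.dist_le_mul _ _
      _ = (∑ i ∈ Finset.range E.1, dist (h (E.2 i).1) (h (E.2 i).2)) * L := by
          rw [← Finset.mul_sum, mul_comm]
      _ ≤ (∑ i ∈ Finset.range E.1, dist (h (E.2 i).1) (h (E.2 i).2)) * (L + 1) := by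
          refine mul_le_mul_of_nonneg_left (by linarith) ?_
          exact Finset.sum_nonneg fun _ _ => dist_nonneg
      _ < ε := h1
  have h1 := hβac.integral_deriv_eq_sub
  have h2 : ∫ t in a..c, deriv (fun t => β (h t)) t = ∫ t in a..c, -(β' (h t) * G t) := by
    refine intervalIntegral.integral_congr_ae ?_
    filter_upwards [hG.ae_hasDerivAt_integral] with x hx hx'
    have h3 := (hx (uIoc_subset_uIcc hx') a (by simp)).const_sub r
    have h4 := (hβ (h x)).comp x h3
    rw [show (fun t => β (h t)) = β ∘ h from rfl, h4.deriv]
    ring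
  rw [h2, intervalIntegral.integral_neg] at h1
  simp only [h, intervalIntegral.integral_same, sub_zero] at h1
  linarith

/-! ### Truncations of the entropy -/

/-- The primitive of the truncated logarithm that vanishes at `1`: a convex function of linear
growth that increases to the entropy function as `n → ∞`. -/
def truncEntropy (n : ℕ) (r : ℝ) : ℝ := ∫ s in (1 : ℝ)..r, Real.log (trunc n s)

lemma continuous_log_trunc (n : ℕ) : Continuous (fun s => Real.log (trunc n s)) :=
  (continuous_trunc n).log fun s => (trunc_pos n s).ne'

lemma abs_log_trunc_le (n : ℕ) (s : ℝ) : |Real.log (trunc n s)| ≤ Real.log ((n : ℝ) + 1) := by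
  have hn : (0 : ℝ) < (n : ℝ) + 1 := by positivity
  have h1 := Real.log_le_log (by positivity) (one_div_le_trunc n s)
  have h2 := Real.log_le_log (trunc_pos n s) (trunc_le n s)
  rw [one_div, Real.log_inv] at h1
  exact abs_le.2 ⟨h1, h2⟩

lemma log_nat_add_one_nonneg (n : ℕ) : 0 ≤ Real.log ((n : ℝ) + 1) := Real.log_nonneg (by simp)

lemma hasDerivAt_truncEntropy (n : ℕ) (r : ℝ) :
    HasDerivAt (truncEntropy n) (Real.log (trunc n r)) r :=
  intervalIntegral.integral_hasDerivAt_right ((continuous_log_trunc n).intervalIntegrable _ _)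
    ((continuous_log_trunc n).stronglyMeasurableAtFilter _ _) (continuous_log_trunc n).continuousAt

lemma lipschitzWith_truncEntropy (n : ℕ) :
    LipschitzWith (Real.toNNReal (Real.log ((n : ℝ) + 1))) (truncEntropy n) := by
  refine lipschitzWith_of_nnnorm_deriv_le
    (fun r => (hasDerivAt_truncEntropy n r).differentiableAt) fun r => ?_
  rw [(hasDerivAt_truncEntropy n r).deriv, ← NNReal.coe_le_coe, coe_nnnorm,
    Real.coe_toNNReal _ (log_nat_add_one_nonneg n)]
  exact abs_log_trunc_le n r

lemma continuous_truncEntropy (n : ℕ) : Continuous (truncEntropy n) :=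
  (lipschitzWith_truncEntropy n).continuous

lemma abs_truncEntropy_le (n : ℕ) (r : ℝ) :
    |truncEntropy n r| ≤ Real.log ((n : ℝ) + 1) * |r - 1| := by
  rw [truncEntropy, ← Real.norm_eq_abs]
  exact intervalIntegral.norm_integral_le_of_norm_le_const fun s _ => abs_log_trunc_le n s

lemma trunc_le_self {n : ℕ} {s : ℝ} (hs : 1 ≤ s) : trunc n s ≤ s := by
  refine max_le (le_trans ?_ hs) (min_le_left _ _)
  rw [div_le_one (by positivity)]
  simp

lemma self_le_trunc {n : ℕ} {s : ℝ} (hs : s ≤ 1) : s ≤ trunc n s := by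
  refine le_trans ?_ (le_max_right _ _)
  rw [le_min_iff]
  exact ⟨le_rfl, hs.trans (by simp)⟩

lemma one_le_trunc {n : ℕ} {s : ℝ} (hs : 1 ≤ s) : 1 ≤ trunc n s := by
  refine le_trans ?_ (le_max_right _ _)
  rw [le_min_iff]
  exact ⟨hs, by simp⟩

lemma trunc_le_one {n : ℕ} {s : ℝ} (hs : s ≤ 1) : trunc n s ≤ 1 := by
  refine max_le ?_ ((min_le_left _ _).trans hs)
  rw [div_le_one (by positivity)]
  simp

lemma truncEntropy_nonneg (n : ℕ) (r : ℝ) : 0 ≤ truncEntropy n r := by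
  rcases le_total 1 r with h | h
  · exact intervalIntegral.integral_nonneg h fun s hs => Real.log_nonneg (one_le_trunc hs.1)
  · rw [truncEntropy, intervalIntegral.integral_symm, ← intervalIntegral.integral_neg]
    refine intervalIntegral.integral_nonneg h fun s hs => ?_
    rw [neg_nonneg]
    exact Real.log_nonpos (trunc_pos n s).le (trunc_le_one hs.2)

lemma klFun_eq_integral_log (r : ℝ) :
    InformationTheory.klFun r = ∫ s in (1 : ℝ)..r, Real.log s := by
  rw [integral_log, InformationTheory.klFun_apply]
  simp
  ring

lemma truncEntropy_le_klFun (n : ℕ) {r : ℝ} (hr : 0 ≤ r) :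
    truncEntropy n r ≤ InformationTheory.klFun r := by
  rw [klFun_eq_integral_log, truncEntropy]
  have h1 : ∀ p q : ℝ, IntervalIntegrable (fun s => Real.log (trunc n s)) volume p q :=
    fun p q => (continuous_log_trunc n).intervalIntegrable _ _
  rcases le_total 1 r with h | h
  · refine intervalIntegral.integral_mono_on h (h1 _ _) intervalIntegral.intervalIntegrable_log'
      fun s hs => Real.log_le_log (trunc_pos n s) (trunc_le_self hs.1)
  · rw [intervalIntegral.integral_symm, intervalIntegral.integral_symm r 1]
    refine neg_le_neg (intervalIntegral.integral_mono_on_of_le_Ioo h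
      intervalIntegral.intervalIntegrable_log' (h1 _ _) fun s hs =>
        Real.log_le_log (hr.trans_lt hs.1) (self_le_trunc hs.2.le))

lemma tendsto_truncEntropy {r : ℝ} (hr : 0 ≤ r) :
    Tendsto (fun n => truncEntropy n r) atTop (𝓝 (InformationTheory.klFun r)) := by
  rw [klFun_eq_integral_log]
  have hpos : ∀ s ∈ uIoc 1 r, 0 < s := by
    intro s hs
    rcases le_total 1 r with h | h
    · rw [uIoc_of_le h] at hs
      linarith [hs.1]
    · rw [uIoc_of_ge h] at hs
      exact hr.trans_lt hs.1
  refine intervalIntegral.tendsto_integral_filter_of_dominated_convergence (fun s => |Real.log s|)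
    (Eventually.of_forall fun n => (continuous_log_trunc n).aestronglyMeasurable)
    (Eventually.of_forall fun n => Eventually.of_forall fun s hs => ?_)
    intervalIntegral.intervalIntegrable_log'.abs (Eventually.of_forall fun s hs => ?_)
  · have hs0 := hpos s hs
    rw [Real.norm_eq_abs]
    rcases le_total 1 s with h | h
    · rw [abs_of_nonneg (Real.log_nonneg (one_le_trunc h)), abs_of_nonneg (Real.log_nonneg h)]
      exact Real.log_le_log (trunc_pos n s) (trunc_le_self h)
    · rw [abs_of_nonpos (Real.log_nonpos (trunc_pos n s).le (trunc_le_one h)),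
        abs_of_nonpos (Real.log_nonpos hs0.le h)]
      exact neg_le_neg (Real.log_le_log hs0 (self_le_trunc h))
  · exact (tendsto_trunc (hpos s hs).le).log (hpos s hs).ne'

/-! ### Functions on the phase space without Fourier coefficients -/

lemma integral_eq_zero_of_forall_wave {d : ℕ} {V : Type*} [MeasurableSpace V] {π : Measure V}
    {f : Torus d × V → ℝ} (hf : Integrable f (phase d π))
    (h : ∀ k z, ∫ w, f w * wave k z 0 w.1 ∂(phase d π) = 0) (φ : C(Torus d, ℝ)) :
    ∫ w, f w * φ w.1 ∂(phase d π) = 0 := by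
  have hfc : Integrable (fun w => (f w : ℂ)) (phase d π) := hf.ofReal
  have hint : ∀ ψ : C(Torus d, ℂ), Integrable (fun w => (f w : ℂ) * ψ w.1) (phase d π) := by
    intro ψ
    refine hfc.mul_bdd (c := ‖ψ‖) ((ψ.continuous.measurable.comp measurable_fst).aestronglyMeasurable)
      (Eventually.of_forall fun w => ψ.norm_coe_le_norm _)
  let Λ : C(Torus d, ℂ) →ₗ[ℂ] ℂ :=
    { toFun := fun ψ => ∫ w, (f w : ℂ) * ψ w.1 ∂(phase d π)
      map_add' := fun ψ₁ ψ₂ => by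
        rw [← integral_add (hint _) (hint _)]
        simp [mul_add]
      map_smul' := fun r ψ => by
        rw [RingHom.id_apply, smul_eq_mul, ← integral_const_mul]
        congr 1
        ext w
        simp
        ring }
  let Λc : C(Torus d, ℂ) →L[ℂ] ℂ := Λ.mkContinuous (∫ w, ‖f w‖ ∂(phase d π)) fun ψ => by
    rw [← integral_mul_const]
    refine norm_integral_le_of_norm_le (hf.norm.mul_const _) (Eventually.of_forall fun w => ?_)
    rw [norm_mul, Complex.norm_real]
    exact mul_le_mul_of_nonneg_left (ψ.norm_coe_le_norm _) (norm_nonneg _)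
  have hspan : Submodule.span ℂ (range (UnitAddTorus.mFourier (d := Fin d))) ≤ Λc.ker := by
    rw [Submodule.span_le]
    rintro _ ⟨k, rfl⟩
    have hk := hint (UnitAddTorus.mFourier k)
    change ∫ w, (f w : ℂ) * UnitAddTorus.mFourier k w.1 ∂(phase d π) = 0
    have hre := h k 1
    have him := h k (-Complex.I)
    simp only [wave] at hre him
    apply Complex.ext
    · rw [Complex.zero_re, ← hre]
      refine (integral_re hk).symm.trans ?_
      simp
    · rw [Complex.zero_im, ← him]
      refine (integral_im hk).symm.trans ?_
      simp
  have htop : Λc.ker = ⊤ := by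
    rw [eq_top_iff, ← UnitAddTorus.span_mFourier_closure_eq_top]
    exact Submodule.topologicalClosure_minimal _ hspan Λc.isClosed_ker
  have h1 : (⟨fun x => (φ x : ℂ), by fun_prop⟩ : C(Torus d, ℂ)) ∈ Λc.ker := htop ▸ trivial
  have h2 : ∫ w, (f w : ℂ) * (φ w.1 : ℂ) ∂(phase d π) = 0 := h1
  have h3 : ∀ w, (f w : ℂ) * (φ w.1 : ℂ) = ((f w * φ w.1 : ℝ) : ℂ) := fun w => by push_cast; rfl
  simp_rw [h3] at h2
  have h4 := (integral_ofReal (𝕜 := ℂ) (μ := phase d π) (f := fun w => f w * φ w.1)).symm.trans h2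
  exact Complex.ofReal_eq_zero.1 h4

section

variable {d : ℕ} {V : Type*} [MeasurableSpace V] {π : Measure V}

/-- An integrable function on the phase space is determined by its Fourier coefficients in the
position, localized in the velocity. -/
lemma ae_eq_zero_of_forall_wave {f : Torus d × V → ℝ} (hfm : Measurable f)
    (hf : Integrable f (phase d π))
    (h : ∀ A : Set V, MeasurableSet A → ∀ k z,
      ∫ w, f w * (A.indicator 1 w.2 * wave k z 0 w.1) ∂(phase d π) = 0) :
    f =ᵐ[phase d π] 0 := by
  let μ : Measure (Torus d × V) := (phase d π).withDensity fun w => ENNReal.ofReal (f w)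
  let ν : Measure (Torus d × V) := (phase d π).withDensity fun w => ENNReal.ofReal (-f w)
  have : IsFiniteMeasure μ := isFiniteMeasure_withDensity_ofReal hf.2
  have : IsFiniteMeasure ν := isFiniteMeasure_withDensity_ofReal hf.neg.2
  have hmaps : ∀ A : Set V, MeasurableSet A →
      (μ.restrict (univ ×ˢ A)).map Prod.fst = (ν.restrict (univ ×ˢ A)).map Prod.fst := by
    intro A hA
    have hUA : MeasurableSet ((univ : Set (Torus d)) ×ˢ A) := MeasurableSet.univ.prod hA
    refine ext_of_forall_integral_eq_of_IsFiniteMeasure fun φ => ?_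
    have hφm : Measurable fun w : Torus d × V => φ w.1 :=
      φ.continuous.measurable.comp measurable_fst
    have hint : ∀ e : Torus d × V → ℝ, Measurable e → Integrable e (phase d π) →
        Integrable (fun w => e w * (A.indicator 1 w.2 * φ w.1)) (phase d π) := by
      intro e hem he
      have hm : Measurable fun w : Torus d × V => A.indicator (1 : V → ℝ) w.2 * φ w.1 :=
        ((measurable_one.indicator hA).comp measurable_snd).mul hφm
      refine he.mul_bdd (c := ‖φ‖) hm.aestronglyMeasurable (Eventually.of_forall fun w => ?_)
      rw [norm_mul]
      refine (mul_le_mul_of_nonneg_right (?_ : _ ≤ (1 : ℝ)) (norm_nonneg _)).trans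
        ((one_mul _).trans_le (φ.norm_coe_le_norm _))
      by_cases hw : w.2 ∈ A <;> simp [hw]
    have hside : ∀ e : Torus d × V → ℝ, Measurable e →
        ∫ x, φ x ∂((((phase d π).withDensity fun w => ENNReal.ofReal (e w)).restrict
          (univ ×ˢ A)).map Prod.fst) =
        ∫ w, max (e w) 0 * (A.indicator 1 w.2 * φ w.1) ∂(phase d π) := by
      intro e he
      rw [integral_map measurable_fst.aemeasurable φ.continuous.aestronglyMeasurable,
        setIntegral_withDensity_eq_setIntegral_toReal_smul he.ennreal_ofReal
          (Eventually.of_forall fun _ => ENNReal.ofReal_lt_top) _ hUA,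
        ← integral_indicator hUA]
      congr 1
      ext w
      by_cases hw : w.2 ∈ A <;> simp [hw, indicator, ENNReal.toReal_ofReal']
    rw [hside f hfm, hside (fun w => -f w) hfm.neg, ← sub_eq_zero, ← integral_sub
      (hint _ (by fun_prop) hf.pos_part) (hint _ (by fun_prop) hf.neg_part)]
    have e : ∀ w : Torus d × V, max (f w) 0 * (A.indicator 1 w.2 * φ w.1) -
        max (-f w) 0 * (A.indicator 1 w.2 * φ w.1) = f w * A.indicator 1 w.2 * φ w.1 := by
      intro w
      rw [← sub_mul, ← mul_assoc]
      congr 2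
      rcases le_total (f w) 0 with h | h
      · rw [max_eq_right h, max_eq_left (by linarith)]; ring
      · rw [max_eq_left h, max_eq_right (by linarith)]; ring
    simp_rw [e]
    have hfA : Integrable (fun w => f w * A.indicator 1 w.2) (phase d π) := by
      have e2 : (fun w : Torus d × V => f w * A.indicator 1 w.2) = (univ ×ˢ A).indicator f := by
        ext w
        by_cases hw : w.2 ∈ A <;> simp [hw, indicator]
      rw [e2]
      exact hf.indicator hUA
    refine integral_eq_zero_of_forall_wave hfA (fun k z => ?_) φ.toContinuousMap
    simp_rw [mul_assoc]
    exact h A hA k z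
  have hμν : μ = ν := by
    refine Measure.ext_prod fun {B A} hB hA => ?_
    have h1 := congrArg (fun m => m B) (hmaps A hA)
    rw [Measure.map_apply measurable_fst hB, Measure.map_apply measurable_fst hB,
      Measure.restrict_apply (measurable_fst hB), Measure.restrict_apply (measurable_fst hB)] at h1
    have e : Prod.fst ⁻¹' B ∩ (univ : Set (Torus d)) ×ˢ A = B ×ˢ A := by
      ext w; simp
    rwa [e] at h1
  have h2 := (withDensity_eq_iff hfm.ennreal_ofReal.aemeasurable hfm.neg.ennreal_ofReal.aemeasurable
    (Integrable.lintegral_lt_top hf).ne).1 hμν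
  filter_upwards [h2] with w hw
  rcases le_total (f w) 0 with h | h
  · rw [ENNReal.ofReal_of_nonpos h, eq_comm, Pi.neg_apply, ENNReal.ofReal_eq_zero] at hw
    exact le_antisymm h (neg_nonpos.1 hw)
  · rw [Pi.neg_apply, ENNReal.ofReal_of_nonpos (neg_nonpos.2 h), ENNReal.ofReal_eq_zero] at hw
    exact le_antisymm hw h

end

/-! ### The free flow -/

/-- The displacement on the torus after time `t` of a particle with velocity variable `v`. -/
def displacement {d : ℕ} {V : Type*} (b : V → EuclideanSpace ℝ (Fin d)) (t : ℝ) (v : V) : Torus d :=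
  toTorus (t • b v)

lemma continuous_toTorus {d : ℕ} : Continuous (toTorus (d := d)) := by
  refine continuous_pi fun i => ?_
  exact (AddCircle.continuous_mk' (1 : ℝ)).comp (by fun_prop)

@[fun_prop]
lemma measurable_displacement {d : ℕ} {V X : Type*} [MeasurableSpace V] [MeasurableSpace X]
    {b : V → EuclideanSpace ℝ (Fin d)} (hb : Measurable b) {t : X → ℝ} {v : X → V}
    (ht : Measurable t) (hv : Measurable v) :
    Measurable (fun p => displacement b (t p) (v p)) := by
  have h := hb.comp hv
  exact continuous_toTorus.measurable.comp (ht.smul h)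

lemma wave_displacement {d : ℕ} {V : Type*} (b : V → EuclideanSpace ℝ (Fin d)) (k : Fin d → ℤ)
    (z : ℂ) (t : ℝ) (v : V) (y : Torus d) :
    wave k z (-(inner ℝ (frequency k) (b v)) * t) (y + displacement b t v) = wave k z 0 y := by
  rw [displacement, wave_add_toTorus, inner_smul_right]
  congr 1
  ring

lemma measurePreserving_translate {d : ℕ} {W : Type*} [MeasurableSpace W] (ν : Measure W) [SFinite ν]
    {s : W → Torus d} (hs : Measurable s) :
    MeasurePreserving (fun p : Torus d × W => (p.1 + s p.2, p.2))
      ((volume : Measure (Torus d)).prod ν) (volume.prod ν) := by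
  have h1 : MeasurePreserving (fun p : W × Torus d => (p.1, p.2 + s p.1))
      (ν.prod (volume : Measure (Torus d))) (ν.prod volume) := by
    refine (MeasurePreserving.id ν).skew_product (g := fun w x => x + s w) ?_ ?_
    · exact measurable_snd.add (hs.comp measurable_fst)
    · exact Eventually.of_forall fun w => map_add_right_eq_self _ _
  exact (Measure.measurePreserving_swap.comp h1).comp Measure.measurePreserving_swap

lemma measurePreserving_translate_time {d : ℕ} {W : Type*} [MeasurableSpace W] (ν : Measure W)
    [SFinite ν] (τ : Measure ℝ) [SFinite τ] {s : ℝ → W → Torus d}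
    (hs : Measurable (fun p : ℝ × W => s p.1 p.2)) :
    MeasurePreserving (fun q : ℝ × Torus d × W => (q.1, q.2.1 + s q.1 q.2.2, q.2.2))
      (τ.prod ((volume : Measure (Torus d)).prod ν)) (τ.prod (volume.prod ν)) := by
  refine (MeasurePreserving.id τ).skew_product
    (g := fun t (p : Torus d × W) => (p.1 + s t p.2, p.2)) ?_ ?_
  · have h : Measurable (fun q : ℝ × Torus d × W => s q.1 q.2.2) :=
      hs.comp (measurable_fst.prodMk (measurable_snd.comp measurable_snd))
    exact (((measurable_fst.comp measurable_snd).add h)).prodMk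
      (measurable_snd.comp measurable_snd)
  · exact Eventually.of_forall fun t =>
      (measurePreserving_translate ν (hs.comp measurable_prodMk_left)).map_eq

/-! ### The density along the free flow -/

section

variable {d : ℕ} {V : Type*} [MeasurableSpace V] {π : Measure V}
  {b : V → EuclideanSpace ℝ (Fin d)} {a c : ℝ} {g : ℝ × Torus d × V × V → ℝ}

lemma IsDensityPath.integrable_slice {P : ℝ → ProbabilityMeasure (Torus d × V)}
    {ρ : ℝ × Torus d × V → ℝ}
    (hρ : IsDensityPath π a c (fun t => (P t : Measure (Torus d × V))) ρ) {t : ℝ}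
    (ht : t ∈ Icc a c) : Integrable (fun z => ρ (t, z)) (phase d π) := by
  refine integrable_of_lintegral_lt_top (hρ.measurable_slice t) (fun _ => hρ.nonneg _) ?_
  rw [← setLIntegral_univ, ← withDensity_apply _ MeasurableSet.univ, ← hρ.eq t ht]
  exact measure_lt_top _ _

lemma abs_integral_sub_le_iSup {H : ℝ≥0∞} {Q : ProbabilityMeasure (Torus d × V)}
    (hQ : entropy π Q ≤ H) {F F' : Torus d × V → ℝ} (hF : Measurable F) (hF' : Measurable F')
    {C C' : ℝ} (hC : ∀ z, |F z| ≤ C) (hC' : ∀ z, |F' z| ≤ C') :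
    ENNReal.ofReal |∫ z, F z ∂(Q : Measure (Torus d × V)) -
        ∫ z, F' z ∂(Q : Measure (Torus d × V))| ≤
      ⨆ (Q : ProbabilityMeasure (Torus d × V)) (_ : entropy π Q ≤ H),
        ∫⁻ z, ENNReal.ofReal |F z - F' z| ∂(Q : Measure (Torus d × V)) := by
  have h1 : Integrable F (Q : Measure (Torus d × V)) :=
    Integrable.of_bound hF.aestronglyMeasurable C (Eventually.of_forall hC)
  have h2 : Integrable F' (Q : Measure (Torus d × V)) :=
    Integrable.of_bound hF'.aestronglyMeasurable C' (Eventually.of_forall hC')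
  refine le_trans ?_ (le_iSup₂ (f := fun (Q : ProbabilityMeasure (Torus d × V))
    (_ : entropy π Q ≤ H) => ∫⁻ z, ENNReal.ofReal |F z - F' z| ∂(Q : Measure (Torus d × V))) Q hQ)
  have h3 : Integrable (fun z => |F z - F' z|) (Q : Measure (Torus d × V)) := (h1.sub h2).abs
  rw [← integral_sub h1 h2, ← ofReal_integral_eq_lintegral_ofReal h3
    (Eventually.of_forall fun _ => abs_nonneg _)]
  exact ENNReal.ofReal_le_ofReal (abs_integral_le_integral_abs)

variable [IsProbabilityMeasure π]

/-- The net loss rate of a current density `g` in the moving frame of the free flow: the integral of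
`g` over the outgoing velocity. -/
def flowLoss (π : Measure V) (b : V → EuclideanSpace ℝ (Fin d)) (g : ℝ × Torus d × V × V → ℝ)
    (p : ℝ × Torus d × V) : ℝ :=
  ∫ v', g (p.1, p.2.1 + displacement b p.1 p.2.2, p.2.2, v') ∂π

lemma measurable_flowLoss (hb : Measurable b) (hg : Measurable g) :
    Measurable (flowLoss π b g) := by
  have h : Measurable (fun q : (ℝ × Torus d × V) × V =>
      g (q.1.1, q.1.2.1 + displacement b q.1.1 q.1.2.2, q.1.2.2, q.2)) := by fun_prop
  exact h.stronglyMeasurable.integral_prod_right'.measurable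

lemma measurePreserving_timeCollision_displacement (hb : Measurable b) :
    MeasurePreserving (fun q : ℝ × Torus d × V × V =>
        (q.1, q.2.1 + displacement b q.1 q.2.2.1, q.2.2))
      (timeCollision d π a c) (timeCollision d π a c) :=
  measurePreserving_translate_time (π.prod π) _ (s := fun t w => displacement b t w.1)
    (by fun_prop)

lemma measurePreserving_phase_displacement (hb : Measurable b) (t : ℝ) :
    MeasurePreserving (fun p : Torus d × V => (p.1 + displacement b t p.2, p.2))
      (phase d π) (phase d π) :=
  measurePreserving_translate π (s := fun v => displacement b t v) (by fun_prop)

lemma measurePreserving_timePhase_timeCollision :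
    MeasurePreserving (fun q : (ℝ × Torus d × V) × V => (q.1.1, q.1.2.1, q.1.2.2, q.2))
      ((timePhase d π a c).prod π) (timeCollision d π a c) :=
  ((MeasurePreserving.id _).prod measurePreserving_collision).comp (measurePreserving_prodAssoc
    ((volume : Measure ℝ).restrict (Icc a c)) (phase d π) π)

lemma integrable_flowLoss_prod (hb : Measurable b) (hgm : Measurable g)
    (hg : Integrable g (timeCollision d π a c)) :
    Integrable (fun q : (ℝ × Torus d × V) × V =>
      g (q.1.1, q.1.2.1 + displacement b q.1.1 q.1.2.2, q.1.2.2, q.2))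
      ((timePhase d π a c).prod π) := by
  have h1 := ((measurePreserving_timeCollision_displacement (a := a) (c := c) (π := π) hb).comp
    measurePreserving_timePhase_timeCollision).integrable_comp (g := g) hgm.aestronglyMeasurable
  exact h1.2 hg

lemma integrable_flowLoss (hb : Measurable b) (hgm : Measurable g)
    (hg : Integrable g (timeCollision d π a c)) :
    Integrable (flowLoss π b g) (timePhase d π a c) :=
  (integrable_flowLoss_prod hb hgm hg).integral_prod_left

/-- Integration of a current density against a function of the incoming velocity, in the moving
frame of the free flow. -/
lemma integral_mul_flowLoss (hb : Measurable b) (hgm : Measurable g)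
    (hg : Integrable g (timeCollision d π a c)) {F : ℝ × Torus d × V → ℝ} (hF : Measurable F)
    {C : ℝ} (hC : ∀ p, |F p| ≤ C) :
    ∫ q, F (q.1, q.2.1, q.2.2.1) * g q ∂(timeCollision d π a c) =
      ∫ p, F (p.1, p.2.1 + displacement b p.1 p.2.2, p.2.2) * flowLoss π b g p
        ∂(timePhase d π a c) := by
  have hmp := (measurePreserving_timeCollision_displacement (a := a) (c := c) (π := π) hb).comp
    measurePreserving_timePhase_timeCollision
  have hm : Measurable fun q : ℝ × Torus d × V × V => F (q.1, q.2.1, q.2.2.1) * g q :=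
    (hF.comp (by fun_prop)).mul hgm
  have hFp : Measurable fun p : ℝ × Torus d × V =>
      F (p.1, p.2.1 + displacement b p.1 p.2.2, p.2.2) := hF.comp (by fun_prop)
  rw [← hmp.map_eq, integral_map hmp.measurable.aemeasurable hm.aestronglyMeasurable,
    integral_prod]
  · refine integral_congr_ae (Eventually.of_forall fun p => ?_)
    simp only [Function.comp, flowLoss]
    rw [integral_const_mul]
  · exact (integrable_flowLoss_prod hb hgm hg).bdd_mul (c := C)
      (hFp.comp measurable_fst).aestronglyMeasurable (Eventually.of_forall fun q => hC _)

end

section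

variable {d : ℕ} {V : Type*} [TopologicalSpace V] [PolishSpace V]
  [MeasurableSpace V] [BorelSpace V] {π : Measure V} [IsProbabilityMeasure π]
  {σ : V → V → ℝ} {b : V → EuclideanSpace ℝ (Fin d)} {a c : ℝ}
  {P : ℝ → ProbabilityMeasure (Torus d × V)} {ρ : ℝ × Torus d × V → ℝ}
  {Θ : SignedMeasure (ℝ × Torus d × V × V)}

/-- Along a weakly continuous path with bounded entropy, the integrals of a bounded measurable
function are continuous in time. -/
lemma continuousOn_integral_of_entropy_le [LocallyCompactSpace V]
    (hP : ContinuousOn P (Icc a c)) (hH : (⨆ t ∈ Icc a c, entropy π (P t)) < ⊤)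
    {F : Torus d × V → ℝ} (hF : Measurable F) {C : ℝ} (hC : ∀ z, |F z| ≤ C) :
    ContinuousOn (fun t => ∫ z, F z ∂(P t : Measure (Torus d × V))) (Icc a c) := by
  obtain ⟨G, hG1, -, hG3, hG4⟩ := exists_seq_continuous_bounded_tendsto_ae (phase d π) hF hC
  have hlim := tendsto_iSup_lintegral_of_entropy_le (π := π) hH (l := atTop)
    (g := fun n z => |G n z - F z|) (fun n => ((hG1 n).measurable.sub hF).abs)
    (fun _ _ => abs_nonneg _) (C := C + C)
    (fun n z => (abs_sub _ _).trans (add_le_add (hG3 n z) (hC z))) (by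
      filter_upwards [hG4] with z hz
      simpa using (hz.sub_const (F z)).abs)
  have hcont : ∀ n, ContinuousOn (fun t => ∫ z, G n z ∂(P t : Measure (Torus d × V))) (Icc a c) := by
    intro n t ht
    have h1 := ProbabilityMeasure.tendsto_iff_forall_integral_tendsto.1 (hP t ht)
    exact h1 (BoundedContinuousFunction.ofNormedAddCommGroup (G n) (hG1 n) C (hG3 n))
  refine TendstoUniformlyOn.continuousOn (F := fun n t => ∫ z, G n z ∂(P t : Measure (Torus d × V)))
    (p := atTop) ?_ (Frequently.of_forall hcont)
  rw [Metric.tendstoUniformlyOn_iff]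
  intro ε hε
  filter_upwards [hlim.eventually_lt_const (ENNReal.ofReal_pos.2 hε)] with n hn t ht
  have h1 := (abs_integral_sub_le_iSup (le_iSup₂ (f := fun t _ => entropy π (P t)) t ht)
    (hG1 n).measurable hF (hG3 n) hC).trans_lt hn
  rw [dist_comm, Real.dist_eq]
  exact (ENNReal.ofReal_lt_ofReal_iff hε).1 h1

/-- Continuity in time of the integrals of a bounded function that depends continuously on time. -/
lemma continuousOn_integral_of_entropy_le_of_continuous [LocallyCompactSpace V]
    (hP : ContinuousOn P (Icc a c)) (hH : (⨆ t ∈ Icc a c, entropy π (P t)) < ⊤)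
    {F : ℝ → Torus d × V → ℝ} (hF : ∀ t, Measurable (F t)) {C : ℝ} (hC : ∀ t z, |F t z| ≤ C)
    (hFc : ∀ z, Continuous fun t => F t z) :
    ContinuousOn (fun t => ∫ z, F t z ∂(P t : Measure (Torus d × V))) (Icc a c) := by
  intro s hs
  have h1 := continuousOn_integral_of_entropy_le hP hH (hF s) (hC s) s hs
  have hlim := tendsto_iSup_lintegral_of_entropy_le (π := π) hH (l := 𝓝[Icc a c] s)
    (g := fun t z => |F t z - F s z|) (fun t => ((hF t).sub (hF s)).abs)
    (fun _ _ => abs_nonneg _) (C := C + C)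
    (fun n z => (abs_sub _ _).trans (add_le_add (hC _ z) (hC _ z)))
    (Eventually.of_forall fun z => by
      have h2 : Tendsto (fun t => F t z) (𝓝[Icc a c] s) (𝓝 (F s z)) :=
        ((hFc z).tendsto s).mono_left nhdsWithin_le_nhds
      simpa using (h2.sub_const (F s z)).abs)
  have h3 : Tendsto (fun t => ∫ z, F t z ∂(P t : Measure (Torus d × V)) -
      ∫ z, F s z ∂(P t : Measure (Torus d × V))) (𝓝[Icc a c] s) (𝓝 0) := by
    rw [Metric.tendsto_nhds]
    intro ε hε
    filter_upwards [hlim.eventually_lt_const (ENNReal.ofReal_pos.2 hε), self_mem_nhdsWithin]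
      with t ht hts
    have h4 := (abs_integral_sub_le_iSup (le_iSup₂ (f := fun t _ => entropy π (P t)) t hts)
      (hF t) (hF s) (hC t) (hC s)).trans_lt ht
    rw [Real.dist_eq, sub_zero]
    exact (ENNReal.ofReal_lt_ofReal_iff hε).1 h4
  have h5 := h3.add h1
  simp only [sub_add_cancel, zero_add] at h5
  exact h5

/-- The density at time `t`, in the moving frame of the free flow. -/
def flowDensity (b : V → EuclideanSpace ℝ (Fin d)) (ρ : ℝ × Torus d × V → ℝ) (t : ℝ)
    (z : Torus d × V) : ℝ :=
  ρ (t, z.1 + displacement b t z.2, z.2)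

/-- The balance equation in integrated form: in the moving frame of the free flow, the density at
any time differs from the initial one by the accumulated loss. -/
lemma flowDensity_eq_sub_integral [LocallyCompactSpace V] (hA : Admissible π σ b) (hac : a < c)
    (hP : ContinuousOn P (Icc a c)) (hH : (⨆ t ∈ Icc a c, entropy π (P t)) < ⊤)
    (hρ : IsDensityPath π a c (fun t => (P t : Measure (Torus d × V))) ρ)
    (hbal : BalanceEquation b a c P Θ)
    (hΘ : VectorMeasure.map Θ (swapVelocities (d := d) (V := V)) = -Θ)
    {g : ℝ × Torus d × V × V → ℝ} (hgm : Measurable g) (hg : Integrable g (timeCollision d π a c))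
    (hΘg : Θ = (timeCollision d π a c).withDensityᵥ g) {t : ℝ} (ht : t ∈ Icc a c) :
    ∀ᵐ z ∂(phase d π), flowDensity b ρ t z =
      flowDensity b ρ a z - ∫ s in a..t, flowLoss π b g (s, z) := by
  have hb := hA.measurable_drift
  have hρm := hρ.measurable
  have hGm := measurable_flowLoss (π := π) hb hgm
  have hGi := integrable_flowLoss hb hgm hg
  have ha : a ∈ Icc a c := left_mem_Icc.2 hac.le
  have hrm : ∀ s, Measurable (flowDensity b ρ s) := fun s => by unfold flowDensity; fun_prop
  have hri : ∀ s ∈ Icc a c, Integrable (flowDensity b ρ s) (phase d π) := fun s hs =>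
    ((measurePreserving_phase_displacement hb s).integrable_comp
      (hρ.measurable_slice s).aestronglyMeasurable).2 (hρ.integrable_slice hs)
  have hsub : Ioc a t ⊆ Icc a c := fun s hs => ⟨hs.1.le, hs.2.trans ht.2⟩
  have hGt : Integrable (flowLoss π b g) (((volume : Measure ℝ).restrict (Ioc a t)).prod
      (phase d π)) := by
    refine hGi.mono_measure ?_
    exact Measure.prod_mono (Measure.restrict_mono hsub le_rfl) le_rfl
  have hIm : Measurable fun z => ∫ s in a..t, flowLoss π b g (s, z) := by
    simp_rw [intervalIntegral.integral_of_le ht.1]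
    exact (hGm.comp measurable_swap).stronglyMeasurable.integral_prod_right'.measurable
  have hIi : Integrable (fun z => ∫ s in a..t, flowLoss π b g (s, z)) (phase d π) := by
    simp_rw [intervalIntegral.integral_of_le ht.1]
    exact hGt.integral_prod_right
  have hmain := ae_eq_zero_of_forall_wave (π := π) (f := fun z => flowDensity b ρ t z -
      flowDensity b ρ a z + ∫ s in a..t, flowLoss π b g (s, z))
    (((hrm t).sub (hrm a)).add hIm) (((hri t ht).sub (hri a ha)).add hIi) ?_
  · filter_upwards [hmain] with z hz
    simp only [Pi.zero_apply] at hz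
    linarith
  intro A hA' k w
  let χ : V → ℝ := A.indicator 1
  have hχ : Measurable χ := measurable_one.indicator hA'
  have hχ1 : ∀ v, |χ v| ≤ 1 := fun v => by by_cases hv : v ∈ A <;> simp [χ, hv]
  let e : Torus d × V → ℝ := fun z => χ z.2 * wave k w 0 z.1
  have hem : Measurable e := by fun_prop
  have heb : ∀ z, |e z| ≤ ‖w‖ := fun z => by
    rw [abs_mul]
    exact (mul_le_mul (hχ1 _) (abs_wave_le _ _ _ _) (abs_nonneg _) zero_le_one).trans
      (one_mul _).le
  have hei : ∀ f : Torus d × V → ℝ, Integrable f (phase d π) →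
      Integrable (fun z => f z * e z) (phase d π) := fun f hf =>
    hf.mul_bdd (c := ‖w‖) hem.aestronglyMeasurable (Eventually.of_forall heb)
  let F : ℝ → Torus d × V → ℝ := fun s z =>
    χ z.2 * wave k w (-(inner ℝ (frequency k) (b z.2)) * s) z.1
  have hFm : Measurable (fun p : ℝ × Torus d × V => F p.1 p.2) := by fun_prop
  have hFb : ∀ s z, |F s z| ≤ ‖w‖ := fun s z => by
    rw [abs_mul]
    exact (mul_le_mul (hχ1 _) (abs_wave_le _ _ _ _) (abs_nonneg _) zero_le_one).trans
      (one_mul _).le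
  have hFe : ∀ s z, F s (z.1 + displacement b s z.2, z.2) = e z := fun s z => by
    simp only [F, e, wave_displacement]
  let U : ℝ → ℝ := fun s => ∫ z, F s z ∂(P s : Measure (Torus d × V))
  let K : ℝ → ℝ := fun s => ∫ z, e z * flowLoss π b g (s, z) ∂(phase d π)
  have hU : ContinuousOn U (Icc a c) := by
    refine continuousOn_integral_of_entropy_le_of_continuous hP hH
      (fun s => hFm.comp measurable_prodMk_left) hFb fun z => ?_
    simp only [F]
    fun_prop
  have hUr : ∀ s ∈ Icc a c, U s = ∫ z, flowDensity b ρ s z * e z ∂(phase d π) := by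
    intro s hs
    have hm : Measurable fun z => ρ (s, z) * F s z :=
      (hρ.measurable_slice s).mul (hFm.comp measurable_prodMk_left)
    have hmp := measurePreserving_phase_displacement (π := π) hb s
    simp only [U]
    rw [hρ.integral_eq hs, ← hmp.map_eq, integral_map hmp.measurable.aemeasurable
      hm.aestronglyMeasurable]
    simp only [hFe, flowDensity]
    rw [hmp.map_eq]
  have heG : Integrable (fun p => e p.2 * flowLoss π b g p) (timePhase d π a c) :=
    hGi.bdd_mul (c := ‖w‖) (hem.comp measurable_snd).aestronglyMeasurable
      (Eventually.of_forall fun p => heb _)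
  have hK : IntegrableOn K (Icc a c) := heG.integral_prod_left
  have hUK := eq_sub_integral_of_weak_deriv hac hU hK (fun η hη hηc hηs => by
    have h := balance_wave hA hac.le hH hρ hbal hΘ hgm hg hΘg hη hηc hηs hχ hχ1 k w
    obtain ⟨C, hC⟩ := hηc.exists_bound_of_continuous hη.continuous
    obtain ⟨D, hD⟩ := hηc.deriv.exists_bound_of_continuous (hη.continuous_deriv le_rfl)
    have hηm : Measurable η := hη.continuous.measurable
    have hη'm : Measurable (deriv η) := (hη.continuous_deriv le_rfl).measurable
    have hl : ∫ s in Icc a c, deriv η s * U s =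
        ∫ p, ρ p * (deriv η p.1 * F p.1 p.2) ∂(timePhase d π a c) := by
      rw [← integral_path hac.le hρ (F := fun p => deriv η p.1 * F p.1 p.2),
        intervalIntegral.integral_of_le hac.le, integral_Icc_eq_integral_Ioc]
      · simp only [U, integral_const_mul]
      · refine (integrable_density hH hρ).mul_bdd (c := D * ‖w‖)
          ((hη'm.comp measurable_fst).mul hFm).aestronglyMeasurable
          (Eventually.of_forall fun p => ?_)
        rw [norm_mul]
        exact mul_le_mul (hD _) (hFb _ _) (norm_nonneg _) ((norm_nonneg _).trans (hD 0))
    have hr : ∫ s in Icc a c, η s * K s =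
        ∫ q, η q.1 * F q.1 (q.2.1, q.2.2.1) * g q ∂(timeCollision d π a c) := by
      rw [integral_mul_flowLoss hb hgm hg (F := fun p => η p.1 * F p.1 p.2) (C := C * ‖w‖)
        ((hηm.comp measurable_fst).mul hFm), integral_prod]
      · refine integral_congr_ae (Eventually.of_forall fun s => ?_)
        simp only [K]
        rw [← integral_const_mul]
        refine integral_congr_ae (Eventually.of_forall fun z => ?_)
        simp only [hFe s z, mul_assoc]
      · refine hGi.bdd_mul (c := C * ‖w‖) (Measurable.aestronglyMeasurable ?_)
          (Eventually.of_forall fun p => ?_)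
        · exact (hηm.comp measurable_fst).mul (hFm.comp (by fun_prop))
        · rw [norm_mul]
          exact mul_le_mul (hC _) (hFb _ _) (norm_nonneg _) ((norm_nonneg _).trans (hC 0))
      · intro p
        rw [abs_mul]
        exact mul_le_mul (hC _) (hFb _ _) (abs_nonneg _) ((norm_nonneg _).trans (hC 0))
    rw [hl, hr]
    exact h) t ht
  have hsw : ∫ z, (∫ s in a..t, flowLoss π b g (s, z)) * e z ∂(phase d π) = ∫ s in a..t, K s := by
    simp only [intervalIntegral.integral_of_le ht.1, K]
    rw [integral_integral_swap (f := fun s z => e z * flowLoss π b g (s, z))]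
    · refine integral_congr_ae (Eventually.of_forall fun z => ?_)
      simp only
      rw [integral_const_mul, mul_comm]
    · exact hGt.bdd_mul (c := ‖w‖) (hem.comp measurable_snd).aestronglyMeasurable
        (Eventually.of_forall fun p => heb _)
  rw [hUr t ht, hUr a ha, ← hsw] at hUK
  have hsplit : ∀ z : Torus d × V, (flowDensity b ρ t z - flowDensity b ρ a z +
      ∫ s in a..t, flowLoss π b g (s, z)) * (A.indicator 1 z.2 * wave k w 0 z.1) =
      flowDensity b ρ t z * e z - flowDensity b ρ a z * e z +
        (∫ s in a..t, flowLoss π b g (s, z)) * e z := fun z => by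
    simp only [e, χ]
    ring
  simp_rw [hsplit]
  have hd : Integrable (fun z => flowDensity b ρ t z * e z - flowDensity b ρ a z * e z)
      (phase d π) := (hei _ (hri t ht)).sub (hei _ (hri a ha))
  rw [integral_add hd (hei _ hIi), integral_sub (hei _ (hri t ht)) (hei _ (hri a ha))]
  linarith

end

/-! ### The entropy inequality on a time interval -/

section

variable {d : ℕ} {V : Type*} [TopologicalSpace V] [PolishSpace V]
  [MeasurableSpace V] [BorelSpace V] {π : Measure V} [IsProbabilityMeasure π]
  {σ : V → V → ℝ} {b : V → EuclideanSpace ℝ (Fin d)} {a c : ℝ}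
  {P : ℝ → ProbabilityMeasure (Torus d × V)} {ρ : ℝ × Torus d × V → ℝ}
  {Θ : SignedMeasure (ℝ × Torus d × V × V)}

/-- The balance of the truncated entropy: the chain rule is applied in time, separately on almost
every trajectory of the free flow, and then integrated over the phase space. -/
lemma integral_truncEntropy_sub [LocallyCompactSpace V] (hA : Admissible π σ b) (hac : a < c)
    (hP : ContinuousOn P (Icc a c)) (hH : (⨆ t ∈ Icc a c, entropy π (P t)) < ⊤)
    (hρ : IsDensityPath π a c (fun t => (P t : Measure (Torus d × V))) ρ)
    (hbal : BalanceEquation b a c P Θ)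
    (hΘ : VectorMeasure.map Θ (swapVelocities (d := d) (V := V)) = -Θ)
    {g : ℝ × Torus d × V × V → ℝ} (hgm : Measurable g) (hg : Integrable g (timeCollision d π a c))
    (hΘg : Θ = (timeCollision d π a c).withDensityᵥ g) (n : ℕ) :
    ∫ z, truncEntropy n (ρ (a, z)) ∂(phase d π) - ∫ z, truncEntropy n (ρ (c, z)) ∂(phase d π) =
      ∫ q, Real.log (trunc n (ρ (q.1, q.2.1, q.2.2.1))) * g q ∂(timeCollision d π a c) := by
  have hb := hA.measurable_drift
  have hρm := hρ.measurable
  have hGm := measurable_flowLoss (π := π) hb hgm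
  have hGi := integrable_flowLoss hb hgm hg
  have ha : a ∈ Icc a c := left_mem_Icc.2 hac.le
  have hc : c ∈ Icc a c := right_mem_Icc.2 hac.le
  have hβm : Measurable (truncEntropy n) := (continuous_truncEntropy n).measurable
  have hβ'm : Measurable (fun r => Real.log (trunc n r)) := (continuous_log_trunc n).measurable
  have hrm : ∀ s, Measurable (flowDensity b ρ s) := fun s => by unfold flowDensity; fun_prop
  have hri : ∀ s ∈ Icc a c, Integrable (flowDensity b ρ s) (phase d π) := fun s hs =>
    ((measurePreserving_phase_displacement hb s).integrable_comp
      (hρ.measurable_slice s).aestronglyMeasurable).2 (hρ.integrable_slice hs)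
  have hβi : ∀ s ∈ Icc a c, Integrable (fun z => truncEntropy n (flowDensity b ρ s z))
      (phase d π) := fun s hs =>
    ((((hri s hs).sub (integrable_const 1)).abs).const_mul _).mono'
      (hβm.comp (hrm s)).aestronglyMeasurable
      (Eventually.of_forall fun z => abs_truncEntropy_le n _)
  have hflow : ∀ s, ∫ z, truncEntropy n (flowDensity b ρ s z) ∂(phase d π) =
      ∫ z, truncEntropy n (ρ (s, z)) ∂(phase d π) := by
    intro s
    have hmp := measurePreserving_phase_displacement (π := π) hb s
    have hm : Measurable fun z => truncEntropy n (ρ (s, z)) := hβm.comp (hρ.measurable_slice s)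
    conv_rhs => rw [← hmp.map_eq, integral_map hmp.measurable.aemeasurable
      hm.aestronglyMeasurable]
    rfl
  -- the accumulated loss, as a jointly measurable function
  let J : ℝ × Torus d × V → ℝ := fun p =>
    ∫ s, {q : (ℝ × Torus d × V) × ℝ | a < q.2 ∧ q.2 ≤ q.1.1}.indicator
      (fun q => flowLoss π b g (q.2, q.1.2)) (p, s)
  have hJm : Measurable J := by
    have hs : MeasurableSet {q : (ℝ × Torus d × V) × ℝ | a < q.2 ∧ q.2 ≤ q.1.1} :=
      (measurableSet_lt measurable_const measurable_snd).inter
        (measurableSet_le measurable_snd (by fun_prop))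
    have hm : Measurable fun q : (ℝ × Torus d × V) × ℝ => flowLoss π b g (q.2, q.1.2) :=
      hGm.comp (by fun_prop)
    exact (hm.indicator hs).stronglyMeasurable.integral_prod_right'.measurable
  have hJ : ∀ t ∈ Icc a c, ∀ z, J (t, z) = ∫ s in a..t, flowLoss π b g (s, z) := by
    intro t ht z
    rw [intervalIntegral.integral_of_le ht.1, ← integral_indicator measurableSet_Ioc]
    rfl
  let Ψ : ℝ × Torus d × V → ℝ := fun p =>
    Real.log (trunc n (flowDensity b ρ a p.2 - J p)) * flowLoss π b g p
  have hΨi : Integrable Ψ (timePhase d π a c) := by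
    refine hGi.bdd_mul (c := Real.log ((n : ℝ) + 1)) (Measurable.aestronglyMeasurable ?_)
      (Eventually.of_forall fun p => abs_log_trunc_le n _)
    exact hβ'm.comp (((hrm a).comp measurable_snd).sub hJm)
  have hGz : ∀ᵐ z ∂(phase d π), IntervalIntegrable (fun s => flowLoss π b g (s, z)) volume a c := by
    filter_upwards [hGi.prod_left_ae] with z hz
    exact (intervalIntegrable_iff_integrableOn_Icc_of_le hac.le).2 hz
  have hflowt := fun t (ht : t ∈ Icc a c) =>
    flowDensity_eq_sub_integral hA hac hP hH hρ hbal hΘ hgm hg hΘg ht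
  rw [← hflow a, ← hflow c, ← integral_sub (hβi a ha) (hβi c hc),
    integral_mul_flowLoss hb hgm hg (F := fun p => Real.log (trunc n (ρ p)))
      (hβ'm.comp hρm) (fun p => abs_log_trunc_le n _)]
  have h1 : ∫ z, (truncEntropy n (flowDensity b ρ a z) - truncEntropy n (flowDensity b ρ c z))
      ∂(phase d π) = ∫ z, (∫ t in Icc a c, Ψ (t, z)) ∂(phase d π) := by
    refine integral_congr_ae ?_
    filter_upwards [hGz, hflowt c hc] with z hz1 hz2
    rw [hz2, chain_rule_primitive (hasDerivAt_truncEntropy n) (lipschitzWith_truncEntropy n) hz1,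
      intervalIntegral.integral_of_le hac.le, ← integral_Icc_eq_integral_Ioc]
    refine setIntegral_congr_fun measurableSet_Icc fun t ht => ?_
    simp only [Ψ, hJ t ht]
  rw [h1, ← integral_integral_swap (f := fun t z => Ψ (t, z)) hΨi, integral_prod]
  · refine setIntegral_congr_fun measurableSet_Icc fun t ht => ?_
    refine integral_congr_ae ?_
    filter_upwards [hflowt t ht] with z hz
    simp only [Ψ]
    rw [hJ t ht, ← hz]
    rfl
  · refine hGi.bdd_mul (c := Real.log ((n : ℝ) + 1)) (Measurable.aestronglyMeasurable ?_)
      (Eventually.of_forall fun p => abs_log_trunc_le n _)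
    exact hβ'm.comp (hρm.comp (by fun_prop))

/-- The half difference of the truncated logarithms of two densities. Evaluated at the densities of
the two velocities of a collision, it is the test function `ζ` whose action on the current is the
variation of the truncated entropy. -/
def halfLogRatio (n : ℕ) (r s : ℝ) : ℝ :=
  (Real.log (trunc n r) - Real.log (trunc n s)) / 2

lemma abs_halfLogRatio_le (n : ℕ) (r s : ℝ) : |halfLogRatio n r s| ≤ Real.log ((n : ℝ) + 1) := by
  have h1 := abs_le.1 (abs_log_trunc_le n r)
  have h2 := abs_le.1 (abs_log_trunc_le n s)
  rw [halfLogRatio, abs_le]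
  constructor <;> linarith

lemma halfLogRatio_swap (n : ℕ) (r s : ℝ) : halfLogRatio n s r = -halfLogRatio n r s := by
  rw [halfLogRatio, halfLogRatio]
  ring

/-- Truncation of both arguments does not increase the ratio of the larger to the smaller. -/
lemma trunc_div_trunc_le (n : ℕ) {r s : ℝ} (hr : 0 < r) (hrs : r ≤ s) :
    trunc n s / trunc n r ≤ s / r := by
  rw [div_le_div_iff₀ (trunc_pos n r) hr]
  have hn := one_div_le_self_add_one n
  have hn0 : (0 : ℝ) < 1 / ((n : ℝ) + 1) := by positivity
  have hs := hr.trans_le hrs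
  unfold trunc
  generalize 1 / ((n : ℝ) + 1) = l at *
  generalize (n : ℝ) + 1 = u at *
  rcases le_total s l with h | h
  · rw [max_eq_left ((min_le_left _ _).trans h), max_eq_left ((min_le_left _ _).trans (hrs.trans h))]
    nlinarith
  rcases le_total u r with h' | h'
  · rw [min_eq_right h', min_eq_right (h'.trans hrs), max_eq_right hn]
    nlinarith
  have h1 : max l (min s u) ≤ s := max_le h (min_le_left _ _)
  have h2 : r ≤ max l (min r u) := le_max_of_le_right (le_min le_rfl h')
  nlinarith

lemma sqrt_mul_cosh_halfLogRatio_le_of_le (n : ℕ) {r s : ℝ} (hr : 0 < r) (hrs : r ≤ s) :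
    2 * √(r * s) * (Real.cosh (halfLogRatio n r s) - 1) ≤ (√r - √s) ^ 2 := by
  have hs := hr.trans_le hrs
  have h1 : |halfLogRatio n r s| ≤ |Real.log (√s / √r)| := by
    have e1 : halfLogRatio n r s = -(Real.log (trunc n s / trunc n r) / 2) := by
      rw [halfLogRatio, Real.log_div (trunc_pos n s).ne' (trunc_pos n r).ne']
      ring
    have e2 : Real.log (√s / √r) = Real.log (s / r) / 2 := by
      rw [← Real.sqrt_div hs.le, Real.log_sqrt (by positivity)]
    have h0 : 1 ≤ trunc n s / trunc n r := (one_le_div (trunc_pos n r)).2 (trunc_mono n hrs)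
    have h0' : 1 ≤ s / r := (one_le_div hr).2 hrs
    rw [e1, e2, abs_neg, abs_of_nonneg (by have := Real.log_nonneg h0; positivity),
      abs_of_nonneg (by have := Real.log_nonneg h0'; positivity)]
    have := Real.log_le_log (by linarith) (trunc_div_trunc_le n hr hrs)
    linarith
  have h2 := Real.cosh_le_cosh.2 h1
  have hrs' : 0 < √r := Real.sqrt_pos.2 hr
  have hss' : 0 < √s := Real.sqrt_pos.2 hs
  have h3 : Real.cosh (Real.log (√s / √r)) = (√s / √r + √r / √s) / 2 := by
    rw [Real.cosh_log (by positivity), inv_div]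
  calc _ ≤ 2 * √(r * s) * ((√s / √r + √r / √s) / 2 - 1) := by
        rw [← h3]
        exact mul_le_mul_of_nonneg_left (by linarith) (by positivity)
    _ = (√r - √s) ^ 2 := by
        rw [Real.sqrt_mul hr.le]
        field_simp
        ring

/-- The cost of the half difference of the logarithms is at most the integrand of the Dirichlet
form. Without truncation this is an identity; the truncation lowers `|ζ|`. -/
lemma sqrt_mul_cosh_halfLogRatio_le (n : ℕ) {r s : ℝ} (hr : 0 ≤ r) (hs : 0 ≤ s) :
    2 * √(r * s) * (Real.cosh (halfLogRatio n r s) - 1) ≤ (√r - √s) ^ 2 := by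
  rcases hr.eq_or_lt with rfl | hr
  · simp
  rcases hs.eq_or_lt with rfl | hs
  · simp [hr.le]
  rcases le_total r s with h | h
  · exact sqrt_mul_cosh_halfLogRatio_le_of_le n hr h
  · have := sqrt_mul_cosh_halfLogRatio_le_of_le n hs h
    rw [halfLogRatio_swap, Real.cosh_neg, mul_comm s r] at this
    linarith [sub_sq_comm (√r) (√s)]

/-- The entropy inequality over a whole time interval. If the kinematic term is finite, the current
has a density, so that the balance of the truncated entropy applies; the truncation is removed by
Fatou's lemma. -/
theorem entropy_le_add_kinematicTerm [LocallyCompactSpace V] (hA : Admissible π σ b) (hac : a < c)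
    (hPΘ : IsBoundedEntropyPair π a c P Θ) (hbal : BalanceEquation b a c P Θ) :
    entropy π (P a) ≤ entropy π (P c) + (∫⁻ u in Icc a c, dirichletForm π σ (P u)) +
      kinematicTerm π σ a c P Θ := by
  rcases eq_or_ne (kinematicTerm π σ a c P Θ) ⊤ with hR | hR
  · simp [hR]
  have hP := hPΘ.continuousOn
  have hH := hPΘ.bounded_entropy
  have hΘ : VectorMeasure.map Θ (swapVelocities (d := d) (V := V)) = -Θ := hPΘ.antisymm
  have ha : a ∈ Icc a c := left_mem_Icc.2 hac.le
  have hc : c ∈ Icc a c := right_mem_Icc.2 hac.le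
  have hent : ∀ t ∈ Icc a c, entropy π (P t) < ⊤ := fun t ht =>
    (le_iSup₂ (f := fun t _ => entropy π (P t)) t ht).trans_lt hH
  obtain ⟨ρ, hρ⟩ := exists_isDensityPath hac.le hP fun t ht =>
    absolutelyContinuous_of_entropy_lt_top (hent t ht)
  have hΘac := absolutelyContinuous_of_kinematicTerm_ne_top hA hac.le hH hρ hΘ hR
  let g := Θ.rnDeriv (timeCollision d π a c)
  have hgm : Measurable g := SignedMeasure.measurable_rnDeriv _ _
  have hg : Integrable g (timeCollision d π a c) := SignedMeasure.integrable_rnDeriv _ _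
  have hΘg : Θ = (timeCollision d π a c).withDensityᵥ g :=
    (SignedMeasure.withDensityᵥ_rnDeriv_eq _ _ hΘac).symm
  have hρm := hρ.measurable
  let D : ℝ≥0∞ := ∫⁻ u in Icc a c, dirichletForm π σ (P u)
  have hD : ∫⁻ q, ENNReal.ofReal (σ q.2.2.1 q.2.2.2 *
      (√(ρ (q.1, q.2.1, q.2.2.1)) - √(ρ (q.1, q.2.1, q.2.2.2))) ^ 2) ∂(timeCollision d π a c) ≤
      D := by
    have hσ := hA.measurable_kernel
    have hm : Measurable fun q : ℝ × Torus d × V × V => σ q.2.2.1 q.2.2.2 *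
        (√(ρ (q.1, q.2.1, q.2.2.1)) - √(ρ (q.1, q.2.1, q.2.2.2))) ^ 2 :=
      (hσ.comp (measurable_snd.comp measurable_snd)).mul (by fun_prop)
    rw [lintegral_prod _ hm.ennreal_ofReal.aemeasurable]
    refine setLIntegral_mono' measurableSet_Icc fun t ht => ?_
    exact lintegral_sqrt_sub_sqrt_le_dirichletForm hA (hent t ht) (hρ.measurable_slice t)
      (fun _ => hρ.nonneg _) (hρ.eq t ht)
  have hn : ∀ n, ∫⁻ z, ENNReal.ofReal (truncEntropy n (ρ (a, z))) ∂(phase d π) ≤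
      entropy π (P c) + D + kinematicTerm π σ a c P Θ := by
    intro n
    let ζ : ℝ × Torus d × V × V → ℝ := fun q =>
      halfLogRatio n (ρ (q.1, q.2.1, q.2.2.1)) (ρ (q.1, q.2.1, q.2.2.2))
    have hβm : Measurable (truncEntropy n) := (continuous_truncEntropy n).measurable
    have hlm : Measurable (fun r => Real.log (trunc n r)) := (continuous_log_trunc n).measurable
    let ℓ : ℝ × Torus d × V × V → ℝ := fun q => Real.log (trunc n (ρ (q.1, q.2.1, q.2.2.1)))
    have hℓm : Measurable ℓ := hlm.comp (by fun_prop)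
    have hℓb : ∀ q, |ℓ q| ≤ Real.log ((n : ℝ) + 1) := fun q => abs_log_trunc_le n _
    have hζe : ∀ q, ζ q = (1 / 2 : ℝ) • (ℓ q - ℓ (swapVelocities q)) := fun q => by
      simp only [ζ, ℓ, halfLogRatio, swapVelocities, smul_eq_mul]
      ring
    have hζm : Measurable ζ := by
      have h : Measurable fun q => (1 / 2 : ℝ) • (ℓ q - ℓ (swapVelocities q)) := by fun_prop
      exact (funext hζe : ζ = _) ▸ h
    have hζb : ∀ q, |ζ q| ≤ Real.log ((n : ℝ) + 1) := fun q => abs_halfLogRatio_le n _ _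
    have hζa : ∀ q, ζ (swapVelocities q) = -ζ q := fun q => halfLogRatio_swap n _ _
    have hK := ofReal_vectorIntegral_le hA hac.le hH hρ hζm hζb hζa (Θ := Θ)
    have hΘζ : ∫ᵛ q, ζ q ∂•Θ = ∫ q, ℓ q * g q ∂(timeCollision d π a c) := by
      simp_rw [hζe]
      rw [VectorMeasure.integral_fun_smul, VectorMeasure.integral_fun_sub
        (integrable_variation_of_bound Θ hℓm hℓb)
        (integrable_variation_of_bound Θ (hℓm.comp measurable_swapVelocities)
          (fun q => hℓb (swapVelocities q))) (g := fun q => ℓ (swapVelocities q)),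
        vectorIntegral_swapVelocities hΘ, hΘg, vectorIntegral_withDensity hgm hg hℓm hℓb,
        smul_eq_mul]
      ring
    have hbalance := integral_truncEntropy_sub hA hac hP hH hρ hbal hΘ hgm hg hΘg n
    have hcost : ∫⁻ q, ENNReal.ofReal (σ q.2.2.1 q.2.2.2 *
        (2 * √(ρ (q.1, q.2.1, q.2.2.1) * ρ (q.1, q.2.1, q.2.2.2)) * (Real.cosh (ζ q) - 1)))
        ∂(timeCollision d π a c) ≤ D := by
      refine le_trans (lintegral_mono fun q => ENNReal.ofReal_le_ofReal ?_) hD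
      exact mul_le_mul_of_nonneg_left
        (sqrt_mul_cosh_halfLogRatio_le n (hρ.nonneg _) (hρ.nonneg _)) (hA.kernel_nonneg _ _)
    have hint : ∀ t ∈ Icc a c, Integrable (fun z => truncEntropy n (ρ (t, z))) (phase d π) :=
      fun t ht => ((((hρ.integrable_slice ht).sub (integrable_const 1)).abs).const_mul _).mono'
        (hβm.comp (hρ.measurable_slice t)).aestronglyMeasurable
        (Eventually.of_forall fun z => abs_truncEntropy_le n _)
    rw [← ofReal_integral_eq_lintegral_ofReal (hint a ha)
      (Eventually.of_forall fun _ => truncEntropy_nonneg n _)]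
    calc _ ≤ ENNReal.ofReal (∫ z, truncEntropy n (ρ (c, z)) ∂(phase d π)) +
          ENNReal.ofReal (∫ᵛ q, ζ q ∂•Θ) := by
          refine le_trans (ENNReal.ofReal_le_ofReal ?_) ENNReal.ofReal_add_le
          rw [hΘζ, ← hbalance]
          linarith
      _ ≤ entropy π (P c) + (kinematicTerm π σ a c P Θ + D) := by
          refine add_le_add ?_ (hK.trans (add_le_add le_rfl hcost))
          rw [ofReal_integral_eq_lintegral_ofReal (hint c hc)
            (Eventually.of_forall fun _ => truncEntropy_nonneg n _),
            entropy_eq_lintegral_klFun (hρ.measurable_slice c) (fun _ => hρ.nonneg _) (hρ.eq c hc)]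
          exact lintegral_mono fun z =>
            ENNReal.ofReal_le_ofReal (truncEntropy_le_klFun n (hρ.nonneg _))
      _ = _ := by
          rw [add_comm (kinematicTerm π σ a c P Θ), add_assoc]
  rw [entropy_eq_lintegral_klFun (hρ.measurable_slice a) (fun _ => hρ.nonneg _) (hρ.eq a ha)]
  calc _ = ∫⁻ z, liminf (fun n => ENNReal.ofReal (truncEntropy n (ρ (a, z)))) atTop
        ∂(phase d π) := lintegral_congr fun z =>
          ((ENNReal.tendsto_ofReal (tendsto_truncEntropy (hρ.nonneg _))).liminf_eq).symm
    _ ≤ liminf (fun n => ∫⁻ z, ENNReal.ofReal (truncEntropy n (ρ (a, z))) ∂(phase d π)) atTop :=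
        lintegral_liminf_le fun n =>
          ((continuous_truncEntropy n).measurable.comp (hρ.measurable_slice a)).ennreal_ofReal
    _ ≤ _ := liminf_le_of_le (by isBoundedDefault) fun r hr => by
        obtain ⟨n, hrn⟩ := hr.exists
        exact hrn.trans (hn n)

end

/-! ### Restriction to smaller time intervals -/

lemma restrictTime_restrictTime {X : Type*} [MeasurableSpace X] (Θ : SignedMeasure (ℝ × X))
    {s t s' t' : ℝ} (h : Icc s t ⊆ Icc s' t') :
    (Θ.restrict (Icc s' t' ×ˢ univ)).restrict (Icc s t ×ˢ univ) =
      Θ.restrict (Icc s t ×ˢ univ) := by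
  rw [VectorMeasure.restrict_restrict _ (measurableSet_Icc.prod MeasurableSet.univ)
    (measurableSet_Icc.prod MeasurableSet.univ), prod_inter_prod, inter_eq_left.2 h, univ_inter]

lemma IsBalanceTest.mono {d : ℕ} {V : Type*} [TopologicalSpace V] {a c s t : ℝ}
    {φ : ℝ × Torus d × V → ℝ} (h : IsBalanceTest s t φ)
    (hst : Ioo s t ⊆ Ioo a c) : IsBalanceTest a c φ :=
  { h with support_subset := h.support_subset.trans (prod_mono hst subset_rfl) }

lemma IsBalanceTest.eventually_eq_zero {d : ℕ} {V : Type*} [TopologicalSpace V] {s t : ℝ}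
    {φ : ℝ × Torus d × V → ℝ} (h : IsBalanceTest s t φ) {u : ℝ}
    (hu : u ∉ Ioo s t) (z : Torus d × V) : ∀ᶠ p in 𝓝 (u, z), φ p = 0 := by
  have h1 : (u, z) ∉ tsupport φ := fun h' => hu (h.support_subset h').1
  exact notMem_tsupport_iff_eventuallyEq.1 h1

lemma IsDensityPath.mono {d : ℕ} {V : Type*} [MeasurableSpace V] {π : Measure V} {a c s t : ℝ}
    {P : ℝ → ProbabilityMeasure (Torus d × V)} {ρ : ℝ × Torus d × V → ℝ}
    (h : IsDensityPath π a c (fun t => (P t : Measure (Torus d × V))) ρ)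
    (hst : Icc s t ⊆ Icc a c) :
    IsDensityPath π s t (fun t => (P t : Measure (Torus d × V))) ρ :=
  ⟨h.measurable, h.nonneg, fun u hu => h.eq u (hst hu)⟩

lemma lintegral_Icc_add {a s c : ℝ} (F : ℝ → ℝ≥0∞) (has : a ≤ s) (hsc : s ≤ c) :
    (∫⁻ u in Icc a s, F u) + ∫⁻ u in Icc s c, F u = ∫⁻ u in Icc a c, F u := by
  rw [← setLIntegral_congr (Ioc_ae_eq_Icc (a := s) (b := c)),
    ← lintegral_union measurableSet_Ioc (disjoint_left.2 fun u h1 h2 => h2.1.not_ge h1.2),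
    Icc_union_Ioc_eq_Icc has hsc]

lemma BalanceEquation.restrict {d : ℕ} {V : Type*} [TopologicalSpace V] [MeasurableSpace V]
    {b : V → EuclideanSpace ℝ (Fin d)} {a c s t : ℝ} {P : ℝ → ProbabilityMeasure (Torus d × V)}
    {Θ : SignedMeasure (ℝ × Torus d × V × V)} (h : BalanceEquation b a c P Θ) (has : a ≤ s) (hst : s < t)
    (htc : t ≤ c) : BalanceEquation b s t P (restrictTime Θ s t) := by
  intro φ hφ
  have h1 := h φ (hφ.mono (Ioo_subset_Ioo has htc))
  have hS : MeasurableSet (Icc s t ×ˢ (univ : Set (Torus d × V × V))) :=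
    measurableSet_Icc.prod MeasurableSet.univ
  have hzero : ∀ u ∉ Ioo s t, ∀ z : Torus d × V, φ (u, z) = 0 := fun u hu z =>
    (hφ.eventually_eq_zero hu z).self_of_nhds
  have hl : ∀ u ∈ Ioc a c \ Ioc s t, ∫ z : Torus d × V,
      (deriv (fun u => φ (u, z.1, z.2)) u +
        inner ℝ (b z.2) (torusGradient (fun x => φ (u, x, z.2)) z.1))
      ∂(P u : Measure (Torus d × V)) = 0 := by
    intro u hu
    have hu' : u ∉ Ioo s t := fun h' => hu.2 (Ioo_subset_Ioc_self h')
    refine integral_eq_zero_of_ae (Eventually.of_forall fun z => ?_)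
    have hd : deriv (fun u => φ (u, z.1, z.2)) u = 0 := by
      have h2 : (fun u => φ (u, z.1, z.2)) =ᶠ[𝓝 u] fun _ => 0 :=
        (Continuous.tendsto (f := fun u : ℝ => (u, z)) (by fun_prop) u).eventually
          (hφ.eventually_eq_zero hu' z)
      rw [h2.deriv_eq, deriv_const]
    have hg : torusGradient (fun x => φ (u, x, z.2)) z.1 = 0 := by
      simp only [torusGradient, hzero u hu']
      exact gradient_const _ _
    simp [hd, hg]
  have hr : ∫ᵛ z, (φ (z.1, z.2.1, z.2.2.1) - φ (z.1, z.2.1, z.2.2.2)) ∂•(restrictTime Θ s t) =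
      ∫ᵛ z, (φ (z.1, z.2.1, z.2.2.1) - φ (z.1, z.2.1, z.2.2.2)) ∂•Θ := by
    rw [restrictTime, ← VectorMeasure.integral_indicator hS]
    congr 1
    ext z
    by_cases hz : z.1 ∈ Icc s t
    · simp [indicator, hz]
    · have hz' : z.1 ∉ Ioo s t := fun h' => hz (Ioo_subset_Icc_self h')
      simp [indicator, hzero _ hz']
  rw [hr, ← h1, intervalIntegral.integral_of_le hst.le,
    intervalIntegral.integral_of_le (has.trans (hst.le.trans htc))]
  exact (setIntegral_eq_of_subset_of_forall_sdiff_eq_zero measurableSet_Ioc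
    (Ioc_subset_Ioc has htc) hl).symm

section

variable {d : ℕ} {V : Type*} [TopologicalSpace V] [PolishSpace V]
  [MeasurableSpace V] [BorelSpace V] {π : Measure V}
  {σ : V → V → ℝ} {b : V → EuclideanSpace ℝ (Fin d)} {a c s t : ℝ}
  {P : ℝ → ProbabilityMeasure (Torus d × V)} {ρ : ℝ × Torus d × V → ℝ}
  {Θ : SignedMeasure (ℝ × Torus d × V × V)}

lemma IsBoundedEntropyPair.restrict (h : IsBoundedEntropyPair π a c P Θ)
    (hst : Icc s t ⊆ Icc a c) : IsBoundedEntropyPair π s t P (restrictTime Θ s t) where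
  continuousOn := h.continuousOn.mono hst
  bounded_entropy := (biSup_mono fun _ ht => hst ht).trans_lt h.bounded_entropy
  concentrated := restrictTime_restrictTime Θ le_rfl
  antisymm := by
    have hS : MeasurableSet (Icc s t ×ˢ (univ : Set (Torus d × V × V))) :=
      measurableSet_Icc.prod MeasurableSet.univ
    have hsw := measurable_swapVelocities (d := d) (V := V)
    have e : swapVelocities ⁻¹' (Icc s t ×ˢ (univ : Set (Torus d × V × V))) = Icc s t ×ˢ univ := by
      ext q
      simp [swapVelocities]
    have h1 := VectorMeasure.restrict_map Θ hsw hS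
    rw [e] at h1
    refine h1.symm.trans ?_
    have h2 : VectorMeasure.map Θ (swapVelocities (d := d) (V := V)) = -Θ := h.antisymm
    rw [h2, restrictTime]
    ext B hB
    simp [VectorMeasure.restrict_apply, hS, hB]

end

/-! ### Superadditivity in time of the kinematic term -/

/-- A pair of measurable test functions for the kinematic term. -/
structure IsMeasurableTest {d : ℕ} {V : Type*} [MeasurableSpace V]
    (ζ α : ℝ × Torus d × V × V → ℝ) : Prop where
  measurable_current : Measurable ζ
  measurable_weight : Measurable α
  antisymm : ∀ q, ζ (swapVelocities q) = -ζ q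
  bounded : ∃ C : ℝ, ∀ q, |ζ q| ≤ C
  weight_bounds : ∃ m M : ℝ, 0 < m ∧ ∀ q, m ≤ α q ∧ α q ≤ M

/-- The integrand of the kinematic term, for a path with density `ρ` and a current with density
`g`. -/
def kinematicIntegrand {d : ℕ} {V : Type*} (σ : V → V → ℝ) (ρ : ℝ × Torus d × V → ℝ)
    (g ζ α : ℝ × Torus d × V × V → ℝ) (q : ℝ × Torus d × V × V) : ℝ :=
  ζ q * g q - ρ (q.1, q.2.1, q.2.2.1) * σ q.2.2.1 q.2.2.2 *
    ((Real.cosh (ζ q) - 1) * (α q + (α (swapVelocities q))⁻¹))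

section

variable {d : ℕ} {V : Type*} [MeasurableSpace V] {ζ α : ℝ × Torus d × V × V → ℝ}

lemma IsMeasurableTest.zero (h : IsMeasurableTest ζ α) : IsMeasurableTest (fun _ => 0) α :=
  { h with
    measurable_current := measurable_const
    antisymm := fun _ => neg_zero.symm
    bounded := ⟨0, fun _ => by simp⟩ }

/-- Gluing of test functions at the time `m`. -/
lemma IsMeasurableTest.ite {ζ' α' : ℝ × Torus d × V × V → ℝ} (h : IsMeasurableTest ζ α)
    (h' : IsMeasurableTest ζ' α') (m : ℝ) :
    IsMeasurableTest (fun q => if q.1 ≤ m then ζ q else ζ' q)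
      (fun q => if q.1 ≤ m then α q else α' q) := by
  have hS : MeasurableSet {q : ℝ × Torus d × V × V | q.1 ≤ m} :=
    measurableSet_le measurable_fst measurable_const
  obtain ⟨C, hC⟩ := h.bounded
  obtain ⟨C', hC'⟩ := h'.bounded
  obtain ⟨l, u, hl, hlu⟩ := h.weight_bounds
  obtain ⟨l', u', hl', hlu'⟩ := h'.weight_bounds
  refine ⟨h.measurable_current.ite hS h'.measurable_current,
    h.measurable_weight.ite hS h'.measurable_weight, fun q => ?_, ⟨max C C', fun q => ?_⟩,
    ⟨min l l', max u u', lt_min hl hl', fun q => ?_⟩⟩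
  · by_cases hq : q.1 ≤ m
    · simpa [swapVelocities, hq] using h.antisymm q
    · simpa [swapVelocities, hq] using h'.antisymm q
  · by_cases hq : q.1 ≤ m
    · simpa [hq] using Or.inl (hC q)
    · simpa [hq] using Or.inr (hC' q)
  · by_cases hq : q.1 ≤ m
    · simpa [hq] using ⟨Or.inl (hlu q).1, Or.inl (hlu q).2⟩
    · simpa [hq] using ⟨Or.inr (hlu' q).1, Or.inr (hlu' q).2⟩

lemma IsMeasurableTest.integrable_current {π : Measure V} {a c : ℝ} {g : ℝ × Torus d × V × V → ℝ}
    (hg : Integrable g (timeCollision d π a c))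
    (h : IsMeasurableTest ζ α) : Integrable (fun q => ζ q * g q) (timeCollision d π a c) := by
  obtain ⟨C, hC⟩ := h.bounded
  exact hg.bdd_mul (c := C) h.measurable_current.aestronglyMeasurable (Eventually.of_forall hC)

variable {π : Measure V} [IsProbabilityMeasure π] {a c s t : ℝ}

lemma timeCollision_restrict {B : Set ℝ} (hB : MeasurableSet B) :
    (timeCollision d π a c).restrict (B ×ˢ univ) =
      ((volume : Measure ℝ).restrict (B ∩ Icc a c)).prod (collision d π) := by
  rw [← Measure.prod_restrict, Measure.restrict_univ, Measure.restrict_restrict hB]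

lemma timeCollision_restrict_Icc (hst : Icc s t ⊆ Icc a c) :
    (timeCollision d π a c).restrict (Icc s t ×ˢ univ) = timeCollision d π s t := by
  rw [timeCollision_restrict measurableSet_Icc, inter_eq_left.2 hst]

lemma restrictTime_withDensity {g : ℝ × Torus d × V × V → ℝ} (hst : Icc s t ⊆ Icc a c)
    (hg : Integrable g (timeCollision d π a c)) :
    restrictTime ((timeCollision d π a c).withDensityᵥ g) s t =
      (timeCollision d π s t).withDensityᵥ g := by
  have hS : MeasurableSet (Icc s t ×ˢ (univ : Set (Torus d × V × V))) :=
    measurableSet_Icc.prod MeasurableSet.univ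
  ext B hB
  rw [restrictTime, VectorMeasure.restrict_apply _ hS hB, withDensityᵥ_apply hg (hB.inter hS),
    ← timeCollision_restrict_Icc hst, withDensityᵥ_apply hg.restrict hB,
    Measure.restrict_restrict hB]

lemma IsMeasurableTest.integrable_cost {σ : V → V → ℝ} {b : V → EuclideanSpace ℝ (Fin d)}
    {P : ℝ → ProbabilityMeasure (Torus d × V)} {ρ : ℝ × Torus d × V → ℝ} (hA : Admissible π σ b)
    (hH : (⨆ t ∈ Icc a c, entropy π (P t)) < ⊤)
    (hρ : IsDensityPath π a c (fun t => (P t : Measure (Torus d × V))) ρ)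
    (h : IsMeasurableTest ζ α) :
    Integrable (fun q => ρ (q.1, q.2.1, q.2.2.1) * σ q.2.2.1 q.2.2.2 *
      ((Real.cosh (ζ q) - 1) * (α q + (α (swapVelocities q))⁻¹))) (timeCollision d π a c) := by
  obtain ⟨C, hC⟩ := h.bounded
  obtain ⟨l, M, hl, hlM⟩ := h.weight_bounds
  have hζ := h.measurable_current
  have hα := h.measurable_weight
  refine (integrable_density_mul_kernel hA hH hρ).mul_bdd (c := Real.cosh C * (M + l⁻¹))
    (Measurable.aestronglyMeasurable (by fun_prop)) (Eventually.of_forall fun q => ?_)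
  refine abs_cosh_sub_one_mul_le (hC q) ?_
  have h1 := hl.trans_le (hlM q).1
  have h2 := hl.trans_le (hlM (swapVelocities q)).1
  rw [abs_of_nonneg (by positivity)]
  exact add_le_add (hlM q).2 (inv_anti₀ hl (hlM _).1)

lemma IsMeasurableTest.integral_kinematicIntegrand {σ : V → V → ℝ}
    {b : V → EuclideanSpace ℝ (Fin d)} {P : ℝ → ProbabilityMeasure (Torus d × V)}
    {ρ : ℝ × Torus d × V → ℝ} {g : ℝ × Torus d × V × V → ℝ} (hA : Admissible π σ b)
    (hH : (⨆ t ∈ Icc a c, entropy π (P t)) < ⊤)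
    (hρ : IsDensityPath π a c (fun t => (P t : Measure (Torus d × V))) ρ)
    (hgm : Measurable g) (hg : Integrable g (timeCollision d π a c))
    (h : IsMeasurableTest ζ α) :
    (∫ᵛ q, ζ q ∂•((timeCollision d π a c).withDensityᵥ g)) -
      ∫ q, ρ (q.1, q.2.1, q.2.2.1) * σ q.2.2.1 q.2.2.2 *
        ((Real.cosh (ζ q) - 1) * (α q + (α (swapVelocities q))⁻¹)) ∂(timeCollision d π a c) =
      ∫ q, kinematicIntegrand σ ρ g ζ α q ∂(timeCollision d π a c) := by
  obtain ⟨C, hC⟩ := h.bounded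
  rw [vectorIntegral_withDensity hgm hg h.measurable_current hC, ← integral_sub
    (h.integrable_current hg) (h.integrable_cost hA hH hρ)]
  rfl

end

section

variable {d : ℕ} {V : Type*} [TopologicalSpace V] [PolishSpace V]
  [MeasurableSpace V] [BorelSpace V] {π : Measure V} [IsProbabilityMeasure π]
  {σ : V → V → ℝ} {b : V → EuclideanSpace ℝ (Fin d)} {a c m s t : ℝ}
  {P : ℝ → ProbabilityMeasure (Torus d × V)} {ρ : ℝ × Torus d × V → ℝ}
  {Θ : SignedMeasure (ℝ × Torus d × V × V)} {g ζ α : ℝ × Torus d × V × V → ℝ}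

lemma IsCurrentTest.isMeasurableTest (hζ : IsCurrentTest ζ) (hα : IsWeightTest α) :
    IsMeasurableTest ζ α := by
  obtain ⟨C, hC⟩ := hζ.hasCompactSupport.exists_bound_of_continuous hζ.continuous
  obtain ⟨M, hM⟩ := hα.bounded
  obtain ⟨l, hl, hl'⟩ := hα.bounded_below
  exact ⟨hζ.continuous.measurable, hα.continuous.measurable, fun q => hζ.antisymm _ _ _ _,
    ⟨C, hC⟩, ⟨l, M, hl, fun q => ⟨hl' q, hM q⟩⟩⟩

/-- Test functions for the two halves of the time interval can be glued at the intermediate time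
`m`: the current has a density, hence it does not charge that time. -/
lemma ofReal_integral_add_integral_le_kinematicTerm [LocallyCompactSpace V]
    (hA : Admissible π σ b) (ham : a ≤ m) (hmc : m ≤ c)
    (hH : (⨆ t ∈ Icc a c, entropy π (P t)) < ⊤)
    (hρ : IsDensityPath π a c (fun t => (P t : Measure (Torus d × V))) ρ)
    (hgm : Measurable g) (hg : Integrable g (timeCollision d π a c))
    (hΘg : Θ = (timeCollision d π a c).withDensityᵥ g)
    {ζ' α' : ℝ × Torus d × V × V → ℝ} (h : IsMeasurableTest ζ α) (h' : IsMeasurableTest ζ' α') :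
    ENNReal.ofReal (∫ q, kinematicIntegrand σ ρ g ζ α q ∂(timeCollision d π a m) +
      ∫ q, kinematicIntegrand σ ρ g ζ' α' q ∂(timeCollision d π m c)) ≤
      kinematicTerm π σ a c P Θ := by
  have hglue := h.ite h' m
  obtain ⟨C, hC⟩ := hglue.bounded
  obtain ⟨l, M, hl, hlM⟩ := hglue.weight_bounds
  refine le_trans (le_of_eq ?_) (ofReal_le_kinematicTerm_of_measurable hA (ham.trans hmc) hH hρ
    hglue.measurable_current hC hglue.antisymm hglue.measurable_weight hl
    (fun q => (hlM q).1) (fun q => (hlM q).2))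
  have hint : Integrable (kinematicIntegrand σ ρ g (fun q => if q.1 ≤ m then ζ q else ζ' q)
      (fun q => if q.1 ≤ m then α q else α' q)) (timeCollision d π a c) :=
    (hglue.integrable_current hg).sub (hglue.integrable_cost hA hH hρ)
  rw [hΘg, hglue.integral_kinematicIntegrand hA hH hρ hgm hg]
  have hS : MeasurableSet (Iic m ×ˢ (univ : Set (Torus d × V × V))) :=
    measurableSet_Iic.prod MeasurableSet.univ
  have hSc : (Iic m ×ˢ (univ : Set (Torus d × V × V)))ᶜ = Ioi m ×ˢ univ := by
    ext q
    simp
  have h1 : timeCollision d π a m = (timeCollision d π a c).restrict (Iic m ×ˢ univ) := by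
    rw [timeCollision_restrict measurableSet_Iic, inter_comm, ← Ici_inter_Iic, inter_assoc,
      Iic_inter_Iic, inf_eq_right.2 hmc, Ici_inter_Iic]
  have h2 : timeCollision d π m c = (timeCollision d π a c).restrict (Ioi m ×ˢ univ) := by
    rw [timeCollision_restrict measurableSet_Ioi, timeCollision,
      ← Measure.restrict_congr_set (Ioc_ae_eq_Icc (a := m) (b := c)), ← Ici_inter_Iic,
      ← inter_assoc, inter_eq_left.2 (Ioi_subset_Ici ham), Ioi_inter_Iic]
  congr 1
  rw [← integral_add_compl hS hint, hSc, h1, h2]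
  congr 1
  · refine setIntegral_congr_fun hS fun q hq => ?_
    have hq' : q.1 ≤ m := hq.1
    simp [kinematicIntegrand, swapVelocities, hq']
  · refine setIntegral_congr_fun (measurableSet_Ioi.prod MeasurableSet.univ) fun q hq => ?_
    have hq' : ¬ q.1 ≤ m := not_le.2 hq.1
    simp [kinematicIntegrand, swapVelocities, hq']

/-- The kinematic term is superadditive with respect to the time interval. -/
lemma kinematicTerm_add_le [LocallyCompactSpace V] (hA : Admissible π σ b)
    (hPΘ : IsBoundedEntropyPair π a c P Θ) (ham : a ≤ m) (hmc : m ≤ c) :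
    kinematicTerm π σ a m P (restrictTime Θ a m) + kinematicTerm π σ m c P (restrictTime Θ m c) ≤
      kinematicTerm π σ a c P Θ := by
  rcases eq_or_ne (kinematicTerm π σ a c P Θ) ⊤ with hR | hR
  · simp [hR]
  have hac := ham.trans hmc
  have hH := hPΘ.bounded_entropy
  have hΘ : VectorMeasure.map Θ (swapVelocities (d := d) (V := V)) = -Θ := hPΘ.antisymm
  have hent : ∀ t ∈ Icc a c, entropy π (P t) < ⊤ := fun t ht =>
    (le_iSup₂ (f := fun t _ => entropy π (P t)) t ht).trans_lt hH
  obtain ⟨ρ, hρ⟩ := exists_isDensityPath hac hPΘ.continuousOn fun t ht =>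
    absolutelyContinuous_of_entropy_lt_top (hent t ht)
  have hΘac := absolutelyContinuous_of_kinematicTerm_ne_top hA hac hH hρ hΘ hR
  let g := Θ.rnDeriv (timeCollision d π a c)
  have hgm : Measurable g := SignedMeasure.measurable_rnDeriv _ _
  have hg : Integrable g (timeCollision d π a c) := SignedMeasure.integrable_rnDeriv _ _
  have hΘg : Θ = (timeCollision d π a c).withDensityᵥ g :=
    (SignedMeasure.withDensityᵥ_rnDeriv_eq _ _ hΘac).symm
  -- the value at a pair of test functions on a subinterval
  have hval : ∀ s t, s ≤ t → Icc s t ⊆ Icc a c → ∀ ζ α, IsCurrentTest ζ → IsWeightTest α →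
      (∫ᵛ z, ζ z ∂•(restrictTime Θ s t)) - ∫ t in s..t, ∫ z : (Torus d × V) × V,
          σ z.1.2 z.2 * (Real.cosh (ζ (t, z.1.1, z.1.2, z.2)) - 1) *
            (α (t, z.1.1, z.1.2, z.2) + (α (t, z.1.1, z.2, z.1.2))⁻¹)
          ∂((P t : Measure (Torus d × V)).prod π) =
        ∫ q, kinematicIntegrand σ ρ g ζ α q ∂(timeCollision d π s t) := by
    intro s t hst hsub ζ α hζ hα
    have htest := hζ.isMeasurableTest hα
    obtain ⟨C, hC⟩ := htest.bounded
    obtain ⟨l, M, hl, hlM⟩ := htest.weight_bounds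
    have hζm := htest.measurable_current
    have hαm := htest.measurable_weight
    have hHst := (hPΘ.restrict hsub).bounded_entropy
    have hgst : Integrable g (timeCollision d π s t) := by
      rw [← timeCollision_restrict_Icc hsub]
      exact hg.restrict
    rw [← htest.integral_kinematicIntegrand hA hHst (hρ.mono hsub) hgm hgst,
      ← restrictTime_withDensity hsub hg, ← hΘg, ← integral_collisions hA hst hHst (hρ.mono hsub)
      (F := fun q => (Real.cosh (ζ q) - 1) * (α q + (α (swapVelocities q))⁻¹))
      (C := Real.cosh C * (M + l⁻¹)) (by fun_prop)]
    · simp only [swapVelocities, mul_assoc]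
    · intro q
      refine abs_cosh_sub_one_mul_le (hC q) ?_
      have h1 := hl.trans_le (hlM q).1
      have h2 := hl.trans_le (hlM (swapVelocities q)).1
      rw [abs_of_nonneg (by positivity)]
      exact add_le_add (hlM q).2 (inv_anti₀ hl (hlM _).1)
  have hsub1 : Icc a m ⊆ Icc a c := Icc_subset_Icc_right hmc
  have hsub2 : Icc m c ⊆ Icc a c := Icc_subset_Icc_left ham
  -- negative contributions are removed by taking vanishing test functions
  have hkey : ∀ ζ α ζ' α', IsCurrentTest ζ → IsWeightTest α → IsCurrentTest ζ' → IsWeightTest α' →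
      ENNReal.ofReal (∫ q, kinematicIntegrand σ ρ g ζ α q ∂(timeCollision d π a m)) +
        ENNReal.ofReal (∫ q, kinematicIntegrand σ ρ g ζ' α' q ∂(timeCollision d π m c)) ≤
      kinematicTerm π σ a c P Θ := by
    intro ζ α ζ' α' hζ hα hζ' hα'
    have h1 := hζ.isMeasurableTest hα
    have h2 := hζ'.isMeasurableTest hα'
    have h0 : ∀ β q, kinematicIntegrand σ ρ g (fun _ => 0) β q = 0 := fun β q => by
      simp [kinematicIntegrand]
    rcases le_total 0 (∫ q, kinematicIntegrand σ ρ g ζ α q ∂(timeCollision d π a m)) with hx | hx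
    · rcases le_total 0 (∫ q, kinematicIntegrand σ ρ g ζ' α' q ∂(timeCollision d π m c))
        with hy | hy
      · rw [← ENNReal.ofReal_add hx hy]
        exact ofReal_integral_add_integral_le_kinematicTerm hA ham hmc hH hρ hgm hg hΘg h1 h2
      · rw [ENNReal.ofReal_of_nonpos hy, add_zero]
        simpa [h0] using ofReal_integral_add_integral_le_kinematicTerm hA ham hmc hH hρ hgm hg hΘg
          h1 h2.zero
    · rw [ENNReal.ofReal_of_nonpos hx, zero_add]
      simpa [h0] using ofReal_integral_add_integral_le_kinematicTerm hA ham hmc hH hρ hgm hg hΘg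
        h1.zero h2
  have hone : IsWeightTest (fun _ : ℝ × Torus d × V × V => (1 : ℝ)) :=
    ⟨continuous_const, ⟨1, fun _ => le_rfl⟩, ⟨1, one_pos, fun _ => le_rfl⟩⟩
  have hzero : IsCurrentTest (fun _ : ℝ × Torus d × V × V => (0 : ℝ)) :=
    ⟨continuous_const, HasCompactSupport.zero, fun _ _ _ _ => neg_zero.symm⟩
  have hle : kinematicTerm π σ a m P (restrictTime Θ a m) ≤ kinematicTerm π σ a c P Θ := by
    refine iSup₂_le fun ζ hζ => iSup₂_le fun α hα => ?_
    rw [hval a m ham hsub1 ζ α hζ hα]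
    exact le_self_add.trans (hkey ζ α _ _ hζ hα hzero hone)
  refine add_le_of_le_tsub_left_of_le hle ?_
  refine iSup₂_le fun ζ' hζ' => iSup₂_le fun α' hα' => ?_
  rw [hval m c hmc hsub2 ζ' α' hζ' hα']
  refine ENNReal.le_sub_of_add_le_left (hle.trans_lt hR.lt_top).ne ?_
  rw [add_comm]
  refine add_le_of_le_tsub_left_of_le (le_add_self.trans (hkey _ _ ζ' α' hzero hone hζ' hα')) ?_
  refine iSup₂_le fun ζ hζ => iSup₂_le fun α hα => ?_
  rw [hval a m ham hsub1 ζ α hζ hα]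
  refine ENNReal.le_sub_of_add_le_left ENNReal.ofReal_ne_top ?_
  rw [add_comm]
  exact hkey ζ α ζ' α' hζ hα hζ' hα'

/-- The entropy inequality between two times. -/
theorem entropy_le_of_balanceEquation [LocallyCompactSpace V] (hA : Admissible π σ b)
    (hPΘ : IsBoundedEntropyPair π a c P Θ) (hbal : BalanceEquation b a c P Θ) (has : a ≤ s)
    (hst : s ≤ t) (htc : t ≤ c) :
    entropy π (P s) ≤ entropy π (P t) + (∫⁻ u in Icc s t, dirichletForm π σ (P u)) +
      kinematicTerm π σ s t P (restrictTime Θ s t) := by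
  rcases hst.eq_or_lt with rfl | hst
  · exact le_self_add.trans le_self_add
  · exact entropy_le_add_kinematicTerm hA hst (hPΘ.restrict (Icc_subset_Icc has htc))
      (hbal.restrict has hst htc)

/-- Solutions restrict to solutions: since the entropy inequality holds on the complementary time
intervals, there is no room for a strict inequality in between. -/
theorem IsSolution.restrict [LocallyCompactSpace V] (hA : Admissible π σ b)
    {Q : ProbabilityMeasure (Torus d × V)} (h : IsSolution π σ b a c Q P Θ) (has : a ≤ s)
    (hst : s < t) (htc : t ≤ c) : IsSolution π σ b s t (P s) P (restrictTime Θ s t) := by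
  have hsub : Icc s t ⊆ Icc a c := Icc_subset_Icc has htc
  have hat := has.trans hst.le
  have hpair := h.pair.restrict (Icc_subset_Icc le_rfl htc : Icc a t ⊆ Icc a c)
  refine ⟨(le_iSup₂ (f := fun t _ => entropy π (P t)) s (hsub (left_mem_Icc.2 hst.le))).trans_lt
    h.pair.bounded_entropy, h.pair.restrict hsub, rfl, h.balance.restrict has hst htc, ?_⟩
  have hfin := h.entropy_initial
  have h1 := h.entropy_dissipation
  have hE1 := lintegral_Icc_add (fun u => dirichletForm π σ (P u)) hat htc
  have hE2 := lintegral_Icc_add (fun u => dirichletForm π σ (P u)) has hst.le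
  have hR1 := kinematicTerm_add_le hA h.pair hat htc
  have hR2 := kinematicTerm_add_le hA hpair has hst.le
  rw [restrictTime, restrictTime, restrictTime,
    restrictTime_restrictTime Θ (Icc_subset_Icc le_rfl hst.le),
    restrictTime_restrictTime Θ (Icc_subset_Icc has le_rfl)] at hR2
  have hI1 := entropy_le_of_balanceEquation hA h.pair h.balance le_rfl has (hst.le.trans htc)
  have hI2 := entropy_le_of_balanceEquation hA h.pair h.balance hat htc le_rfl
  rw [h.initial] at hI1
  simp only [restrictTime] at *
  set E1 := ∫⁻ u in Icc a s, dirichletForm π σ (P u)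
  set E2 := ∫⁻ u in Icc s t, dirichletForm π σ (P u)
  set E3 := ∫⁻ u in Icc t c, dirichletForm π σ (P u)
  set R1 := kinematicTerm π σ a s P (Θ.restrict (Icc a s ×ˢ univ))
  set R2 := kinematicTerm π σ s t P (Θ.restrict (Icc s t ×ˢ univ))
  set R3 := kinematicTerm π σ t c P (Θ.restrict (Icc t c ×ˢ univ))
  have htot : entropy π (P c) + (E1 + E2 + E3) + (R1 + R2 + R3) ≤ entropy π Q := by
    refine le_trans ?_ h1
    rw [hE2, hE1]
    gcongr
    exact (add_le_add_left hR2 R3).trans hR1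
  have hER : E1 + R1 ≠ ⊤ := by
    refine ((le_trans ?_ htot).trans_lt hfin).ne
    calc E1 + R1 ≤ (E1 + R1) + (entropy π (P c) + E2 + E3 + R2 + R3) := le_self_add
      _ = _ := by ring
  refine (ENNReal.add_le_add_iff_right hER).1 ?_
  calc entropy π (P t) + E2 + R2 + (E1 + R1)
      ≤ (entropy π (P c) + E3 + R3) + E2 + R2 + (E1 + R1) := by gcongr
    _ = entropy π (P c) + (E1 + E2 + E3) + (R1 + R2 + R3) := by ring
    _ ≤ entropy π Q := htot
    _ ≤ entropy π (P s) + E1 + R1 := hI1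
    _ = _ := add_assoc _ _ _

end

end LinearBoltzmann

end

theorem mainTheorem4 {d : ℕ} {V : Type*} [TopologicalSpace V] [PolishSpace V]
    [LocallyCompactSpace V] [MeasurableSpace V] [BorelSpace V]
    (π : Measure V) [IsProbabilityMeasure π]
    (σ : V → V → ℝ) (b : V → EuclideanSpace ℝ (Fin d))
    (hσb : LinearBoltzmann.Admissible π σ b) (T : ℝ) (hT : 0 < T)
    (P : ℝ → ProbabilityMeasure (LinearBoltzmann.Torus d × V))
    (Θ : SignedMeasure (ℝ × LinearBoltzmann.Torus d × V × V)) :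
    (LinearBoltzmann.IsBoundedEntropyPair π 0 T P Θ →
      LinearBoltzmann.BalanceEquation b 0 T P Θ →
      ∀ s t : ℝ, 0 ≤ s → s < t → t ≤ T →
        LinearBoltzmann.entropy π (P s) ≤
          LinearBoltzmann.entropy π (P t) +
            (∫⁻ u in Icc s t, LinearBoltzmann.dirichletForm π σ (P u)) +
            LinearBoltzmann.kinematicTerm π σ s t P (LinearBoltzmann.restrictTime Θ s t)) ∧
    (∀ Q : ProbabilityMeasure (LinearBoltzmann.Torus d × V),
      LinearBoltzmann.IsSolution π σ b 0 T Q P Θ →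
      (∀ t : ℝ, 0 < t → t ≤ T →
        LinearBoltzmann.IsSolution π σ b 0 t Q P (LinearBoltzmann.restrictTime Θ 0 t)) ∧
      (∀ s t : ℝ, 0 ≤ s → s < t → t ≤ T →
        LinearBoltzmann.IsSolution π σ b s t (P s) P (LinearBoltzmann.restrictTime Θ s t))) := by
  refine ⟨fun hPΘ hbal s t hs hst ht =>
    LinearBoltzmann.entropy_le_of_balanceEquation hσb hPΘ hbal hs hst.le ht, fun Q hQ => ?_⟩
  refine ⟨fun t ht htT => ?_, fun s t hs hst ht => hQ.restrict hσb hs hst ht⟩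
  have h := hQ.restrict hσb le_rfl ht htT
  rwa [hQ.initial] at h
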